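/- Let $Q$ be a smooth $n$-dimensional manifold, $k\ge 1$, and let $T^mQ=J^m_0(\mathbb R,Q)$ be the $m$-th order tangent bundle, i.e. the manifold of $m$-jets at $0$ of smooth curves in $Q$, with natural coordinates $(q_0^A,\dots,q_m^A)$, projections $\rho^m_r:T^mQ\to T^rQ$ ($r\le m$), $\beta^m:T^mQ\to Q$, and canonical injections $j_r:T^mQ\to T(T^{r-1}Q)$ over $\rho^m_{r-1}$, which send the jet of $\sigma$ to the velocity at $0$ of the canonical lifting of $\sigma$ to $T^{r-1}Q$. Let $J_r=\sum_{i=0}^{m-r}\frac{(r+i)!}{i!}\,dq_i^A\otimes\frac{\partial}{\partial q_{r+i}^A}$ be the $r$-th vertical endomorphism of $T(T^mQ)$, put $d_{J_r}f=df\circ J_r$ for functions $f$, and let $d_T$ be Tulczyjew's derivation, from forms on $T^mQ$ to forms on $T^{m+1}Q$, determined by $d_Tf=\sum_i q_{i+1}^A\,\partial f/\partial q_i^A$ and $d_T\,d=d\,d_T$. Let $L\in C^\infty(T^kQ)$ be a Lagrangian of order $k$, and on $T^{2k-1}Q$ put $\theta_L=\sum_{r=1}^k\frac{(-1)^{r-1}}{r!}\,d_T^{\,r-1}d_{J_r}L$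 (forms being pulled back to $T^{2k-1}Q$ where necessary) and $\omega_L=-d\theta_L$. The Lagrangian $L$ is called regular if $\omega_L$ is symplectic. The Legendre–Ostrogradsky map $\mathcal{FL}:T^{2k-1}Q\to T^*(T^{k-1}Q)$ is the map over $\rho^{2k-1}_{k-1}$ with $\theta_L(u)=\langle \mathcal{FL}(p),\,T\rho^{2k-1}_{k-1}(u)\rangle$ for all $p\in T^{2k-1}Q$ and $u\in T_p(T^{2k-1}Q)$. Let $\mathcal W=T^{2k-1}Q\times_{T^{k-1}Q}T^*(T^{k-1}Q)$, with projections $\mathrm{pr}_1,\mathrm{pr}_2$; let $\Omega=\mathrm{pr}_2^*\omega_{k-1}$, where $\omega_{k-1}=-d\theta_{k-1}$ is the canonical symplectic form of $T^*(T^{k-1}Q)$; let $H(p,\alpha)=\langle\alpha,j_k(p)\rangle-L(\rho^{2k-1}_k(p))$ for $(p,\alpha)\in\mathcal W$; and let $\mathcal W_o=\{(p,\mathcal{FL}(p)) : p\in T^{2k-1}Q\}\subset\mathcal W$ be the graph of $\mathcal{FL}$. Denote by $\mathfrak X_{\mathcal W_o}(\mathcal W)$ the set of smooth sections of $T\mathcal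 W$ over $\mathcal W_o$ (vector fields in $\mathcal W$ with support on $\mathcal W_o$). **Statement.** If $L$ is regular, then there is a unique $X\in\mathfrak X_{\mathcal W_o}(\mathcal W)$ that is tangent to $\mathcal W_o$ and is a solution of the unified dynamical equation $$\bigl[\,i(X)\Omega-dH\,\bigr]\big|_{\mathcal W_o}=0 ,$$ that is, $\Omega_w(X_w,v)=dH_w(v)$ for all $w\in\mathcal W_o$ and $v\in T_w\mathcal W$. Moreover $X$ is a semispray of type $1$ in $\mathcal W$: for every integral curve $\sigma:I\to\mathcal W_o$ of $X$, where $I\subset\mathbb R$ is an open interval, the curve $\sigma_1=\mathrm{pr}_1\circ\sigma$ is the canonical lifting to $T^{2k-1}Q$ of the curve $\beta^{2k-1}\circ\sigma_1$ in $Q$. -/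

import Mathlib

open Set Filter Topology Manifold Bundle
open scoped ContDiff

noncomputable section

namespace SkinnerRusk

/-! ### Calculus facts behind the manifold structure of jet spaces -/

theorem iteratedDeriv_prodMk {F G : Type*} [NormedAddCommGroup F] [NormedSpace ℝ F]
    [NormedAddCommGroup G] [NormedSpace ℝ G] {f : ℝ → F} {g : ℝ → G} {t : ℝ}
    (hf : ContDiffAt ℝ ∞ f t) (hg : ContDiffAt ℝ ∞ g t) (i : ℕ) :
    iteratedDeriv i (fun s => (f s, g s)) t = (iteratedDeriv i f t, iteratedDeriv i g t) := by
  simp only [iteratedDeriv_eq_iteratedFDeriv]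
  rw [iteratedFDeriv_prodMk hf hg (by exact_mod_cast le_top)]
  rfl

theorem iteratedDeriv_comp_congr {F : Type*} [NormedAddCommGroup F] [NormedSpace ℝ F] (k : ℕ) :
    ∀ {E : Type*} [NormedAddCommGroup E] [NormedSpace ℝ E] {f : E → F} {c d : ℝ → E},
      ContDiffAt ℝ ∞ c 0 → ContDiffAt ℝ ∞ d 0 → ContDiffAt ℝ ∞ f (c 0) →
      (∀ i ≤ k, iteratedDeriv i c 0 = iteratedDeriv i d 0) →
      iteratedDeriv k (f ∘ c) 0 = iteratedDeriv k (f ∘ d) 0 := by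
  induction k with
  | zero =>
    intro E _ _ f c d _ _ _ h
    have := h 0 le_rfl
    simp only [iteratedDeriv_zero] at this
    simp [this]
  | succ k ih =>
    intro E _ _ f c d hc hd hf h
    have h0 : c 0 = d 0 := by simpa using h 0 (Nat.zero_le _)
    have key : ∀ b : ℝ → E, ContDiffAt ℝ ∞ b 0 → ContDiffAt ℝ ∞ f (b 0) →
        deriv (f ∘ b) =ᶠ[𝓝 0]
          ((fun p : E × E => fderiv ℝ f p.1 p.2) ∘ fun t => (b t, deriv b t)) := by
      intro b hb hfb
      have h1 : ∀ᶠ t in 𝓝 (0 : ℝ), DifferentiableAt ℝ b t :=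
        ((hb.of_le (m := 1) (by exact_mod_cast le_top)).eventually (by simp)).mono
          fun t ht => ht.differentiableAt (by simp)
      have h2 : ∀ᶠ x in 𝓝 (b 0), DifferentiableAt ℝ f x :=
        ((hfb.of_le (m := 1) (by exact_mod_cast le_top)).eventually (by simp)).mono
          fun t ht => ht.differentiableAt (by simp)
      filter_upwards [h1, hb.continuousAt.eventually h2] with t ht1 ht2
      exact fderiv_comp_deriv t ht2 ht1
    have hder : ∀ b : ℝ → E, ContDiffAt ℝ ∞ b 0 → ContDiffAt ℝ ∞ (deriv b) 0 := by
      intro b hb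
      have : ContDiffAt ℝ ∞ (fun t => fderiv ℝ b t 1) 0 :=
        (hb.fderiv_right (m := ∞) (by simp)).clm_apply contDiffAt_const
      simpa only [fderiv_apply_one_eq_deriv] using this
    rw [iteratedDeriv_succ', iteratedDeriv_succ', (key c hc hf).iteratedDeriv_eq,
      (key d hd (h0 ▸ hf)).iteratedDeriv_eq]
    refine ih (hc.prodMk (hder c hc)) (hd.prodMk (hder d hd)) ?_ ?_
    · exact ((hf.fderiv_right (m := ∞) (by simp)).comp (c 0, deriv c 0)
        contDiffAt_fst).clm_apply contDiffAt_snd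
    · intro i hi
      rw [iteratedDeriv_prodMk hc (hder c hc), iteratedDeriv_prodMk hd (hder d hd),
        ← iteratedDeriv_succ', ← iteratedDeriv_succ', h i (by omega), h (i + 1) (by omega)]

theorem contDiffAt_iteratedDeriv_param {X F : Type*} [NormedAddCommGroup X] [NormedSpace ℝ X]
    [NormedAddCommGroup F] [NormedSpace ℝ F] {G : X × ℝ → F} {p : X × ℝ}
    (hG : ContDiffAt ℝ ∞ G p) (i : ℕ) :
    ContDiffAt ℝ ∞ (fun q : X × ℝ => iteratedDeriv i (fun s => G (q.1, s)) q.2) p := by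
  induction i with
  | zero => simpa using hG
  | succ i ih =>
    simp only [iteratedDeriv_succ]
    have h : ContDiffAt ℝ ∞ (fun q : X × ℝ =>
        fderiv ℝ (fun s => iteratedDeriv i (fun s => G (q.1, s)) s) q.2 1) p := by
      refine ContDiffAt.clm_apply ?_ contDiffAt_const
      refine ContDiffAt.fderiv (n := ∞) (f := fun (q : X × ℝ) s =>
        iteratedDeriv i (fun s => G (q.1, s)) s) ?_ contDiffAt_snd (by simp)
      exact ContDiffAt.comp (p, p.2) (g := fun q : X × ℝ =>
        iteratedDeriv i (fun s => G (q.1, s)) q.2) (f := fun q : (X × ℝ) × ℝ => (q.1.1, q.2))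
        ih (by fun_prop)
    simpa only [fderiv_apply_one_eq_deriv] using h

/-- The polynomial curve `t ↦ ∑ i, (t ^ i / i!) • y i`. -/
def polyCurve {E : Type*} [NormedAddCommGroup E] [NormedSpace ℝ E] {k : ℕ}
    (y : Fin (k + 1) → E) (t : ℝ) : E :=
  ∑ i : Fin (k + 1), (t ^ (i : ℕ) / (i : ℕ).factorial) • y i

theorem polyCurve_zero {E : Type*} [NormedAddCommGroup E] [NormedSpace ℝ E] {k : ℕ}
    (y : Fin (k + 1) → E) : polyCurve y 0 = y 0 := by
  unfold polyCurve
  rw [Finset.sum_eq_single 0]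
  · simp
  · intro i _ hi
    have : (i : ℕ) ≠ 0 := fun h => hi (Fin.ext h)
    simp [this]
  · simp

theorem contDiff_polyCurve {E : Type*} [NormedAddCommGroup E] [NormedSpace ℝ E] {k : ℕ} :
    ContDiff ℝ ∞ fun p : (Fin (k + 1) → E) × ℝ => polyCurve p.1 p.2 := by
  unfold polyCurve
  fun_prop

theorem contDiff_polyCurve' {E : Type*} [NormedAddCommGroup E] [NormedSpace ℝ E] {k : ℕ}
    (y : Fin (k + 1) → E) : ContDiff ℝ ∞ (polyCurve y) :=
  contDiff_polyCurve.comp (contDiff_const.prodMk contDiff_id)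

theorem iteratedDeriv_polyCurve {E : Type*} [NormedAddCommGroup E] [NormedSpace ℝ E] {k : ℕ}
    (y : Fin (k + 1) → E) (i : Fin (k + 1)) : iteratedDeriv i (polyCurve y) 0 = y i := by
  unfold polyCurve
  have hf : ∀ j : Fin (k + 1), iteratedDeriv i (fun t : ℝ => (t ^ (j : ℕ) / (j : ℕ).factorial) • y j) 0
      = if (i : ℕ) = j then y j else 0 := by
    intro j
    rw [iteratedDeriv_smul_const (by fun_prop)]
    simp only [div_eq_inv_mul]
    rw [iteratedDeriv_const_mul _ (by fun_prop), iteratedDeriv_fun_pow_zero]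
    have : ((j : ℕ).factorial : ℝ) ≠ 0 := by positivity
    split_ifs <;> simp [this]
  rw [iteratedDeriv_fun_sum (fun j _ => by fun_prop), Finset.sum_congr rfl (fun j _ => hf j)]
  simp [← Fin.ext_iff]

/-! ### Higher-order tangent bundles as spaces of jets -/

section Jets

variable (E : Type*) [NormedAddCommGroup E] [NormedSpace ℝ E]
  {Q : Type*} [TopologicalSpace Q] [ChartedSpace E Q]

/-- The curve `σ` is smooth on a neighbourhood of the time `t`. -/
def IsSmoothNear (σ : ℝ → Q) (t : ℝ) : Prop :=
  ∀ᶠ s in 𝓝 t, ContMDiffAt 𝓘(ℝ, ℝ) 𝓘(ℝ, E) ∞ σ s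

variable (Q) in
/-- Curves in `Q` that are smooth near `0` (only their germ at `0` matters). -/
structure JetCurve where
  /-- the underlying function -/
  toFun : ℝ → Q
  smooth : IsSmoothNear E toFun 0

variable {E}

/-- Two curves have the same `k`-jet at `0`: same base point, and the same derivatives up to order
`k` at `0` in the chart at this point. -/
def JetRel (k : ℕ) (σ τ : JetCurve E Q) : Prop :=
  σ.toFun 0 = τ.toFun 0 ∧ ∀ i ≤ k, iteratedDeriv i (chartAt E (σ.toFun 0) ∘ σ.toFun) 0 =
    iteratedDeriv i (chartAt E (σ.toFun 0) ∘ τ.toFun) 0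

variable (E Q) in
/-- The setoid of `k`-jet equivalence. -/
def jetSetoid (k : ℕ) : Setoid (JetCurve E Q) where
  r := JetRel k
  iseqv :=
    { refl := fun _ => ⟨rfl, fun _ _ => rfl⟩
      symm := fun {σ τ} h => ⟨h.1.symm, fun i hi => by rw [← h.1]; exact (h.2 i hi).symm⟩
      trans := fun {σ τ υ} h h' => ⟨h.1.trans h'.1, fun i hi =>
        (h.2 i hi).trans (by have := h'.2 i hi; rwa [← h.1] at this)⟩ }

variable (E Q) in
/-- The `k`-th order tangent bundle `T^k Q = J^k_0(ℝ, Q)`: the set of `k`-jets at `0` of smooth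
curves in `Q`. -/
def JetSpace (k : ℕ) : Type _ := Quotient (jetSetoid E Q k)

theorem isSmoothNear_const (q : Q) (t : ℝ) : IsSmoothNear E (fun _ : ℝ => q) t :=
  Eventually.of_forall fun _ => contMDiffAt_const

theorem IsSmoothNear.shift {σ : ℝ → Q} {t : ℝ} (h : IsSmoothNear E σ t) :
    IsSmoothNear E (fun s => σ (s + t)) 0 := by
  have hc : Tendsto (fun s : ℝ => s + t) (𝓝 0) (𝓝 t) := by
    have : ContinuousAt (fun s : ℝ => s + t) 0 := by fun_prop
    simpa [ContinuousAt] using this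
  refine (hc.eventually h).mono fun s hs => ?_
  exact ContMDiffAt.comp (I' := 𝓘(ℝ, ℝ)) s (g := σ) (f := fun s => s + t) hs
    (by fun_prop : ContDiffAt ℝ ∞ (fun s : ℝ => s + t) s).contMDiffAt

namespace JetSpace

/-- The `k`-jet at `0` of a curve. -/
def jet (k : ℕ) (σ : JetCurve E Q) : JetSpace E Q k := Quotient.mk (jetSetoid E Q k) σ

open Classical in
variable (E) in
/-- The canonical lifting of a curve `σ` to `T^k Q`: at time `t` it is the `k`-jet at `0` of
`s ↦ σ (s + t)`. (At times where `σ` is not smooth, the value is the jet of a constant curve.) -/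
def lift (k : ℕ) (σ : ℝ → Q) (t : ℝ) : JetSpace E Q k :=
  if h : IsSmoothNear E σ t then jet k ⟨fun s => σ (s + t), h.shift⟩
  else jet k ⟨fun _ => σ t, isSmoothNear_const _ _⟩

/-- The projection `β^k : T^k Q → Q`. -/
def base {k : ℕ} (p : JetSpace E Q k) : Q :=
  Quotient.lift (fun σ : JetCurve E Q => σ.toFun 0) (fun σ τ (h : JetRel k σ τ) => h.1) p

/-- The projection `ρ^k_r : T^k Q → T^r Q` for `r ≤ k`. -/
def proj {k r : ℕ} (h : r ≤ k) (p : JetSpace E Q k) : JetSpace E Q r :=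
  Quotient.map' (s₁ := jetSetoid E Q k) (s₂ := jetSetoid E Q r) id
    (fun σ τ (hst : JetRel k σ τ) => ⟨hst.1, fun i hi => hst.2 i (hi.trans h)⟩) p

/-- The natural coordinates `(q_0, …, q_k)` on `T^k Q` induced by a chart `e` of `Q`:
`q_i` is the `i`-th derivative at `0` of the curve read in `e`. -/
def coords {k : ℕ} (e : OpenPartialHomeomorph Q E) (p : JetSpace E Q k) : Fin (k + 1) → E :=
  fun i => iteratedDeriv i (e ∘ (Quotient.out p).toFun) 0

@[simp] theorem base_lift (k : ℕ) (σ : ℝ → Q) (t : ℝ) : (lift E k σ t).base = σ t := by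
  unfold lift
  split_ifs
  · change σ (0 + t) = σ t
    rw [zero_add]
  · rfl

theorem base_out {k : ℕ} (p : JetSpace E Q k) : (Quotient.out p).toFun 0 = p.base := by
  conv_rhs => rw [← Quotient.out_eq p]
  rfl

@[simp] theorem base_proj {k r : ℕ} (h : r ≤ k) (p : JetSpace E Q k) :
    (proj h p).base = p.base := by
  induction p using Quotient.inductionOn
  rfl

theorem coords_zero {k : ℕ} (e : OpenPartialHomeomorph Q E) (p : JetSpace E Q k) :
    coords e p 0 = e p.base := by
  simp [coords, base_out]

/-- The inverse of the natural coordinates: the jet of the polynomial curve with the given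
derivatives. -/
def ofCoords {k : ℕ} (e : OpenPartialHomeomorph Q E) (y : Fin (k + 1) → E) : JetSpace E Q k :=
  lift E k (e.symm ∘ polyCurve y) 0

theorem base_ofCoords {k : ℕ} (e : OpenPartialHomeomorph Q E) (y : Fin (k + 1) → E) :
    (ofCoords e y : JetSpace E Q k).base = e.symm (y 0) := by
  simp [ofCoords, polyCurve_zero]

variable [IsManifold 𝓘(ℝ, E) ∞ Q]

theorem contDiffAt_comp_curve {e : OpenPartialHomeomorph Q E} (he : e ∈ atlas E Q) {σ : ℝ → Q}
    {t : ℝ} (hσ : ContMDiffAt 𝓘(ℝ, ℝ) 𝓘(ℝ, E) ∞ σ t) (hs : σ t ∈ e.source) :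
    ContDiffAt ℝ ∞ (e ∘ σ) t := by
  rw [← contMDiffAt_iff_contDiffAt]
  exact (contMDiffAt_of_mem_maximalAtlas (IsManifold.subset_maximalAtlas he) hs).comp t hσ

theorem isSmoothNear_symm_comp {e : OpenPartialHomeomorph Q E} (he : e ∈ atlas E Q) {c : ℝ → E}
    (hc : ContDiff ℝ ∞ c) {t : ℝ} (hs : c t ∈ e.target) : IsSmoothNear E (e.symm ∘ c) t := by
  refine (hc.continuous.continuousAt.eventually (e.open_target.mem_nhds hs)).mono fun s hs' => ?_
  exact (contMDiffAt_symm_of_mem_maximalAtlas (IsManifold.subset_maximalAtlas he) hs').comp s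
    hc.contDiffAt.contMDiffAt

/-- The transition maps of `Q` are smooth. -/
theorem contDiffAt_transition {e e' : OpenPartialHomeomorph Q E} (he : e ∈ atlas E Q)
    (he' : e' ∈ atlas E Q) {x : E} (hx : x ∈ e.target) (hx' : e.symm x ∈ e'.source) :
    ContDiffAt ℝ ∞ (e' ∘ e.symm) x := by
  rw [← contMDiffAt_iff_contDiffAt]
  exact (contMDiffAt_of_mem_maximalAtlas (IsManifold.subset_maximalAtlas he') hx').comp x
    (contMDiffAt_symm_of_mem_maximalAtlas (IsManifold.subset_maximalAtlas he) hx)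

theorem iteratedDeriv_chart_congr {e e' : OpenPartialHomeomorph Q E} (he : e ∈ atlas E Q)
    (he' : e' ∈ atlas E Q) {σ τ : JetCurve E Q} {k : ℕ} (h0 : σ.toFun 0 = τ.toFun 0)
    (hs : σ.toFun 0 ∈ e.source) (hs' : σ.toFun 0 ∈ e'.source)
    (h : ∀ i ≤ k, iteratedDeriv i (e ∘ σ.toFun) 0 = iteratedDeriv i (e ∘ τ.toFun) 0) :
    ∀ i ≤ k, iteratedDeriv i (e' ∘ σ.toFun) 0 = iteratedDeriv i (e' ∘ τ.toFun) 0 := by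
  intro i hi
  have key : ∀ υ : JetCurve E Q, υ.toFun 0 = σ.toFun 0 →
      e' ∘ υ.toFun =ᶠ[𝓝 0] (e' ∘ e.symm) ∘ (e ∘ υ.toFun) := by
    intro υ hυ
    have hc : ContinuousAt υ.toFun 0 := υ.smooth.self_of_nhds.continuousAt
    filter_upwards [hc.eventually (e.open_source.mem_nhds (hυ ▸ hs))] with t ht
    simp [e.left_inv ht]
  rw [(key σ rfl).iteratedDeriv_eq, (key τ h0.symm).iteratedDeriv_eq]
  refine iteratedDeriv_comp_congr i (contDiffAt_comp_curve he σ.smooth.self_of_nhds hs)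
    (contDiffAt_comp_curve he τ.smooth.self_of_nhds (h0 ▸ hs))
    (contDiffAt_transition he he' (e.map_source hs) (by simpa [e.left_inv hs] using hs')) ?_
  intro j hj
  exact h j (hj.trans hi)

/-- Equality of `k`-jets can be tested in any chart of the atlas. -/
theorem jetRel_iff {e : OpenPartialHomeomorph Q E} (he : e ∈ atlas E Q) {σ τ : JetCurve E Q}
    {k : ℕ} (hs : σ.toFun 0 ∈ e.source) : JetRel k σ τ ↔ σ.toFun 0 = τ.toFun 0 ∧
      ∀ i ≤ k, iteratedDeriv i (e ∘ σ.toFun) 0 = iteratedDeriv i (e ∘ τ.toFun) 0 := by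
  constructor
  · rintro ⟨h0, h⟩
    exact ⟨h0, iteratedDeriv_chart_congr (chart_mem_atlas E _) he h0 (mem_chart_source E _) hs h⟩
  · rintro ⟨h0, h⟩
    exact ⟨h0, iteratedDeriv_chart_congr he (chart_mem_atlas E _) h0 hs (mem_chart_source E _) h⟩

theorem coords_mk {k : ℕ} {e : OpenPartialHomeomorph Q E} (he : e ∈ atlas E Q)
    (σ : JetCurve E Q) (hs : σ.toFun 0 ∈ e.source) (i : Fin (k + 1)) :
    coords e (jet k σ) i = iteratedDeriv i (e ∘ σ.toFun) 0 := by
  have h : JetRel k (Quotient.out (jet k σ)) σ :=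
    Quotient.mk_out (s := jetSetoid E Q k) σ
  exact ((jetRel_iff he (h.1 ▸ hs)).1 h).2 i (Nat.lt_succ_iff.1 i.2)

theorem ext_coords {k : ℕ} {e : OpenPartialHomeomorph Q E} (he : e ∈ atlas E Q)
    {p p' : JetSpace E Q k} (hp : p.base ∈ e.source) (hp' : p'.base ∈ e.source)
    (h : coords e p = coords e p') : p = p' := by
  rw [← Quotient.out_eq p, ← Quotient.out_eq p']
  refine Quotient.sound (s := jetSetoid E Q k) ((jetRel_iff he (by rwa [base_out])).2 ⟨?_, ?_⟩)
  · rw [base_out, base_out]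
    apply e.injOn hp hp'
    rw [← coords_zero, ← coords_zero, h]
  · intro i hi
    exact congrFun h ⟨i, Nat.lt_succ_iff.2 hi⟩

theorem coords_ofCoords {k : ℕ} {e e' : OpenPartialHomeomorph Q E} (he : e ∈ atlas E Q)
    (he' : e' ∈ atlas E Q) {y : Fin (k + 1) → E} (hy : y 0 ∈ e.target)
    (hy' : e.symm (y 0) ∈ e'.source) (i : Fin (k + 1)) :
    coords e' (ofCoords e y) i = iteratedDeriv i ((e' ∘ e.symm) ∘ polyCurve y) 0 := by
  have hsm : IsSmoothNear E (e.symm ∘ polyCurve y) 0 :=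
    isSmoothNear_symm_comp he (contDiff_polyCurve' y) (by rwa [polyCurve_zero])
  rw [ofCoords, lift, dif_pos hsm, coords_mk he' _ (by simpa [polyCurve_zero] using hy')]
  simp [Function.comp_def]

theorem coords_ofCoords_self {k : ℕ} {e : OpenPartialHomeomorph Q E} (he : e ∈ atlas E Q)
    {y : Fin (k + 1) → E} (hy : y 0 ∈ e.target) : coords e (ofCoords e y) = y := by
  funext i
  rw [coords_ofCoords he he hy (e.map_target hy), ← iteratedDeriv_polyCurve y i]
  apply Filter.EventuallyEq.iteratedDeriv_eq
  have hc : ContinuousAt (polyCurve y) 0 := (contDiff_polyCurve' y).continuous.continuousAt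
  have : e.target ∈ 𝓝 (polyCurve y 0) := e.open_target.mem_nhds (by rwa [polyCurve_zero])
  filter_upwards [hc.eventually this] with t ht
  simp [e.right_inv ht]

/-- The natural chart of `T^k Q` over a chart `e` of `Q`. -/
def natChart (k : ℕ) (e : OpenPartialHomeomorph Q E) (he : e ∈ atlas E Q) :
    PartialEquiv (JetSpace E Q k) (Fin (k + 1) → E) where
  toFun := coords e
  invFun := ofCoords e
  source := {p | p.base ∈ e.source}
  target := {y | y 0 ∈ e.target}
  map_source' p hp := by
    change coords e p 0 ∈ e.target
    rw [coords_zero]; exact e.map_source hp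
  map_target' y hy := by
    change (ofCoords e y).base ∈ e.source
    rw [base_ofCoords]; exact e.map_target hy
  left_inv' p hp := by
    have h0 : coords e p 0 ∈ e.target := by rw [coords_zero]; exact e.map_source hp
    refine ext_coords he ?_ hp (coords_ofCoords_self he h0)
    rw [base_ofCoords]; exact e.map_target h0
  right_inv' y hy := coords_ofCoords_self he hy

theorem natChart_trans_source (k : ℕ) {e e' : OpenPartialHomeomorph Q E} (he : e ∈ atlas E Q)
    (he' : e' ∈ atlas E Q) : ((natChart k e he).symm.trans (natChart k e' he')).source =
      {y | y 0 ∈ (e.symm.trans e').source} := by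
  ext y
  simp [natChart, PartialEquiv.trans_source, base_ofCoords]

theorem contDiffOn_natChart_trans (k : ℕ) {e e' : OpenPartialHomeomorph Q E}
    (he : e ∈ atlas E Q) (he' : e' ∈ atlas E Q) :
    ContDiffOn ℝ ∞ ((natChart k e he).symm.trans (natChart k e' he'))
      ((natChart k e he).symm.trans (natChart k e' he')).source := by
  rw [natChart_trans_source]
  intro y hy
  have hy1 : y 0 ∈ e.target := by simpa using hy.1
  have hy2 : e.symm (y 0) ∈ e'.source := by simpa using hy.2
  have hopen : IsOpen {y : Fin (k + 1) → E | y 0 ∈ (e.symm.trans e').source} :=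
    (e.symm.trans e').open_source.preimage (continuous_apply 0)
  have hmain : ContDiffAt ℝ ∞ (fun z : Fin (k + 1) → E => fun i : Fin (k + 1) =>
      iteratedDeriv i ((e' ∘ e.symm) ∘ polyCurve z) 0) y := by
    rw [contDiffAt_pi]
    intro i
    have hG : ContDiffAt ℝ ∞ ((e' ∘ e.symm) ∘
        fun p : (Fin (k + 1) → E) × ℝ => polyCurve p.1 p.2) (y, 0) := by
      refine ContDiffAt.comp _ ?_ contDiff_polyCurve.contDiffAt
      simpa only [polyCurve_zero] using contDiffAt_transition he he' hy1 hy2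
    exact (contDiffAt_iteratedDeriv_param hG i).comp (f := fun z => (z, (0 : ℝ))) y
      (by fun_prop)
  refine (hmain.congr_of_eventuallyEq ?_).contDiffWithinAt
  filter_upwards [hopen.mem_nhds hy] with z hz
  funext i
  exact coords_ofCoords he he' (by simpa using hz.1) (by simpa using hz.2) i

variable (E Q) in
/-- The manifold structure of `T^k Q`, given by the natural charts. -/
def core (k : ℕ) : ChartedSpaceCore (Fin (k + 1) → E) (JetSpace E Q k) where
  atlas := {c | ∃ (e : OpenPartialHomeomorph Q E) (he : e ∈ atlas E Q), c = natChart k e he}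
  chartAt p := natChart k (chartAt E p.base) (chart_mem_atlas E _)
  mem_chart_source p := mem_chart_source E p.base
  chart_mem_atlas p := ⟨_, _, rfl⟩
  open_source := by
    rintro _ _ ⟨e, he, rfl⟩ ⟨e', he', rfl⟩
    rw [natChart_trans_source]
    exact (e.symm.trans e').open_source.preimage (continuous_apply 0)
  continuousOn_toFun := by
    rintro _ _ ⟨e, he, rfl⟩ ⟨e', he', rfl⟩
    exact (contDiffOn_natChart_trans k he he').continuousOn

instance (k : ℕ) : TopologicalSpace (JetSpace E Q k) := (core E Q k).toTopologicalSpace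

instance (k : ℕ) : ChartedSpace (Fin (k + 1) → E) (JetSpace E Q k) := (core E Q k).toChartedSpace

instance (k : ℕ) : IsManifold 𝓘(ℝ, Fin (k + 1) → E) ∞ (JetSpace E Q k) := by
  apply isManifold_of_contDiffOn
  intro c c' hc hc'
  change c ∈ ⋃ (e) (he : e ∈ (core E Q k).atlas), {(core E Q k).openPartialHomeomorph e he} at hc
  change c' ∈ ⋃ (e) (he : e ∈ (core E Q k).atlas), {(core E Q k).openPartialHomeomorph e he} at hc'
  simp only [mem_iUnion, mem_singleton_iff] at hc hc'
  obtain ⟨_, ⟨e, he, rfl⟩, rfl⟩ := hc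
  obtain ⟨_, ⟨e', he', rfl⟩, rfl⟩ := hc'
  simp only [modelWithCornersSelf_coe, modelWithCornersSelf_coe_symm, Function.comp_id,
    Function.id_comp, preimage_id, range_id, inter_univ]
  exact contDiffOn_natChart_trans k he he'

theorem chartAt_apply {k : ℕ} (p p' : JetSpace E Q k) :
    chartAt (Fin (k + 1) → E) p p' = coords (chartAt E p.base) p' := rfl

theorem chartAt_source {k : ℕ} (p : JetSpace E Q k) :
    (chartAt (Fin (k + 1) → E) p).source = {p' | p'.base ∈ (chartAt E p.base).source} := rfl

theorem coords_proj {k r : ℕ} (h : r ≤ k) {e : OpenPartialHomeomorph Q E} (he : e ∈ atlas E Q)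
    {p : JetSpace E Q k} (hp : p.base ∈ e.source) (i : Fin (r + 1)) :
    coords e (proj h p) i = coords e p (Fin.castLE (by omega) i) := by
  induction p using Quotient.inductionOn with
  | h σ =>
    have h1 := coords_mk (k := r) he σ hp i
    have h2 := coords_mk (k := k) he σ hp (Fin.castLE (by omega) i)
    exact h1.trans h2.symm

theorem contMDiff_proj {k r : ℕ} (h : r ≤ k) :
    ContMDiff 𝓘(ℝ, Fin (k + 1) → E) 𝓘(ℝ, Fin (r + 1) → E) ∞
      (proj h : JetSpace E Q k → JetSpace E Q r) := by
  intro p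
  have h0 : chartAt (Fin (r + 1) → E) (proj h p) (proj h p) ∈
      (chartAt (Fin (r + 1) → E) (proj h p)).target := mem_chart_target _ _
  have h1 : ∀ p' : JetSpace E Q k, p'.base ∈ (chartAt E p.base).source →
      chartAt (Fin (r + 1) → E) (proj h p) (proj h p') =
        fun i => chartAt (Fin (k + 1) → E) p p' (Fin.castLE (by omega) i) := by
    intro p' hp'
    funext i
    rw [chartAt_apply, chartAt_apply, base_proj]
    exact coords_proj h (chart_mem_atlas E _) hp' i
  rw [h1 p (mem_chart_source E _)] at h0
  have hchart : ContMDiffAt 𝓘(ℝ, Fin (k + 1) → E) 𝓘(ℝ, Fin (k + 1) → E) ∞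
      (chartAt (Fin (k + 1) → E) p) p :=
    contMDiffOn_chart.contMDiffAt ((chartAt (Fin (k + 1) → E) p).open_source.mem_nhds
      (mem_chart_source _ p))
  have hlin : ContDiff ℝ ∞ (fun (y : Fin (k + 1) → E) (i : Fin (r + 1)) =>
      y (Fin.castLE (by omega) i)) := by fun_prop
  have hsymm := contMDiffAt_symm_of_mem_maximalAtlas (I := 𝓘(ℝ, Fin (r + 1) → E)) (n := ∞)
    (IsManifold.chart_mem_maximalAtlas (proj h p)) h0
  refine (hsymm.comp p (hlin.contDiffAt.contMDiffAt.comp p hchart)).congr_of_eventuallyEq ?_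
  filter_upwards [(chartAt (Fin (k + 1) → E) p).open_source.mem_nhds (mem_chart_source _ p)]
    with p' hp'
  have hp'' : p'.base ∈ (chartAt E p.base).source := hp'
  have hs : proj h p' ∈ (chartAt (Fin (r + 1) → E) (proj h p)).source := by
    rw [chartAt_source]
    simpa using hp''
  change _ = (chartAt (Fin (r + 1) → E) (proj h p)).symm
    (fun i => chartAt (Fin (k + 1) → E) p p' (Fin.castLE (by omega) i))
  rw [← h1 p' hp'', OpenPartialHomeomorph.left_inv _ hs]

variable (E Q) in
/-- `ρ^k_r` as a smooth map. -/
def projMap {k r : ℕ} (h : r ≤ k) :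
    C^∞⟮𝓘(ℝ, Fin (k + 1) → E), JetSpace E Q k; 𝓘(ℝ, Fin (r + 1) → E), JetSpace E Q r⟯ :=
  ⟨proj h, contMDiff_proj h⟩

end JetSpace

end Jets

/-! ### Differential forms on manifolds -/

section Forms

variable {F : Type*} [NormedAddCommGroup F] [NormedSpace ℝ F]
  {H : Type*} [TopologicalSpace H] (I : ModelWithCorners ℝ F H)
  (M : Type*) [TopologicalSpace M] [ChartedSpace H M]

/-- Differential `1`-forms: fields of covectors. -/
abbrev OneForm : Type _ := (x : M) → TangentSpace I x →L[ℝ] ℝ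

/-- Fields of bilinear forms; the differential `2`-forms below are of this type. -/
abbrev TwoForm : Type _ := (x : M) → TangentSpace I x →L[ℝ] TangentSpace I x →L[ℝ] ℝ

variable {I M}

variable (I) in
/-- The differential `df` of a function, as a `1`-form. -/
def differential (f : M → ℝ) : OneForm I M := fun x => mfderiv I 𝓘(ℝ, ℝ) f x

/-- The expression of a `1`-form in the chart at `x`: its pullback by the inverse chart. -/
def OneForm.inChart (μ : OneForm I M) (x : M) (y : F) : F →L[ℝ] ℝ :=
  (μ ((extChartAt I x).symm y)).comp (mfderiv 𝓘(ℝ, F) I (extChartAt I x).symm y)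

/-- The exterior derivative of a `1`-form (on a manifold without boundary),
`dμ(u, v) = (D_u μ) v - (D_v μ) u`, computed at `x` in the chart at `x`; recall that
`TangentSpace I x` is the model space, identified through this chart. -/
def OneForm.extDeriv (μ : OneForm I M) : TwoForm I M := fun x =>
  let A : F →L[ℝ] F →L[ℝ] ℝ := fderiv ℝ (μ.inChart x) (extChartAt I x x)
  A - A.flip

/-- A `2`-form is nondegenerate. -/
def TwoForm.Nondegenerate (η : TwoForm I M) : Prop :=
  ∀ (x : M) (u : TangentSpace I x), (∀ v : TangentSpace I x, η x u v = 0) → u = 0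

variable {F' : Type*} [NormedAddCommGroup F'] [NormedSpace ℝ F']
  {H' : Type*} [TopologicalSpace H'] {I' : ModelWithCorners ℝ F' H'}
  {M' : Type*} [TopologicalSpace M'] [ChartedSpace H' M']

/-- The pullback `f^* μ` of a `1`-form. -/
def OneForm.pullback (μ : OneForm I M) (f : M' → M) : OneForm I' M' := fun x =>
  (μ (f x)).comp (mfderiv I' I f x)

/-- The pullback `f^* η` of a `2`-form. -/
def TwoForm.pullback (η : TwoForm I M) (f : M' → M) : TwoForm I' M' := fun x =>
  let B : F →L[ℝ] F →L[ℝ] ℝ := η (f x)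
  let D : F' →L[ℝ] F := mfderiv I' I f x
  show F' →L[ℝ] F' →L[ℝ] ℝ from B.bilinearComp D D

end Forms

section Cotangent

variable (F : Type*) [NormedAddCommGroup F] [NormedSpace ℝ F]
  (M : Type*) [TopologicalSpace M] [ChartedSpace F M]

/-- The cotangent space `T^*_x M`. -/
abbrev Cotangent (x : M) : Type _ := TangentSpace 𝓘(ℝ, F) x →L[ℝ] Bundle.Trivial M ℝ x

variable [IsManifold 𝓘(ℝ, F) ∞ M]

/-- The cotangent bundle `T^* M`, a manifold modelled on `F × F^*`. -/
abbrev CotangentBundle : Type _ := TotalSpace (F →L[ℝ] ℝ) (Cotangent F M)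

/-- The canonical `1`-form of `T^* M`: `θ_α (u) = α (Tπ u)`. -/
def canonicalOneForm : OneForm (𝓘(ℝ, F).prod 𝓘(ℝ, F →L[ℝ] ℝ)) (CotangentBundle F M) := fun α =>
  (show TangentSpace 𝓘(ℝ, F) α.proj →L[ℝ] ℝ from α.snd).comp
    (mfderiv (𝓘(ℝ, F).prod 𝓘(ℝ, F →L[ℝ] ℝ)) 𝓘(ℝ, F)
      (TotalSpace.proj : CotangentBundle F M → M) α)

/-- The canonical symplectic form `ω = -dθ` of `T^* M`. -/
def canonicalTwoForm : TwoForm (𝓘(ℝ, F).prod 𝓘(ℝ, F →L[ℝ] ℝ)) (CotangentBundle F M) :=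
  -(canonicalOneForm F M).extDeriv

end Cotangent

/-! ### Geometry of higher-order tangent bundles and Lagrangians of order `k` -/

section Lagrangian

/-- The model of `T^k Q`, when `Q` is modelled on `E`. -/
abbrev modelT (E : Type*) [NormedAddCommGroup E] [NormedSpace ℝ E] (k : ℕ) :
    ModelWithCorners ℝ (Fin (k + 1) → E) (Fin (k + 1) → E) := 𝓘(ℝ, Fin (k + 1) → E)

variable {E : Type*} [NormedAddCommGroup E] [NormedSpace ℝ E]
  {Q : Type*} [TopologicalSpace Q] [ChartedSpace E Q] [IsManifold 𝓘(ℝ, E) ∞ Q]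

/-- The canonical injection `j_{r+1} : T^k Q → T(T^r Q)`, for `r + 1 ≤ k`: the jet of `σ` is sent to
the velocity at `0` of the canonical lifting of `σ` to `T^r Q`, a tangent vector at `ρ^k_r p`. -/
def canonicalInjection {k r : ℕ} (h : r + 1 ≤ k) (p : JetSpace E Q k) :
    TangentSpace (modelT E r) (JetSpace.proj (Nat.le_of_succ_le h) p) :=
  show Fin (r + 1) → E from
    mfderiv 𝓘(ℝ, ℝ) (modelT E r) (JetSpace.lift E r (Quotient.out p).toFun) 0 (1 : ℝ)

/-- The `r`-th vertical endomorphism of `T(T^k Q)`. In natural coordinates it is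
`(v_0, …, v_k) ↦ (0, …, 0, (r!/0!) v_0, ((r+1)!/1!) v_1, …, (k!/(k-r)!) v_{k-r})`: the `i`-th
component is `i!/(i-r)! = i (i-1) ⋯ (i-r+1)` times `v_{i-r}`, and zero for `i < r`. The tangent
space at `p` is identified with the space of the `(v_0, …, v_k)` by the natural chart at `p`. -/
def verticalEndo {k : ℕ} (r : ℕ) (p : JetSpace E Q k) :
    TangentSpace (modelT E k) p →L[ℝ] TangentSpace (modelT E k) p :=
  show (Fin (k + 1) → E) →L[ℝ] (Fin (k + 1) → E) from
    ContinuousLinearMap.pi fun i =>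
      (((i : ℕ).descFactorial r : ℕ) : ℝ) •
        ContinuousLinearMap.proj (R := ℝ) (φ := fun _ : Fin (k + 1) => E)
          ⟨(i : ℕ) - r, lt_of_le_of_lt (Nat.sub_le _ _) i.2⟩

/-- The `r`-th vertical differential of a function, `d_{J_r} f = i(J_r) df = df ∘ J_r`. -/
def verticalDiff {k : ℕ} (r : ℕ) (f : JetSpace E Q k → ℝ) : OneForm (modelT E k) (JetSpace E Q k) :=
  fun p => (differential (modelT E k) f p).comp (verticalEndo r p)

/-- Tulczyjew's derivation `d_T = i_T d + d i_T`, from `1`-forms on `T^k Q` to `1`-forms on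
`T^{k+1} Q`. Here `i_T` is the contraction with the vector field `T = j_{k+1}` along `ρ^{k+1}_k`:
`(i_T μ)(p) = μ (j p)` and `(i_T dμ)_p (v) = dμ (j p, Tρ v)`. In natural coordinates `d_T` is the
derivation such that `d_T f = ∑ q_{i+1} ∂f/∂q_i` and `d_T (dq_i) = dq_{i+1}`. -/
def tulczyjew {k : ℕ} (μ : OneForm (modelT E k) (JetSpace E Q k)) :
    OneForm (modelT E (k + 1)) (JetSpace E Q (k + 1)) := fun p =>
  (μ.extDeriv (JetSpace.proj (Nat.le_succ k) p) (canonicalInjection le_rfl p)).comp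
      (mfderiv (modelT E (k + 1)) (modelT E k) (JetSpace.proj (Nat.le_succ k)) p) +
    differential (modelT E (k + 1))
      (fun p' : JetSpace E Q (k + 1) =>
        μ (JetSpace.proj (Nat.le_succ k) p') (canonicalInjection le_rfl p')) p

/-- The iterates `d_T^s`, from `1`-forms on `T^k Q` to `1`-forms on `T^{k+s} Q`. -/
def tulczyjewIter {k : ℕ} (μ : OneForm (modelT E k) (JetSpace E Q k)) :
    (s : ℕ) → OneForm (modelT E (k + s)) (JetSpace E Q (k + s))
  | 0 => μ
  | s + 1 => tulczyjew (tulczyjewIter μ s)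

/-- The Lagrangian `1`-form on `T^{2k-1} Q`,
`θ_L = ∑_{r=1}^k (-1)^(r-1) (1/r!) d_T^{r-1} d_{J_r} L` (the index below is `s = r - 1`, and the
forms on `T^{k+s} Q` are pulled back to `T^{2k-1} Q`). -/
def lagrangianOneForm {k : ℕ} (L : JetSpace E Q k → ℝ) :
    OneForm (modelT E (2 * k - 1)) (JetSpace E Q (2 * k - 1)) :=
  ∑ s : Fin k, ((-1 : ℝ) ^ (s : ℕ) / ((s : ℕ) + 1).factorial) •
    (tulczyjewIter (verticalDiff ((s : ℕ) + 1) L) s).pullback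
      (JetSpace.proj (show k + (s : ℕ) ≤ 2 * k - 1 by omega))

/-- The Lagrangian `2`-form `ω_L = -dθ_L`. -/
def lagrangianTwoForm {k : ℕ} (L : JetSpace E Q k → ℝ) :
    TwoForm (modelT E (2 * k - 1)) (JetSpace E Q (2 * k - 1)) :=
  -(lagrangianOneForm L).extDeriv

/-- `L` is regular: `ω_L` is a symplectic form. As `ω_L` is exact, hence closed, this means that it
is nondegenerate. -/
def IsRegularLagrangian {k : ℕ} (L : JetSpace E Q k → ℝ) : Prop :=
  (lagrangianTwoForm L).Nondegenerate

theorem pred_le_two_mul_pred (k : ℕ) : k - 1 ≤ 2 * k - 1 := by omega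

open Classical in
/-- The Legendre–Ostrogradsky map `FL : T^{2k-1} Q → T^*(T^{k-1} Q)`, over `ρ^{2k-1}_{k-1}`: the
covector `FL(p)` at `ρ^{2k-1}_{k-1}(p)` is determined by `θ_L(u) = ⟨Tρ^{2k-1}_{k-1}(u), FL(p)⟩` for
all tangent vectors `u` at `p`. -/
def legendreMap {k : ℕ} (L : JetSpace E Q k → ℝ) (p : JetSpace E Q (2 * k - 1)) :
    Cotangent (Fin (k - 1 + 1) → E) (JetSpace E Q (k - 1))
      (JetSpace.proj (pred_le_two_mul_pred k) p) :=
  if h : ∃ α : TangentSpace (modelT E (k - 1)) (JetSpace.proj (pred_le_two_mul_pred k) p) →L[ℝ] ℝ,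
      ∀ u : TangentSpace (modelT E (2 * k - 1)) p, lagrangianOneForm L p u =
        α (mfderiv (modelT E (2 * k - 1)) (modelT E (k - 1))
          (JetSpace.proj (pred_le_two_mul_pred k)) p u)
  then h.choose else 0

end Lagrangian

/-! ### The unified (Skinner–Rusk) formalism -/

section Unified

variable (E : Type*) [NormedAddCommGroup E] [NormedSpace ℝ E]
  (Q : Type*) [TopologicalSpace Q] [ChartedSpace E Q] [IsManifold 𝓘(ℝ, E) ∞ Q]

/-- The unified phase space `W = T^{2k-1} Q ×_{T^{k-1} Q} T^*(T^{k-1} Q)`, as the pullback of the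
bundle `T^*(T^{k-1} Q) → T^{k-1} Q` by `ρ^{2k-1}_{k-1}`: its points are the pairs `(p, α)` with
`p ∈ T^{2k-1} Q` and `α` a covector at `ρ^{2k-1}_{k-1}(p)`. -/
abbrev UnifiedSpace (k : ℕ) : Type _ :=
  TotalSpace ((Fin (k - 1 + 1) → E) →L[ℝ] ℝ)
    ((JetSpace.projMap E Q (pred_le_two_mul_pred k)) *ᵖ
      (Cotangent (Fin (k - 1 + 1) → E) (JetSpace E Q (k - 1))))

/-- The model of `W`. -/
abbrev modelW (k : ℕ) : ModelWithCorners ℝ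
    ((Fin (2 * k - 1 + 1) → E) × ((Fin (k - 1 + 1) → E) →L[ℝ] ℝ))
    (ModelProd (Fin (2 * k - 1 + 1) → E) ((Fin (k - 1 + 1) → E) →L[ℝ] ℝ)) :=
  (modelT E (2 * k - 1)).prod 𝓘(ℝ, (Fin (k - 1 + 1) → E) →L[ℝ] ℝ)

/-- The presymplectic form `Ω = pr_2^* ω_{k-1}` of `W`. -/
def unifiedTwoForm (k : ℕ) : TwoForm (modelW E k) (UnifiedSpace E Q k) :=
  (canonicalTwoForm (Fin (k - 1 + 1) → E) (JetSpace E Q (k - 1))).pullback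
    (Pullback.lift (JetSpace.projMap E Q (pred_le_two_mul_pred k)))

variable {E Q}

/-- The projection `pr_1 : W → T^{2k-1} Q`. -/
def pr₁ {k : ℕ} (w : UnifiedSpace E Q k) : JetSpace E Q (2 * k - 1) := w.proj

/-- The covector `α` at `ρ^{2k-1}_{k-1}(p)` of the point `(p, α)` of `W`. -/
def covector {k : ℕ} (w : UnifiedSpace E Q k) :
    TangentSpace (modelT E (k - 1)) (JetSpace.proj (pred_le_two_mul_pred k) (pr₁ w)) →L[ℝ] ℝ :=
  w.snd

/-- The coupling function `C(p, α) = ⟨α, j_k(p)⟩`. -/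
def couplingFunction {k : ℕ} (hk : 1 ≤ k) (w : UnifiedSpace E Q k) : ℝ :=
  covector w (canonicalInjection (show k - 1 + 1 ≤ 2 * k - 1 by omega) (pr₁ w))

/-- The Hamiltonian function `H = C - (ρ^{2k-1}_k ∘ pr_1)^* L`. -/
def hamiltonian {k : ℕ} (hk : 1 ≤ k) (L : JetSpace E Q k → ℝ) (w : UnifiedSpace E Q k) : ℝ :=
  couplingFunction hk w - L (JetSpace.proj (show k ≤ 2 * k - 1 by omega) (pr₁ w))

/-- The parametrization `p ↦ (p, FL(p))` of the graph of the Legendre–Ostrogradsky map. -/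
def legendreGraphMap {k : ℕ} (L : JetSpace E Q k → ℝ) (p : JetSpace E Q (2 * k - 1)) :
    UnifiedSpace E Q k :=
  ⟨p, legendreMap L p⟩

/-- The submanifold `W_o = graph FL` of `W`. -/
def legendreGraph {k : ℕ} (L : JetSpace E Q k → ℝ) : Set (UnifiedSpace E Q k) :=
  range (legendreGraphMap L)

/-- (Not necessarily smooth) vector fields in `W` with support on `W_o`: sections of
`TW` over `W_o`. -/
abbrev FieldAlongGraph {k : ℕ} (L : JetSpace E Q k → ℝ) : Type _ :=
  (w : legendreGraph L) → TangentSpace (modelW E k) (w : UnifiedSpace E Q k)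

namespace FieldAlongGraph

variable {k : ℕ} {L : JetSpace E Q k → ℝ}

/-- Smoothness of a section of `TW` over `W_o`; here `W_o` has the manifold structure given by the
global parametrization `p ↦ (p, FL(p))`. -/
def IsSmooth (X : FieldAlongGraph L) : Prop :=
  ContMDiff (modelT E (2 * k - 1)) (modelW E k).tangent ∞
    (fun p : JetSpace E Q (2 * k - 1) =>
      (⟨legendreGraphMap L p, X ⟨legendreGraphMap L p, mem_range_self p⟩⟩ :
        TangentBundle (modelW E k) (UnifiedSpace E Q k)))

/-- `X` is tangent to `W_o`: at the point `(p, FL(p))`, its value is in the tangent space of the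
graph, which is the image of the differential of `p ↦ (p, FL(p))`. -/
def IsTangent (X : FieldAlongGraph L) : Prop :=
  ∀ p : JetSpace E Q (2 * k - 1), ∃ u : TangentSpace (modelT E (2 * k - 1)) p,
    X ⟨legendreGraphMap L p, mem_range_self p⟩ =
      mfderiv (modelT E (2 * k - 1)) (modelW E k) (legendreGraphMap L) p u

/-- `X` solves the dynamical equation `[i(X)Ω - dH]|_{W_o} = 0`. -/
def IsSolution (hk : 1 ≤ k) (X : FieldAlongGraph L) : Prop :=
  ∀ (w : legendreGraph L) (v : TangentSpace (modelW E k) (w : UnifiedSpace E Q k)),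
    unifiedTwoForm E Q k w (X w) v = differential (modelW E k) (hamiltonian hk L) w v

/-- The curve `σ` is an integral curve of `X` on the set `J` of times. -/
def IsIntegralCurve (X : FieldAlongGraph L) (σ : ℝ → UnifiedSpace E Q k) (J : Set ℝ) : Prop :=
  ∀ t ∈ J, ∃ h : σ t ∈ legendreGraph L,
    HasMFDerivAt 𝓘(ℝ, ℝ) (modelW E k) σ t ((1 : ℝ →L[ℝ] ℝ).smulRight (X ⟨σ t, h⟩))

/-- `X` is a semispray of type `r` (`1 ≤ r`) in `W`: for every integral curve `σ` of `X`, if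
`σ₁ = pr_1 ∘ σ` and `γ = β^{2k-1} ∘ σ₁` then the canonical lifting of `γ` to `T^{2k-r} Q` is
`ρ^{2k-1}_{2k-r} ∘ σ₁`. -/
def IsSemispray (r : ℕ) (hr : 1 ≤ r) (X : FieldAlongGraph L) : Prop :=
  ∀ (σ : ℝ → UnifiedSpace E Q k) (J : Set ℝ), IsOpen J → J.OrdConnected → X.IsIntegralCurve σ J →
    ∀ t ∈ J, JetSpace.lift E (2 * k - r) (fun s => (pr₁ (σ s)).base) t =
      JetSpace.proj (show 2 * k - r ≤ 2 * k - 1 by omega) (pr₁ (σ t))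

end FieldAlongGraph

end Unified

end SkinnerRusk

end

open SkinnerRusk

noncomputable section

namespace SkinnerRusk

/-! ### Linear operators on the model spaces of jets -/

section Model

variable {E : Type*} [NormedAddCommGroup E] [NormedSpace ℝ E]

/-! Everything is decided in natural coordinates. A tangent vector to the graph of `FL` is the image
of a velocity u at a point y of T^{2k-1}Q; let θ and ℓ be the coordinate expressions of θ_L and L.
Since Ω is dq ∧ dp in the coordinates q_0, …, q_{k-1} and their momenta, and H = ⟨p, (q_1, …, q_k)⟩
- ℓ, the dynamical equation splits in two (`unifiedEquation_iff`). Momentum directions give u_i =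
y_{i+1} for i < k; position directions give Dθ(u)v + θ(shift v) = dℓ(v) for all v. `IsMotion` is
this pair of conditions.

Suppose that u is the shift of an extension of y by a coordinate z of order 2k. Then the second
condition says that d_T θ_L - dL vanishes on v. This form is a multiple of dq_0
(`eulerLagrange_semibasic`, `lieTotal_cartanForm`): a vector with v_0 = 0 is J_1 x, and commuting
J_1 past the powers of d_T makes the sum telescope to a term with J_{k+1}, which is zero on
functions of order k. So only the equations on the directions of q_0 remain, and they are affine in
z. Their linear part is injective: θ_L involves only dq_0, …, dq_{k-1}, so a kernel element z would
make (0, …, 0, z) a null vector of ω_L. By equality of dimensions the equations have a solution, and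
it satisfies u_i = y_{i+1} for all i < 2k-1 (`exists_isMotion`).

Conversely, every motion satisfies i(u)ω_L = dE, where E is the restriction of H to the graph
(`IsMotion.fderiv_sub`). Nondegeneracy then gives uniqueness, independence of the chart
(`IsMotion.frame_eq`), and smoothness, because u is the inverse of ω_L applied to dE. Uniqueness
also forces the motion to be the one constructed above, so along integral curves y_i' = y_{i+1} and
y lists the derivatives of y_0: this is the semispray property (`lift_base_eq_of_hasMFDerivAt`).

These computations need J_r and d, defined through the chart at each point, to have the same
expression in every natural chart: `fderiv_prolong_vertL` and `extDeriv_frame`. -/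

/-- `(y_0, …, y_m) ↦ (y_0, …, y_r)`. -/
def truncL {m r : ℕ} (h : r ≤ m) : (Fin (m + 1) → E) →L[ℝ] (Fin (r + 1) → E) :=
  ContinuousLinearMap.pi fun i =>
    ContinuousLinearMap.proj (R := ℝ) (φ := fun _ : Fin (m + 1) => E) (Fin.castLE (by omega) i)

/-- `(y_0, …, y_m) ↦ (y_1, …, y_{r+1})`. -/
def shiftL {m r : ℕ} (h : r + 1 ≤ m) : (Fin (m + 1) → E) →L[ℝ] (Fin (r + 1) → E) :=
  ContinuousLinearMap.pi fun i =>
    ContinuousLinearMap.proj (R := ℝ) (φ := fun _ : Fin (m + 1) => E) ⟨i + 1, by omega⟩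

/-- The expression of the `r`-th vertical endomorphism in natural coordinates. -/
def vertL (m r : ℕ) : (Fin (m + 1) → E) →L[ℝ] (Fin (m + 1) → E) :=
  ContinuousLinearMap.pi fun i =>
    (((i : ℕ).descFactorial r : ℕ) : ℝ) •
      ContinuousLinearMap.proj (R := ℝ) (φ := fun _ : Fin (m + 1) => E)
        ⟨(i : ℕ) - r, lt_of_le_of_lt (Nat.sub_le _ _) i.2⟩

/-- `(y_0, …, y_r) ↦ (y_0, …, y_r, 0, …, 0)`. -/
def padL {m r : ℕ} : (Fin (r + 1) → E) →L[ℝ] (Fin (m + 1) → E) :=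
  ContinuousLinearMap.pi fun i =>
    if h : (i : ℕ) < r + 1 then
      ContinuousLinearMap.proj (R := ℝ) (φ := fun _ : Fin (r + 1) => E) ⟨i, h⟩
    else 0

@[simp] theorem truncL_apply {m r : ℕ} (h : r ≤ m) (y : Fin (m + 1) → E) (i : Fin (r + 1)) :
    truncL h y i = y (Fin.castLE (by omega) i) := rfl

@[simp] theorem shiftL_apply {m r : ℕ} (h : r + 1 ≤ m) (y : Fin (m + 1) → E) (i : Fin (r + 1)) :
    shiftL h y i = y ⟨i + 1, by omega⟩ := rfl

@[simp] theorem vertL_apply {m r : ℕ} (y : Fin (m + 1) → E) (i : Fin (m + 1)) :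
    vertL m r y i = (((i : ℕ).descFactorial r : ℕ) : ℝ) •
      y ⟨(i : ℕ) - r, lt_of_le_of_lt (Nat.sub_le _ _) i.2⟩ := rfl

theorem padL_apply {m r : ℕ} (y : Fin (r + 1) → E) (i : Fin (m + 1)) :
    padL y i = if h : (i : ℕ) < r + 1 then y ⟨i, h⟩ else 0 := by
  simp only [padL, ContinuousLinearMap.coe_pi']
  split_ifs <;> rfl

theorem truncL_padL {m r : ℕ} (h : r ≤ m) (y : Fin (r + 1) → E) :
    truncL h (padL (m := m) y) = y := by
  funext i
  rw [truncL_apply, padL_apply, dif_pos (by simpa using i.2)]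
  rfl

end Model

/-! ### Prolongations of smooth maps -/

section Prolongation

variable {X F G : Type*} [NormedAddCommGroup X] [NormedSpace ℝ X]
  [NormedAddCommGroup F] [NormedSpace ℝ F] [NormedAddCommGroup G] [NormedSpace ℝ G]

/-- In the Leibniz formula at 0 only the term differentiating `t ^ r` exactly `r` times survives.
Its coefficient is the falling factorial that occurs in `vertL`. -/
theorem iteratedDeriv_pow_smul_zero {h : ℝ → F} (hh : ContDiffAt ℝ ∞ h 0) (r i : ℕ) :
    iteratedDeriv i (fun t : ℝ => t ^ r • h t) 0 =
      ((i.descFactorial r : ℕ) : ℝ) • iteratedDeriv (i - r) h 0 := by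
  have h1 : iteratedDeriv i ((fun t : ℝ => t ^ r) • h) 0 = ∑ j ∈ Finset.range (i + 1),
      i.choose j • iteratedDeriv j (fun t : ℝ => t ^ r) 0 • iteratedDeriv (i - j) h 0 := by
    simp only [← iteratedDerivWithin_univ]
    exact iteratedDerivWithin_smul (mem_univ _) uniqueDiffOn_univ (by fun_prop)
      (hh.of_le (by exact_mod_cast le_top)).contDiffWithinAt
  change iteratedDeriv i ((fun t : ℝ => t ^ r) • h) 0 = _
  rw [h1]
  simp only [iteratedDeriv_fun_pow_zero]
  by_cases hr : r ≤ i
  · rw [Finset.sum_eq_single r]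
    · rw [if_pos rfl, Nat.descFactorial_eq_factorial_mul_choose, ← Nat.cast_smul_eq_nsmul ℝ,
        smul_smul]
      push_cast
      rw [mul_comm]
    · intro j _ hj
      simp [hj]
    · intro hn
      exact absurd (Finset.mem_range.2 (by omega)) hn
  -- For `i < r` there is no such term, and the vanishing falling factorial makes the truncated
  -- subtraction `i - r` harmless.
  · rw [Nat.descFactorial_eq_zero_iff_lt.2 (by omega)]
    simp only [Nat.cast_zero, zero_smul]
    refine Finset.sum_eq_zero fun j hj => ?_
    have : j ≠ r := by have := Finset.mem_range.1 hj; omega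
    simp [this]

theorem fderiv_prod_left {g : X × ℝ → F} {q : X × ℝ} (hg : DifferentiableAt ℝ g q) (v : X) :
    fderiv ℝ (fun x => g (x, q.2)) q.1 v = fderiv ℝ g q (v, 0) := by
  have h := hg.hasFDerivAt.comp (f := fun x : X => (x, q.2)) q.1
    ((hasFDerivAt_id q.1).prodMk (hasFDerivAt_const q.2 q.1))
  have h' : HasFDerivAt (fun x => g (x, q.2)) _ q.1 := h
  rw [h'.fderiv]
  simp

theorem deriv_prod_right {g : X × ℝ → F} {q : X × ℝ} (hg : DifferentiableAt ℝ g q) :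
    deriv (fun s => g (q.1, s)) q.2 = fderiv ℝ g q (0, 1) := by
  have h := hg.hasFDerivAt.comp_hasDerivAt (f := fun s : ℝ => (q.1, s)) q.2
    ((hasDerivAt_const q.2 q.1).prodMk (hasDerivAt_id q.2))
  exact h.deriv

/-- Partial derivatives in a parameter commute with time derivatives. -/
theorem fderiv_iteratedDeriv_comm (i : ℕ) : ∀ {g : X × ℝ → F} {p : X × ℝ},
    ContDiffAt ℝ ∞ g p → ∀ v : X,
    fderiv ℝ (fun x => iteratedDeriv i (fun s => g (x, s)) p.2) p.1 v =
      iteratedDeriv i (fun s => fderiv ℝ (fun x => g (x, s)) p.1 v) p.2 := by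
  induction i with
  | zero => intro g p _ v; simp
  | succ i ih =>
    intro g p hg v
    have hg' : ContDiffAt ℝ ∞ (fun q : X × ℝ => deriv (fun s => g (q.1, s)) q.2) p := by
      simpa only [iteratedDeriv_one] using contDiffAt_iteratedDeriv_param hg 1
    have hev : ∀ᶠ q in 𝓝 p, ContDiffAt ℝ 2 g q :=
      (hg.of_le (m := 2) ENat.LEInfty.out).eventually (by simp)
    have hcomm : ∀ᶠ q in 𝓝 p,
        fderiv ℝ (fun x => deriv (fun s => g (x, s)) q.2) q.1 v =
          deriv (fun s => fderiv ℝ (fun x => g (x, s)) q.1 v) q.2 := by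
      filter_upwards [hev.eventually_nhds] with q hq
      have hq2 : ContDiffAt ℝ 2 g q := hq.self_of_nhds
      have hd : ∀ᶠ q' in 𝓝 q, DifferentiableAt ℝ g q' :=
        hq.mono fun q' h' => h'.differentiableAt (by simp)
      have hdd : DifferentiableAt ℝ (fderiv ℝ g) q :=
        (hq2.fderiv_right (m := 1) (by norm_num)).differentiableAt (by simp)
      have hsymm : IsSymmSndFDerivAt ℝ g q := hq2.isSymmSndFDerivAt (by simp)
      have e1 : (fun x => deriv (fun s => g (x, s)) q.2) =ᶠ[𝓝 q.1]
          fun x => fderiv ℝ g (x, q.2) (0, 1) := by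
        have hc : ContinuousAt (fun x : X => (x, q.2)) q.1 := by fun_prop
        filter_upwards [hc.eventually hd] with x hx
        exact deriv_prod_right hx
      have e2 : (fun s => fderiv ℝ (fun x => g (x, s)) q.1 v) =ᶠ[𝓝 q.2]
          fun s => fderiv ℝ g (q.1, s) (v, 0) := by
        have hc : ContinuousAt (fun s : ℝ => (q.1, s)) q.2 := by fun_prop
        filter_upwards [hc.eventually hd] with s hs
        exact fderiv_prod_left (q := (q.1, s)) hs v
      rw [e1.fderiv_eq, e2.deriv_eq]
      have d1 : DifferentiableAt ℝ (fun q' : X × ℝ => fderiv ℝ g q' (0, 1)) q :=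
        hdd.clm_apply (differentiableAt_const _)
      have d2 : DifferentiableAt ℝ (fun q' : X × ℝ => fderiv ℝ g q' (v, 0)) q :=
        hdd.clm_apply (differentiableAt_const _)
      rw [fderiv_prod_left d1 v, deriv_prod_right d2,
        fderiv_clm_apply hdd (differentiableAt_const _),
        fderiv_clm_apply hdd (differentiableAt_const _)]
      simpa using hsymm (v, 0) (0, 1)
    -- The induction hypothesis goes to the time derivative of `g`. The one exchange left is needed
    -- on a neighbourhood, because the outer iterated derivative depends on the germ.
    simp only [iteratedDeriv_succ']
    rw [ih hg' v]
    apply Filter.EventuallyEq.iteratedDeriv_eq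
    have hc : ContinuousAt (fun s : ℝ => (p.1, s)) p.2 := by fun_prop
    filter_upwards [hc.eventually hcomm] with s hs
    exact hs

variable {E : Type*} [NormedAddCommGroup E] [NormedSpace ℝ E]

/-- The prolongation to `k`-jets of a map between vector spaces. -/
def prolong (k : ℕ) (φ : E → F) (y : Fin (k + 1) → E) : Fin (k + 1) → F :=
  fun i => iteratedDeriv i (φ ∘ polyCurve y) 0

theorem contDiffAt_prolong {k : ℕ} {φ : E → F} {y : Fin (k + 1) → E}
    (hφ : ContDiffAt ℝ ∞ φ (y 0)) : ContDiffAt ℝ ∞ (prolong k φ) y := by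
  refine contDiffAt_pi.2 fun i => ?_
  have hG : ContDiffAt ℝ ∞ (φ ∘ fun p : (Fin (k + 1) → E) × ℝ => polyCurve p.1 p.2) (y, 0) := by
    refine ContDiffAt.comp _ ?_ contDiff_polyCurve.contDiffAt
    simpa only [polyCurve_zero] using hφ
  exact (contDiffAt_iteratedDeriv_param hG i).comp (f := fun z => (z, (0 : ℝ))) y
    (by fun_prop)

/-- The vertical endomorphism is multiplication of a variation by `t ^ r`. The two curves may
differ, but only in degrees above `k`. -/
theorem iteratedDeriv_polyCurve_vertL {k r : ℕ} (v : Fin (k + 1) → E) {i : ℕ} (hi : i ≤ k) :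
    iteratedDeriv i (polyCurve (vertL k r v)) 0 =
      iteratedDeriv i (fun t : ℝ => t ^ r • polyCurve v t) 0 := by
  have h1 := iteratedDeriv_polyCurve (vertL k r v) ⟨i, by omega⟩
  have h2 := iteratedDeriv_polyCurve v ⟨i - r, by omega⟩
  rw [iteratedDeriv_pow_smul_zero (contDiff_polyCurve' v).contDiffAt]
  simp only at h1 h2
  rw [h1, h2, vertL_apply]

theorem hasFDerivAt_polyCurve {k : ℕ} (y : Fin (k + 1) → E) (t : ℝ) :
    ∃ A : (Fin (k + 1) → E) →L[ℝ] E, (∀ v, A v = polyCurve v t) ∧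
      HasFDerivAt (fun z : Fin (k + 1) → E => polyCurve z t) A y := by
  refine ⟨∑ i : Fin (k + 1), (t ^ (i : ℕ) / (i : ℕ).factorial) •
    ContinuousLinearMap.proj (R := ℝ) (φ := fun _ : Fin (k + 1) => E) i, fun v => ?_, ?_⟩
  · simp [polyCurve]
  · refine (ContinuousLinearMap.hasFDerivAt _).congr_of_eventuallyEq (Eventually.of_forall fun z => ?_)
    simp [polyCurve]

/-- Varying the jet in the direction `v` varies the curve by `polyCurve v`; its image under `φ` then
varies by the field on the right, and parameter and time derivatives commute. -/
theorem fderiv_prolong_apply {k : ℕ} {φ : E → F} {y : Fin (k + 1) → E}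
    (hφ : ContDiffAt ℝ ∞ φ (y 0)) (v : Fin (k + 1) → E) (i : Fin (k + 1)) :
    fderiv ℝ (prolong k φ) y v i =
      iteratedDeriv i (fun t => fderiv ℝ φ (polyCurve y t) (polyCurve v t)) 0 := by
  have hG : ContDiffAt ℝ ∞ (fun p : (Fin (k + 1) → E) × ℝ => φ (polyCurve p.1 p.2)) (y, 0) := by
    refine ContDiffAt.comp (y, (0 : ℝ)) ?_ contDiff_polyCurve.contDiffAt
    simpa only [polyCurve_zero] using hφ
  have h1 : fderiv ℝ (prolong k φ) y v i = fderiv ℝ (fun z => prolong k φ z i) y v := by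
    have := (contDiffAt_prolong (k := k) hφ).differentiableAt (by simp)
    rw [fderiv_apply this]
    rfl
  rw [h1]
  refine (fderiv_iteratedDeriv_comm i hG v).trans ?_
  apply Filter.EventuallyEq.iteratedDeriv_eq
  have hd : ∀ᶠ x in 𝓝 (y 0), DifferentiableAt ℝ φ x :=
    ((hφ.of_le (m := 1) (by exact_mod_cast le_top)).eventually (by simp)).mono
      fun t ht => ht.differentiableAt (by simp)
  have hc : Tendsto (polyCurve y) (𝓝 0) (𝓝 (y 0)) := by
    have := (contDiff_polyCurve' y).continuous.tendsto 0
    rwa [polyCurve_zero] at this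
  filter_upwards [hc.eventually hd] with t ht
  obtain ⟨A, hA, hA'⟩ := hasFDerivAt_polyCurve y t
  have := (ht.hasFDerivAt.comp y hA').fderiv
  rw [Function.comp_def] at this
  rw [this]
  simp [hA]

/-- The vertical endomorphisms commute with the differentials of prolongations. -/
theorem fderiv_prolong_vertL {k : ℕ} {φ : E → F} {y : Fin (k + 1) → E}
    (hφ : ContDiffAt ℝ ∞ φ (y 0)) (r : ℕ) (v : Fin (k + 1) → E) :
    fderiv ℝ (prolong k φ) y (vertL k r v) = vertL k r (fderiv ℝ (prolong k φ) y v) := by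
  funext i
  have hφ' : ContDiffAt ℝ ∞ (fun p : E × E => fderiv ℝ φ p.1 p.2) (y 0, v 0) :=
    ((hφ.fderiv_right (m := ∞) (by simp)).comp (y 0, v 0) contDiffAt_fst).clm_apply contDiffAt_snd
  have hφ'' : ∀ w : E, ContDiffAt ℝ ∞ (fun p : E × E => fderiv ℝ φ p.1 p.2) (y 0, w) := fun w =>
    ((hφ.fderiv_right (m := ∞) (by simp)).comp (y 0, w) contDiffAt_fst).clm_apply contDiffAt_snd
  have hy := (contDiff_polyCurve' y).contDiffAt (x := 0)
  have hv := (contDiff_polyCurve' v).contDiffAt (x := 0)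
  have hJ := (contDiff_polyCurve' (vertL k r v)).contDiffAt (x := 0)
  have ht : ContDiffAt ℝ ∞ (fun t : ℝ => t ^ r • polyCurve v t) 0 := by fun_prop
  rw [vertL_apply, fderiv_prolong_apply hφ, fderiv_prolong_apply hφ]
  -- The `i`-th derivative sees only jets of order `i ≤ k`, so the variation of `vertL k r v` may be
  -- replaced by `t ^ r` times that of `v`.
  have h1 := iteratedDeriv_comp_congr (i : ℕ) (f := fun p : E × E => fderiv ℝ φ p.1 p.2)
    (hy.prodMk hJ) (hy.prodMk ht) (by simpa only [polyCurve_zero] using hφ'' _) (by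
      intro j hj
      rw [iteratedDeriv_prodMk hy hJ, iteratedDeriv_prodMk hy ht,
        iteratedDeriv_polyCurve_vertL v (by omega)])
  refine h1.trans ?_
  -- By linearity of the differential of `φ` the factor `t ^ r` comes out.
  have h2 := iteratedDeriv_pow_smul_zero (h := fun t =>
    fderiv ℝ φ (polyCurve y t) (polyCurve v t)) (by
      have : ContDiffAt ℝ ∞ (fun p : E × E => fderiv ℝ φ p.1 p.2) (polyCurve y 0, polyCurve v 0) := by
        simpa only [polyCurve_zero] using hφ'
      exact ContDiffAt.comp (0 : ℝ) this (hy.prodMk hv)) r i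
  rw [← h2]
  congr 1
  funext t
  simp

end Prolongation

/-! ### Natural parametrizations of jet spaces -/

section Charts

variable {E : Type*} [NormedAddCommGroup E] [NormedSpace ℝ E]
  {Q : Type*} [TopologicalSpace Q] [ChartedSpace E Q] [IsManifold 𝓘(ℝ, E) ∞ Q]

namespace JetSpace

/-- The natural chart over `e`, as an element of the atlas of `T^k Q`. -/
def natHomeo (k : ℕ) {e : OpenPartialHomeomorph Q E} (he : e ∈ atlas E Q) :
    OpenPartialHomeomorph (JetSpace E Q k) (Fin (k + 1) → E) :=
  (core E Q k).openPartialHomeomorph (natChart k e he) ⟨e, he, rfl⟩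

theorem natHomeo_mem_atlas (k : ℕ) {e : OpenPartialHomeomorph Q E} (he : e ∈ atlas E Q) :
    natHomeo k he ∈ atlas (Fin (k + 1) → E) (JetSpace E Q k) := by
  change natHomeo k he ∈
    ⋃ (e) (he : e ∈ (core E Q k).atlas), {(core E Q k).openPartialHomeomorph e he}
  simp only [mem_iUnion, mem_singleton_iff]
  exact ⟨_, ⟨e, he, rfl⟩, rfl⟩

variable {k : ℕ} {e : OpenPartialHomeomorph Q E}

theorem contMDiffAt_ofCoords (he : e ∈ atlas E Q) {y : Fin (k + 1) → E} (hy : y 0 ∈ e.target) :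
    ContMDiffAt 𝓘(ℝ, Fin (k + 1) → E) (modelT E k) ∞
      (ofCoords e : (Fin (k + 1) → E) → JetSpace E Q k) y :=
  contMDiffAt_symm_of_mem_maximalAtlas (e := natHomeo k he)
    (IsManifold.subset_maximalAtlas (natHomeo_mem_atlas k he)) hy

theorem contMDiffAt_coords (he : e ∈ atlas E Q) {p : JetSpace E Q k} (hp : p.base ∈ e.source) :
    ContMDiffAt (modelT E k) 𝓘(ℝ, Fin (k + 1) → E) ∞
      (coords e : JetSpace E Q k → Fin (k + 1) → E) p :=
  contMDiffAt_of_mem_maximalAtlas (e := natHomeo k he)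
    (IsManifold.subset_maximalAtlas (natHomeo_mem_atlas k he)) hp

theorem ofCoords_coords (he : e ∈ atlas E Q) {p : JetSpace E Q k} (hp : p.base ∈ e.source) :
    ofCoords e (coords e p) = p :=
  (natChart k e he).left_inv hp

omit [IsManifold 𝓘(ℝ, E) ∞ Q] in
theorem coords_zero_mem {p : JetSpace E Q k} (hp : p.base ∈ e.source) :
    coords e p 0 ∈ e.target := by
  rw [coords_zero]; exact e.map_source hp

omit [IsManifold 𝓘(ℝ, E) ∞ Q] in
theorem base_ofCoords_mem {y : Fin (k + 1) → E} (hy : y 0 ∈ e.target) :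
    (ofCoords e y : JetSpace E Q k).base ∈ e.source := by
  rw [base_ofCoords]; exact e.map_target hy

omit [NormedSpace ℝ E] [ChartedSpace E Q] [IsManifold 𝓘(ℝ, E) ∞ Q] in
variable (k e) in
theorem isOpen_domain : IsOpen {y : Fin (k + 1) → E | y 0 ∈ e.target} :=
  e.open_target.preimage (continuous_apply 0)

omit [NormedSpace ℝ E] [ChartedSpace E Q] [IsManifold 𝓘(ℝ, E) ∞ Q] in
theorem eventually_domain {y : Fin (k + 1) → E} (hy : y 0 ∈ e.target) :
    ∀ᶠ z in 𝓝 y, z 0 ∈ e.target :=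
  (isOpen_domain k e).mem_nhds hy

theorem eventually_base_mem (he : e ∈ atlas E Q) {p : JetSpace E Q k} (hp : p.base ∈ e.source) :
    ∀ᶠ p' in 𝓝 p, p'.base ∈ e.source :=
  (natHomeo k he).open_source.mem_nhds hp

variable (k e) in
/-- The differential at `y` of the natural parametrization over `e`. -/
def frame (y : Fin (k + 1) → E) : (Fin (k + 1) → E) →L[ℝ] (Fin (k + 1) → E) :=
  mfderiv 𝓘(ℝ, Fin (k + 1) → E) (modelT E k)
    (ofCoords e : (Fin (k + 1) → E) → JetSpace E Q k) y

theorem hasMFDerivAt_ofCoords (he : e ∈ atlas E Q) {y : Fin (k + 1) → E} (hy : y 0 ∈ e.target) :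
    HasMFDerivAt 𝓘(ℝ, Fin (k + 1) → E) (modelT E k)
      (ofCoords e : (Fin (k + 1) → E) → JetSpace E Q k) y (frame k e y) :=
  ((contMDiffAt_ofCoords he hy).mdifferentiableAt (by simp)).hasMFDerivAt

/-- Tangent vectors at a jet are read in the chart at that jet, so the differential of the
parametrization over `e` is the derivative of the prolonged transition map to that chart. -/
theorem frame_eq (he : e ∈ atlas E Q) {y : Fin (k + 1) → E} (hy : y 0 ∈ e.target) :
    frame k e y = fderiv ℝ (prolong k (chartAt E (ofCoords e y : JetSpace E Q k).base ∘ e.symm)) y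
    := by
  have h := (contMDiffAt_ofCoords (k := k) he hy).mdifferentiableAt (by simp)
  have h2 := h.mfderiv
  refine h2.trans ?_
  simp only [modelWithCornersSelf_coe, range_id, fderivWithin_univ]
  apply Filter.EventuallyEq.fderiv_eq
  change writtenInExtChartAt 𝓘(ℝ, Fin (k + 1) → E) (modelT E k) y _ =ᶠ[𝓝 y] _
  have hs : ∀ᶠ z in 𝓝 y, (ofCoords e z : JetSpace E Q k).base ∈
      (chartAt E (ofCoords e y : JetSpace E Q k).base).source :=
    h.continuousAt.eventually (eventually_base_mem (chart_mem_atlas E _) (mem_chart_source E _))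
  filter_upwards [eventually_domain hy, hs] with z hz hz'
  funext i
  rw [base_ofCoords e z] at hz'
  exact coords_ofCoords he (chart_mem_atlas E _) hz hz' i

/-- At the centre of its own chart the frame is trivial; this links objects defined pointwise
through that chart to their expressions in coordinates. -/
theorem frame_self (p : JetSpace E Q k) :
    frame k (chartAt E p.base) (coords (chartAt E p.base) p) = ContinuousLinearMap.id ℝ _ := by
  have hp : p.base ∈ (chartAt E p.base).source := mem_chart_source E _
  have he : chartAt E p.base ∈ atlas E Q := chart_mem_atlas E _
  rw [frame_eq he (coords_zero_mem hp), ofCoords_coords he hp]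
  have : prolong k (chartAt E p.base ∘ (chartAt E p.base).symm)
      =ᶠ[𝓝 (coords (chartAt E p.base) p)] id := by
    filter_upwards [eventually_domain (coords_zero_mem hp)] with z hz
    funext i
    have h1 := coords_ofCoords (k := k) he he hz ((chartAt E p.base).map_target hz) i
    rw [coords_ofCoords_self he hz] at h1
    exact h1.symm
  rw [this.fderiv_eq, fderiv_id]

/-- `verticalEndo` is defined with the chart at each point; since `vertL` commutes with derivatives
of prolongations, it has the same matrix in every natural chart. -/
theorem verticalEndo_frame (he : e ∈ atlas E Q) {y : Fin (k + 1) → E} (hy : y 0 ∈ e.target)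
    (r : ℕ) (v : Fin (k + 1) → E) :
    (verticalEndo r (ofCoords e y : JetSpace E Q k) (frame k e y v) : Fin (k + 1) → E) =
      frame k e y (vertL k r v) := by
  have hs : e.symm (y 0) ∈ (chartAt E (ofCoords e y : JetSpace E Q k).base).source := by
    rw [base_ofCoords]; exact mem_chart_source E _
  have h := fderiv_prolong_vertL (k := k) (y := y)
    (contDiffAt_transition he (chart_mem_atlas E (ofCoords e y : JetSpace E Q k).base) hy hs) r v
  rw [frame_eq he hy, h]
  rfl

/-- Two natural parametrizations differ by the prolongation of the transition map. -/
theorem ofCoords_prolong {e' : OpenPartialHomeomorph Q E} (he : e ∈ atlas E Q)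
    (he' : e' ∈ atlas E Q) {y : Fin (k + 1) → E} (hy : y 0 ∈ e.target)
    (hy' : e.symm (y 0) ∈ e'.source) :
    (ofCoords e' (prolong k (e' ∘ e.symm) y) : JetSpace E Q k) = ofCoords e y := by
  have h1 : prolong k (e' ∘ e.symm) y = coords e' (ofCoords e y : JetSpace E Q k) :=
    funext fun i => (coords_ofCoords he he' hy hy' i).symm
  rw [h1, ofCoords_coords he' (by rwa [base_ofCoords])]

theorem prolong_zero (φ : E → E) (y : Fin (k + 1) → E) : prolong k φ y 0 = φ (y 0) := by
  simp [prolong, polyCurve_zero]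

theorem frame_comp_prolong {e' : OpenPartialHomeomorph Q E} (he : e ∈ atlas E Q)
    (he' : e' ∈ atlas E Q) {y : Fin (k + 1) → E} (hy : y 0 ∈ e.target)
    (hy' : e.symm (y 0) ∈ e'.source) :
    frame k e y = (frame k e' (prolong k (e' ∘ e.symm) y)).comp
      (fderiv ℝ (prolong k (e' ∘ e.symm)) y) := by
  have hz : prolong k (e' ∘ e.symm) y 0 ∈ e'.target := by
    rw [prolong_zero]; exact e'.map_source hy'
  have hΦ : HasMFDerivAt 𝓘(ℝ, Fin (k + 1) → E) 𝓘(ℝ, Fin (k + 1) → E)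
      (prolong k (e' ∘ e.symm)) y (fderiv ℝ (prolong k (e' ∘ e.symm)) y) :=
    ((contDiffAt_prolong (contDiffAt_transition he he' hy hy')).differentiableAt
      (by simp)).hasFDerivAt.hasMFDerivAt
  have h := (hasMFDerivAt_ofCoords (k := k) he' hz).comp y hΦ
  have hev : (ofCoords e : (Fin (k + 1) → E) → JetSpace E Q k) =ᶠ[𝓝 y]
      (ofCoords e' ∘ prolong k (e' ∘ e.symm)) := by
    have hopen : ∀ᶠ z in 𝓝 y, z 0 ∈ (e.symm.trans e').source :=
      ((e.symm.trans e').open_source.preimage (continuous_apply (0 : Fin (k + 1)))).mem_nhds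
        (by simp [hy, hy'])
    filter_upwards [hopen] with z hz
    have hz2 : z 0 ∈ e.target ∧ e.symm (z 0) ∈ e'.source := by simpa using hz
    exact (ofCoords_prolong he he' hz2.1 hz2.2).symm
  exact (h.congr_of_eventuallyEq hev).mfderiv

theorem proj_ofCoords {r : ℕ} (h : r ≤ k) (he : e ∈ atlas E Q) {y : Fin (k + 1) → E}
    (hy : y 0 ∈ e.target) :
    proj h (ofCoords e y : JetSpace E Q k) = ofCoords e (truncL h y) := by
  have hy' : truncL h y 0 ∈ e.target := hy
  have hb := base_ofCoords_mem (k := k) (Q := Q) hy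
  refine ext_coords he (by rwa [base_proj]) (base_ofCoords_mem hy') ?_
  rw [coords_ofCoords_self he hy']
  funext i
  rw [coords_proj h he hb, coords_ofCoords_self he hy]
  rfl

theorem coords_proj_eq {r : ℕ} (h : r ≤ k) (he : e ∈ atlas E Q) {p : JetSpace E Q k}
    (hp : p.base ∈ e.source) : coords e (proj h p) = truncL h (coords e p) :=
  funext fun i => coords_proj h he hp i

theorem hasMFDerivAt_proj {r : ℕ} (h : r ≤ k) (p : JetSpace E Q k) :
    HasMFDerivAt (modelT E k) (modelT E r) (proj h) p
      (mfderiv (modelT E k) (modelT E r) (proj h) p) :=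
  ((contMDiff_proj h).contMDiffAt.mdifferentiableAt (by simp)).hasMFDerivAt

theorem mfderiv_proj_frame {r : ℕ} (h : r ≤ k) (he : e ∈ atlas E Q) {y : Fin (k + 1) → E}
    (hy : y 0 ∈ e.target) (v : Fin (k + 1) → E) :
    (mfderiv (modelT E k) (modelT E r) (proj h) (ofCoords e y : JetSpace E Q k) (frame k e y v) :
      Fin (r + 1) → E) = frame r e (truncL h y) (truncL h v) := by
  have h1 := (hasMFDerivAt_proj h (ofCoords e y : JetSpace E Q k)).comp y
    (hasMFDerivAt_ofCoords he hy)
  have h2 := (hasMFDerivAt_ofCoords (k := r) he (y := truncL h y) hy).comp y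
    ((truncL h : (Fin (k + 1) → E) →L[ℝ] (Fin (r + 1) → E)).hasFDerivAt.hasMFDerivAt)
  have hev : (proj h ∘ (ofCoords e : (Fin (k + 1) → E) → JetSpace E Q k)) =ᶠ[𝓝 y]
      ((ofCoords e : (Fin (r + 1) → E) → JetSpace E Q r) ∘ truncL h) := by
    filter_upwards [eventually_domain hy] with z hz
    exact proj_ofCoords h he hz
  have h3 := h1.mfderiv.symm.trans (hev.mfderiv_eq.trans h2.mfderiv)
  exact congrArg (fun A : (Fin (k + 1) → E) →L[ℝ] (Fin (r + 1) → E) => A v) h3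

theorem coords_lift {σ : ℝ → Q} {t : ℝ} (he : e ∈ atlas E Q) (hσ : IsSmoothNear E σ t)
    (hs : σ t ∈ e.source) (i : Fin (k + 1)) :
    coords e (lift E k σ t) i = iteratedDeriv i (e ∘ σ) t := by
  rw [lift, dif_pos hσ, coords_mk he _ (by simpa using hs)]
  have := congrFun (iteratedDeriv_comp_add_const (i : ℕ) (e ∘ σ) t) 0
  simpa [Function.comp_def] using this

/-- In coordinates the lift is the tuple of derivatives of the curve at all times near `t`, hence
its velocity is the tuple of the next derivatives. This is where smoothness on a neighbourhood is
needed. -/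
theorem hasMFDerivAt_lift {σ : ℝ → Q} {t : ℝ} (he : e ∈ atlas E Q) (hσ : IsSmoothNear E σ t)
    (hs : σ t ∈ e.source) :
    HasMFDerivAt 𝓘(ℝ, ℝ) (modelT E k) (lift E k σ) t
      ((frame k e (fun i => iteratedDeriv i (e ∘ σ) t)).comp
        ((1 : ℝ →L[ℝ] ℝ).smulRight (fun i : Fin (k + 1) => iteratedDeriv (i + 1) (e ∘ σ) t))) := by
  have hc : ContDiffAt ℝ ∞ (e ∘ σ) t := contDiffAt_comp_curve he hσ.self_of_nhds hs
  have hd : HasDerivAt (fun s => fun i : Fin (k + 1) => iteratedDeriv i (e ∘ σ) s)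
      (fun i : Fin (k + 1) => iteratedDeriv (i + 1) (e ∘ σ) t) t := by
    refine hasDerivAt_pi.2 fun i => ?_
    rw [iteratedDeriv_succ]
    have : ContDiffAt ℝ ∞ (iteratedDeriv (i : ℕ) (e ∘ σ)) t := by
      have h := contDiffAt_iteratedDeriv_param (X := ℝ) (G := fun q : ℝ × ℝ => (e ∘ σ) q.2)
        (p := (0, t)) (ContDiffAt.comp (g := e ∘ σ) ((0 : ℝ), t) hc contDiffAt_snd) i
      exact h.comp (f := fun s : ℝ => ((0 : ℝ), s)) t (by fun_prop)
    exact (this.differentiableAt (by simp)).hasDerivAt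
  have h0 : (fun i : Fin (k + 1) => iteratedDeriv i (e ∘ σ) t) 0 ∈ e.target := by
    simpa using e.map_source hs
  have h1 := (hasMFDerivAt_ofCoords (k := k) he h0).comp t hd.hasFDerivAt.hasMFDerivAt
  refine h1.congr_of_eventuallyEq ?_
  have hcont : ∀ᶠ s in 𝓝 t, σ s ∈ e.source :=
    hσ.self_of_nhds.continuousAt.eventually (e.open_source.mem_nhds hs)
  filter_upwards [hσ.eventually_nhds, hcont] with s hs1 hs2
  have hb : (lift E k σ s).base ∈ e.source := by rwa [base_lift]
  rw [← ofCoords_coords he hb]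
  congr 1
  funext i
  exact coords_lift he hs1 hs2 i

end JetSpace

open JetSpace

variable {k : ℕ} {e : OpenPartialHomeomorph Q E}

/-- Velocity of the lift of a representative: in coordinates the canonical injection is the total
derivative field. -/
theorem canonicalInjection_eq {r : ℕ} (h : r + 1 ≤ k) (he : e ∈ atlas E Q) {p : JetSpace E Q k}
    (hp : p.base ∈ e.source) :
    (canonicalInjection h p : Fin (r + 1) → E) =
      frame r e (truncL (Nat.le_of_succ_le h) (coords e p)) (shiftL h (coords e p)) := by
  have hs : (Quotient.out p).toFun 0 ∈ e.source := by rwa [base_out]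
  have h1 := (hasMFDerivAt_lift (k := r) he (Quotient.out p).smooth hs).mfderiv
  have h2 := congrArg (fun A : ℝ →L[ℝ] (Fin (r + 1) → E) => A 1) h1
  refine Eq.trans h2 ?_
  change frame r e _ ((1 : ℝ) • _) = _
  rw [one_smul]
  rfl

theorem canonicalInjection_ofCoords {r : ℕ} (h : r + 1 ≤ k) (he : e ∈ atlas E Q)
    {y : Fin (k + 1) → E} (hy : y 0 ∈ e.target) :
    (canonicalInjection h (ofCoords e y : JetSpace E Q k) : Fin (r + 1) → E) =
      frame r e (truncL (Nat.le_of_succ_le h) y) (shiftL h y) := by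
  rw [canonicalInjection_eq h he (base_ofCoords_mem hy), coords_ofCoords_self he hy]

end Charts

/-! ### Local representatives of differential forms -/

section Calculus

variable {V W : Type*} [NormedAddCommGroup V] [NormedSpace ℝ V]
  [NormedAddCommGroup W] [NormedSpace ℝ W]

/-- The exterior derivative commutes with pullbacks of `1`-forms between vector spaces. -/
theorem fderiv_pullback_sub {B : W → W →L[ℝ] ℝ} {Φ : V → W} {y : V}
    (hB : DifferentiableAt ℝ B (Φ y)) (hΦ : ContDiffAt ℝ 2 Φ y) (u v : V) :
    fderiv ℝ (fun w => (B (Φ w)).comp (fderiv ℝ Φ w)) y u v -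
        fderiv ℝ (fun w => (B (Φ w)).comp (fderiv ℝ Φ w)) y v u =
      fderiv ℝ B (Φ y) (fderiv ℝ Φ y u) (fderiv ℝ Φ y v) -
        fderiv ℝ B (Φ y) (fderiv ℝ Φ y v) (fderiv ℝ Φ y u) := by
  have hd : DifferentiableAt ℝ Φ y := hΦ.differentiableAt (by simp)
  have hdd : DifferentiableAt ℝ (fderiv ℝ Φ) y :=
    (hΦ.fderiv_right (m := 1) (by norm_num)).differentiableAt (by simp)
  have hsymm : IsSymmSndFDerivAt ℝ Φ y := hΦ.isSymmSndFDerivAt (by simp)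
  have hc : HasFDerivAt (fun w => B (Φ w)) ((fderiv ℝ B (Φ y)).comp (fderiv ℝ Φ y)) y :=
    hB.hasFDerivAt.comp y hd.hasFDerivAt
  rw [(hc.clm_comp hdd.hasFDerivAt).fderiv]
  simp only [_root_.add_apply, ContinuousLinearMap.comp_apply,
    ContinuousLinearMap.compL_apply, ContinuousLinearMap.flip_apply]
  -- The terms with the second derivative of `Φ` cancel by its symmetry.
  rw [hsymm u v]
  ring

end Calculus

section Rep

variable {E : Type*} [NormedAddCommGroup E] [NormedSpace ℝ E]
  {Q : Type*} [TopologicalSpace Q] [ChartedSpace E Q] [IsManifold 𝓘(ℝ, E) ∞ Q]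

open JetSpace

variable {k : ℕ} {e : OpenPartialHomeomorph Q E}

/-- The expression of a `1`-form of `T^k Q` in the natural coordinates over `e`. -/
def rep (e : OpenPartialHomeomorph Q E) (μ : OneForm (modelT E k) (JetSpace E Q k))
    (y : Fin (k + 1) → E) : (Fin (k + 1) → E) →L[ℝ] ℝ :=
  (μ (ofCoords e y) : (Fin (k + 1) → E) →L[ℝ] ℝ).comp (frame k e y)

theorem rep_apply (μ : OneForm (modelT E k) (JetSpace E Q k)) (y v : Fin (k + 1) → E) :
    rep e μ y v = (μ (ofCoords e y) : (Fin (k + 1) → E) →L[ℝ] ℝ) (frame k e y v) := rfl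

theorem rep_self (μ : OneForm (modelT E k) (JetSpace E Q k)) (p : JetSpace E Q k) :
    rep (chartAt E p.base) μ (coords (chartAt E p.base) p) = μ p := by
  unfold rep
  rw [frame_self, ofCoords_coords (chart_mem_atlas E _) (mem_chart_source E _)]
  rfl

/-- Smooth `1`-forms on `T^k Q`: those with smooth expressions in natural coordinates. -/
def IsSmoothForm (μ : OneForm (modelT E k) (JetSpace E Q k)) : Prop :=
  ∀ e ∈ atlas E Q, ∀ y : Fin (k + 1) → E, y 0 ∈ e.target → ContDiffAt ℝ ∞ (rep e μ) y

theorem rep_prolong {e' : OpenPartialHomeomorph Q E} (he : e ∈ atlas E Q) (he' : e' ∈ atlas E Q)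
    (μ : OneForm (modelT E k) (JetSpace E Q k)) {y : Fin (k + 1) → E} (hy : y 0 ∈ e.target)
    (hy' : e.symm (y 0) ∈ e'.source) :
    rep e μ y = (rep e' μ (prolong k (e' ∘ e.symm) y)).comp
      (fderiv ℝ (prolong k (e' ∘ e.symm)) y) := by
  unfold rep
  rw [ofCoords_prolong he he' hy hy', frame_comp_prolong he he' hy hy']
  rfl

/-- Definitional, because the chart at `p` is the natural chart over the chart of `Q` at `p.base`.
-/
theorem extDeriv_self (μ : OneForm (modelT E k) (JetSpace E Q k)) (p : JetSpace E Q k)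
    (u v : Fin (k + 1) → E) :
    μ.extDeriv p u v =
      fderiv ℝ (rep (chartAt E p.base) μ) (coords (chartAt E p.base) p) u v -
      fderiv ℝ (rep (chartAt E p.base) μ) (coords (chartAt E p.base) p) v u := rfl

/-- The exterior derivative can be computed in any natural chart. -/
theorem extDeriv_frame {μ : OneForm (modelT E k) (JetSpace E Q k)} (hμ : IsSmoothForm μ)
    (he : e ∈ atlas E Q) {y : Fin (k + 1) → E} (hy : y 0 ∈ e.target) (u v : Fin (k + 1) → E) :
    μ.extDeriv (ofCoords e y) (frame k e y u) (frame k e y v) =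
      fderiv ℝ (rep e μ) y u v - fderiv ℝ (rep e μ) y v u := by
  set e' := chartAt E (ofCoords e y : JetSpace E Q k).base with he'_def
  have he' : e' ∈ atlas E Q := chart_mem_atlas E _
  have hy' : e.symm (y 0) ∈ e'.source := by
    rw [he'_def, base_ofCoords]; exact mem_chart_source E _
  have hz : prolong k (e' ∘ e.symm) y = coords e' (ofCoords e y : JetSpace E Q k) :=
    funext fun i => (coords_ofCoords he he' hy hy' i).symm
  have hz0 : prolong k (e' ∘ e.symm) y 0 ∈ e'.target := by
    rw [prolong_zero]; exact e'.map_source hy'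
  have hev : rep e μ =ᶠ[𝓝 y] fun w => (rep e' μ (prolong k (e' ∘ e.symm) w)).comp
      (fderiv ℝ (prolong k (e' ∘ e.symm)) w) := by
    have hopen : ∀ᶠ z in 𝓝 y, z 0 ∈ (e.symm.trans e').source :=
      ((e.symm.trans e').open_source.preimage (continuous_apply (0 : Fin (k + 1)))).mem_nhds
        (by simp [hy, hy'])
    filter_upwards [hopen] with z hz
    have hz2 : z 0 ∈ e.target ∧ e.symm (z 0) ∈ e'.source := by simpa using hz
    exact rep_prolong he he' μ hz2.1 hz2.2
  rw [hev.fderiv_eq, fderiv_pullback_sub ((hμ e' he' _ hz0).differentiableAt (by simp))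
    ((contDiffAt_prolong (contDiffAt_transition he he' hy hy')).of_le ENat.LEInfty.out)]
  refine (extDeriv_self μ _ _ _).trans ?_
  rw [← he'_def, hz, frame_eq he hy]

theorem mdifferentiableAt_of_comp_ofCoords {F : Type*} [NormedAddCommGroup F] [NormedSpace ℝ F]
    {f : JetSpace E Q k → F} (he : e ∈ atlas E Q)
    {y : Fin (k + 1) → E} (hy : y 0 ∈ e.target) (hf : DifferentiableAt ℝ (f ∘ ofCoords e) y) :
    MDifferentiableAt (modelT E k) 𝓘(ℝ, F) f (ofCoords e y) := by
  have hb := base_ofCoords_mem (k := k) (Q := Q) hy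
  have hc := (contMDiffAt_coords (k := k) he hb).mdifferentiableAt (by simp)
  have hf' : MDifferentiableAt 𝓘(ℝ, Fin (k + 1) → E) 𝓘(ℝ, F) (f ∘ ofCoords e)
      (coords e (ofCoords e y : JetSpace E Q k)) := by
    rw [coords_ofCoords_self he hy]
    exact hf.mdifferentiableAt
  refine (hf'.comp _ hc).congr_of_eventuallyEq ?_
  filter_upwards [eventually_base_mem he hb] with p hp
  simp [ofCoords_coords he hp]

theorem contDiffAt_comp_ofCoords {F : Type*} [NormedAddCommGroup F] [NormedSpace ℝ F]
    {f : JetSpace E Q k → F} (hf : ContMDiff (modelT E k) 𝓘(ℝ, F) ∞ f) (he : e ∈ atlas E Q)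
    {y : Fin (k + 1) → E} (hy : y 0 ∈ e.target) : ContDiffAt ℝ ∞ (f ∘ ofCoords e) y :=
  (hf.contMDiffAt.comp y (contMDiffAt_ofCoords he hy)).contDiffAt

theorem differential_frame {f : JetSpace E Q k → ℝ} (he : e ∈ atlas E Q)
    {y : Fin (k + 1) → E} (hy : y 0 ∈ e.target) (hf : DifferentiableAt ℝ (f ∘ ofCoords e) y)
    (v : Fin (k + 1) → E) :
    differential (modelT E k) f (ofCoords e y) (frame k e y v) = fderiv ℝ (f ∘ ofCoords e) y v := by
  have h := (mdifferentiableAt_of_comp_ofCoords he hy hf).hasMFDerivAt.comp y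
    (hasMFDerivAt_ofCoords he hy)
  have h' := h.mfderiv.symm.trans mfderiv_eq_fderiv
  exact congrArg (fun A : (Fin (k + 1) → E) →L[ℝ] ℝ => A v) h'

theorem rep_verticalDiff {f : JetSpace E Q k → ℝ} (he : e ∈ atlas E Q) (r : ℕ)
    {y : Fin (k + 1) → E} (hy : y 0 ∈ e.target) (hf : DifferentiableAt ℝ (f ∘ ofCoords e) y) :
    rep e (verticalDiff r f) y = (fderiv ℝ (f ∘ ofCoords e) y).comp (vertL k r) := by
  ext v
  rw [ContinuousLinearMap.comp_apply, ← differential_frame he hy hf]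
  exact congrArg (fun u : Fin (k + 1) → E => differential (modelT E k) f (ofCoords e y) u)
    (verticalEndo_frame he hy r v)

/-- Cartan's formula in coordinates: the term differentiating `μ` along the test vector occurs in
`i_T dμ` and in `d i_T μ` with opposite signs and drops out, leaving a Lie derivative. -/
theorem rep_tulczyjew {μ : OneForm (modelT E k) (JetSpace E Q k)} (hμ : IsSmoothForm μ)
    (he : e ∈ atlas E Q) {y : Fin (k + 1 + 1) → E} (hy : y 0 ∈ e.target) :
    rep e (tulczyjew μ) y =
      (fderiv ℝ (rep e μ) (truncL (Nat.le_succ k) y) (shiftL le_rfl y)).comp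
        (truncL (Nat.le_succ k)) +
      (rep e μ (truncL (Nat.le_succ k) y)).comp (shiftL le_rfl) := by
  have hyt : truncL (Nat.le_succ k) y 0 ∈ e.target := hy
  have hdμ : DifferentiableAt ℝ (rep e μ) (truncL (Nat.le_succ k) y) :=
    (hμ e he _ hyt).differentiableAt (by simp)
  have hev : (fun p' : JetSpace E Q (k + 1) =>
        μ (JetSpace.proj (Nat.le_succ k) p') (canonicalInjection le_rfl p')) ∘ ofCoords e
      =ᶠ[𝓝 y] fun z => rep e μ (truncL (Nat.le_succ k) z) (shiftL le_rfl z) := by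
    filter_upwards [eventually_domain hy] with z hz
    rw [rep_apply, ← canonicalInjection_ofCoords le_rfl he hz, ← proj_ofCoords _ he hz]
    rfl
  have hg : HasFDerivAt (fun z => rep e μ (truncL (Nat.le_succ k) z) (shiftL le_rfl z))
      (_ : (Fin (k + 1 + 1) → E) →L[ℝ] ℝ) y :=
    (hdμ.hasFDerivAt.comp y (truncL (E := E) (Nat.le_succ k)).hasFDerivAt).clm_apply
      (shiftL (E := E) (le_refl (k + 1))).hasFDerivAt
  have hf := hg.congr_of_eventuallyEq hev
  ext v
  rw [rep_apply]
  have h1 := differential_frame he hy hf.differentiableAt v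
  rw [hf.fderiv] at h1
  have h2 : μ.extDeriv (JetSpace.proj (Nat.le_succ k) (ofCoords e y))
      (canonicalInjection le_rfl (ofCoords e y))
      (mfderiv (modelT E (k + 1)) (modelT E k) (JetSpace.proj (Nat.le_succ k))
        (ofCoords e y : JetSpace E Q (k + 1)) (frame (k + 1) e y v)) =
      fderiv ℝ (rep e μ) (truncL (Nat.le_succ k) y) (shiftL le_rfl y) (truncL (Nat.le_succ k) v) -
      fderiv ℝ (rep e μ) (truncL (Nat.le_succ k) y) (truncL (Nat.le_succ k) v)
        (shiftL le_rfl y) := by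
    rw [← extDeriv_frame hμ he hyt, ← canonicalInjection_ofCoords le_rfl he hy,
      ← mfderiv_proj_frame (Nat.le_succ k) he hy, ← proj_ofCoords _ he hy]
  refine (congrArg₂ (· + ·) h2 h1).trans ?_
  simp

theorem rep_pullback_proj {r : ℕ} (h : r ≤ k) (μ : OneForm (modelT E r) (JetSpace E Q r))
    (he : e ∈ atlas E Q) {y : Fin (k + 1) → E} (hy : y 0 ∈ e.target) :
    rep e (μ.pullback (I' := modelT E k) (proj h : JetSpace E Q k → JetSpace E Q r)) y =
      (rep e μ (truncL h y)).comp (truncL h) := by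
  ext v
  rw [rep_apply, ContinuousLinearMap.comp_apply, rep_apply, ← mfderiv_proj_frame h he hy,
    ← proj_ofCoords h he hy]
  rfl

theorem IsSmoothForm.congr {μ : OneForm (modelT E k) (JetSpace E Q k)}
    (h : ∀ e ∈ atlas E Q, ∀ y : Fin (k + 1) → E, y 0 ∈ e.target →
      ∃ f : (Fin (k + 1) → E) → (Fin (k + 1) → E) →L[ℝ] ℝ, ContDiffAt ℝ ∞ f y ∧
        ∀ z : Fin (k + 1) → E, z 0 ∈ e.target → rep e μ z = f z) : IsSmoothForm μ := by
  intro e he y hy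
  obtain ⟨f, hf, hff⟩ := h e he y hy
  refine hf.congr_of_eventuallyEq ?_
  filter_upwards [eventually_domain hy] with z hz using hff z hz

theorem isSmoothForm_verticalDiff {f : JetSpace E Q k → ℝ}
    (hf : ContMDiff (modelT E k) 𝓘(ℝ, ℝ) ∞ f) (r : ℕ) : IsSmoothForm (verticalDiff r f) := by
  refine IsSmoothForm.congr fun e he y hy =>
    ⟨fun y => (fderiv ℝ (f ∘ ofCoords e) y).comp (vertL k r), ?_, fun z hz =>
      rep_verticalDiff he r hz ((contDiffAt_comp_ofCoords hf he hz).differentiableAt (by simp))⟩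
  exact ((contDiffAt_comp_ofCoords hf he hy).fderiv_right (m := ∞) (by simp)).clm_comp
    contDiffAt_const

theorem IsSmoothForm.tulczyjew {μ : OneForm (modelT E k) (JetSpace E Q k)} (hμ : IsSmoothForm μ) :
    IsSmoothForm (tulczyjew μ) := by
  refine IsSmoothForm.congr fun e he y hy => ⟨_, ?_, fun z hz => rep_tulczyjew hμ he hz⟩
  have hyt : truncL (Nat.le_succ k) y 0 ∈ e.target := hy
  have h := hμ e he _ hyt
  have ht := (truncL (E := E) (Nat.le_succ k)).contDiff.contDiffAt (n := ∞) (x := y)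
  have hs := (shiftL (E := E) (le_refl (k + 1))).contDiff.contDiffAt (n := ∞) (x := y)
  exact ((((h.fderiv_right (m := ∞) (by simp)).comp y ht).clm_apply hs).clm_comp
    contDiffAt_const).add ((h.comp y ht).clm_comp contDiffAt_const)

theorem IsSmoothForm.tulczyjewIter {μ : OneForm (modelT E k) (JetSpace E Q k)}
    (hμ : IsSmoothForm μ) (s : ℕ) : IsSmoothForm (tulczyjewIter μ s) := by
  induction s with
  | zero => exact hμ
  | succ s ih => exact ih.tulczyjew

theorem rep_sum_smul {ι : Type*} (t : Finset ι) (c : ι → ℝ)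
    (μ : ι → OneForm (modelT E k) (JetSpace E Q k)) (y : Fin (k + 1) → E) :
    rep e (∑ i ∈ t, c i • μ i) y = ∑ i ∈ t, c i • rep e (μ i) y := by
  classical
  induction t using Finset.induction_on with
  | empty => ext v; rfl
  | insert i t hi ih =>
    rw [Finset.sum_insert hi, Finset.sum_insert hi, ← ih]
    rfl

/-- The Lagrangian `1`-form in natural coordinates. -/
theorem rep_lagrangianOneForm (L : JetSpace E Q k → ℝ) (he : e ∈ atlas E Q)
    {y : Fin (2 * k - 1 + 1) → E} (hy : y 0 ∈ e.target) :
    rep e (lagrangianOneForm L) y =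
      ∑ s : Fin k, ((-1 : ℝ) ^ (s : ℕ) / ((s : ℕ) + 1).factorial) •
        (rep e (tulczyjewIter (verticalDiff ((s : ℕ) + 1) L) s)
          (truncL (show k + (s : ℕ) ≤ 2 * k - 1 by omega) y)).comp
          (truncL (show k + (s : ℕ) ≤ 2 * k - 1 by omega)) := by
  unfold lagrangianOneForm
  rw [rep_sum_smul]
  exact Finset.sum_congr rfl fun s _ => by rw [rep_pullback_proj _ _ he hy]

theorem isSmoothForm_lagrangianOneForm {L : JetSpace E Q k → ℝ}
    (hL : ContMDiff (modelT E k) 𝓘(ℝ, ℝ) ∞ L) : IsSmoothForm (lagrangianOneForm L) := by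
  refine IsSmoothForm.congr fun e he y hy => ⟨_, ?_, fun z hz => rep_lagrangianOneForm L he hz⟩
  refine ContDiffAt.sum fun s _ => ContDiffAt.const_smul _ ?_
  have ht := (truncL (E := E) (show k + (s : ℕ) ≤ 2 * k - 1 by omega)).contDiff.contDiffAt
    (n := ∞) (x := y)
  exact ((((isSmoothForm_verticalDiff hL (s + 1)).tulczyjewIter s) e he (truncL _ y) hy).comp y
    ht).clm_comp contDiffAt_const

end Rep

/-! ### Total derivatives of differential forms in coordinates -/

section TotalDerivative

variable {E : Type*} [NormedAddCommGroup E] [NormedSpace ℝ E] {N : ℕ}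

variable (E N) in
/-- The truncated total derivative field `(y_0, …, y_N) ↦ (y_1, …, y_N, 0)`. -/
def totalL : (Fin (N + 1) → E) →L[ℝ] (Fin (N + 1) → E) :=
  ContinuousLinearMap.pi fun i =>
    if h : (i : ℕ) + 1 < N + 1 then
      ContinuousLinearMap.proj (R := ℝ) (φ := fun _ : Fin (N + 1) => E) ⟨i + 1, h⟩
    else 0

theorem totalL_apply (y : Fin (N + 1) → E) (i : Fin (N + 1)) :
    totalL E N y i = if h : (i : ℕ) + 1 < N + 1 then y ⟨i + 1, h⟩ else 0 := by
  simp only [totalL, ContinuousLinearMap.coe_pi']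
  split_ifs <;> rfl

/-- The Lie derivative of a `1`-form along the truncated total derivative field. -/
def lieTotal (μ : (Fin (N + 1) → E) → (Fin (N + 1) → E) →L[ℝ] ℝ) (y : Fin (N + 1) → E) :
    (Fin (N + 1) → E) →L[ℝ] ℝ :=
  fderiv ℝ μ y (totalL E N y) + (μ y).comp (totalL E N)

/-- On `U`, the form `μ` is a combination of `dq_0, …, dq_{a-1}`. -/
def SemibasicOn (U : Set (Fin (N + 1) → E)) (a : ℕ)
    (μ : (Fin (N + 1) → E) → (Fin (N + 1) → E) →L[ℝ] ℝ) : Prop :=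
  ∀ y ∈ U, ∀ v : Fin (N + 1) → E, (∀ i : Fin (N + 1), (i : ℕ) < a → v i = 0) → μ y v = 0

variable {U : Set (Fin (N + 1) → E)} {μ ν : (Fin (N + 1) → E) → (Fin (N + 1) → E) →L[ℝ] ℝ}

theorem lieTotal_congr (hU : IsOpen U) (h : ∀ y ∈ U, μ y = ν y) :
    ∀ y ∈ U, lieTotal μ y = lieTotal ν y := by
  intro y hy
  have hev : μ =ᶠ[𝓝 y] ν := by filter_upwards [hU.mem_nhds hy] with z hz using h z hz
  rw [lieTotal, lieTotal, hev.fderiv_eq, h y hy]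

theorem lieTotal_zero (y : Fin (N + 1) → E) :
    lieTotal (fun _ => 0 : (Fin (N + 1) → E) → (Fin (N + 1) → E) →L[ℝ] ℝ) y = 0 := by
  simp [lieTotal]

theorem lieTotal_add_smul {y : Fin (N + 1) → E} (hμ : ContDiffAt ℝ ∞ μ y)
    (hν : ContDiffAt ℝ ∞ ν y) (c : ℝ) :
    lieTotal (fun z => μ z + c • ν z) y = lieTotal μ y + c • lieTotal ν y := by
  have h1 := hμ.differentiableAt (by simp)
  have h2 := hν.differentiableAt (by simp)
  have h := (h1.hasFDerivAt.add (h2.hasFDerivAt.const_smul c)).fderiv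
  have h' : fderiv ℝ (fun z => μ z + c • ν z) y = fderiv ℝ μ y + c • fderiv ℝ ν y := h
  ext v
  simp only [lieTotal, h']
  simp
  ring

theorem lieTotal_sum_smul {ι : Type*} (t : Finset ι) (c : ι → ℝ)
    (f : ι → (Fin (N + 1) → E) → (Fin (N + 1) → E) →L[ℝ] ℝ) {y : Fin (N + 1) → E}
    (hf : ∀ i ∈ t, ContDiffAt ℝ ∞ (f i) y) :
    lieTotal (fun z => ∑ i ∈ t, c i • f i z) y = ∑ i ∈ t, c i • lieTotal (f i) y := by
  classical
  induction t using Finset.induction_on with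
  | empty => simp [lieTotal_zero]
  | insert i t hi ih =>
    have h1 := fun j hj => hf j (Finset.mem_insert_of_mem hj)
    simp only [Finset.sum_insert hi]
    have h2 : ContDiffAt ℝ ∞ (fun z => ∑ j ∈ t, c j • f j z) y :=
      ContDiffAt.sum fun j hj => (h1 j hj).const_smul (c j)
    have h3 := lieTotal_add_smul h2 (hf i (Finset.mem_insert_self i t)) (c i)
    have h4 : lieTotal (fun z => c i • f i z + ∑ j ∈ t, c j • f j z) y =
        lieTotal (fun z => ∑ j ∈ t, c j • f j z + c i • f i z) y := by
      congr 1
      funext z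
      exact add_comm _ _
    rw [h4, h3, ih h1]
    exact add_comm _ _

theorem contDiffAt_lieTotal {y : Fin (N + 1) → E} (hμ : ContDiffAt ℝ ∞ μ y) :
    ContDiffAt ℝ ∞ (lieTotal μ) y :=
  ((hμ.fderiv_right (m := ∞) (by simp)).clm_apply (totalL E N).contDiff.contDiffAt).add
    (hμ.clm_comp contDiffAt_const)

theorem contDiffAt_lieTotal_iterate {y : Fin (N + 1) → E} (hμ : ContDiffAt ℝ ∞ μ y) (j : ℕ) :
    ContDiffAt ℝ ∞ (lieTotal^[j] μ) y := by
  induction j with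
  | zero => exact hμ
  | succ j ih =>
    rw [Function.iterate_succ_apply']
    exact contDiffAt_lieTotal ih

theorem SemibasicOn.mono {a b : ℕ} (h : SemibasicOn U a μ) (hab : a ≤ b) : SemibasicOn U b μ :=
  fun y hy v hv => h y hy v fun i hi => hv i (hi.trans_le hab)

/-- `totalL` lowers the index of each component by one, so the Lie derivative can involve at most
one further differential. -/
theorem SemibasicOn.lieTotal (hU : IsOpen U) (hμ : ∀ y ∈ U, ContDiffAt ℝ ∞ μ y) {a : ℕ}
    (h : SemibasicOn U a μ) : SemibasicOn U (a + 1) (lieTotal μ) := by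
  intro y hy v hv
  have hd := (hμ y hy).differentiableAt (by simp)
  have h1 : fderiv ℝ μ y (totalL E N y) v = 0 := by
    -- With `v` fixed, `μ` vanishes on it at all nearby points, hence so does any derivative of `μ`.
    have h2 : (fun z => μ z v) =ᶠ[𝓝 y] fun _ => 0 := by
      filter_upwards [hU.mem_nhds hy] with z hz using h z hz v fun i hi => hv i (by omega)
    have h3 := h2.fderiv_eq (𝕜 := ℝ)
    rw [fderiv_clm_apply hd (differentiableAt_const v)] at h3
    simpa using congrArg (fun A : (Fin (N + 1) → E) →L[ℝ] ℝ => A (totalL E N y)) h3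
  have h2 : μ y (totalL E N v) = 0 := h y hy _ fun i hi => by
    rw [totalL_apply]
    split_ifs
    · exact hv _ (by simp; omega)
    · rfl
  simp [SkinnerRusk.lieTotal, h1, h2]

theorem SemibasicOn.lieTotal_iterate (hU : IsOpen U) (hμ : ∀ y ∈ U, ContDiffAt ℝ ∞ μ y) {a : ℕ}
    (h : SemibasicOn U a μ) (j : ℕ) : SemibasicOn U (a + j) (SkinnerRusk.lieTotal^[j] μ) := by
  induction j with
  | zero => exact h
  | succ j ih =>
    rw [Function.iterate_succ_apply']
    exact ih.lieTotal hU fun y hy => contDiffAt_lieTotal_iterate (hμ y hy) j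

/-- Commutation of the vertical endomorphism with the Lie derivative. -/
theorem lieTotal_vertL (hμ : ∀ y ∈ U, ContDiffAt ℝ ∞ μ y)
    (h : SemibasicOn U N μ) {y : Fin (N + 1) → E} (hy : y ∈ U) (v : Fin (N + 1) → E) :
    lieTotal μ y (vertL N 1 v) = lieTotal (fun z => (μ z).comp (vertL N 1)) y v + μ y v := by
  have hd := (hμ y hy).differentiableAt (by simp)
  have h1 : fderiv ℝ (fun z => (μ z).comp (vertL N 1)) y (totalL E N y) v =
      fderiv ℝ μ y (totalL E N y) (vertL N 1 v) := by
    rw [(hd.hasFDerivAt.clm_comp (hasFDerivAt_const (vertL N 1) y)).fderiv]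
    simp
  -- The commutator of `totalL` and `vertL N 1` is the identity except in the last component, an
  -- artefact of cutting off at order `N`; a form semibasic of order `N` does not see it.
  have h2 : μ y (totalL E N (vertL N 1 v) - vertL N 1 (totalL E N v) - v) = 0 := by
    refine h y hy _ fun i hi => ?_
    simp only [Pi.sub_apply, totalL_apply, vertL_apply, Nat.descFactorial_one]
    rw [dif_pos (by omega)]
    rcases Nat.eq_zero_or_pos (i : ℕ) with h0 | h0
    · have : i = 0 := Fin.ext h0
      subst this
      simp
    · rw [dif_pos (by omega)]
      have e1 : (⟨(i : ℕ) - 1 + 1, by omega⟩ : Fin (N + 1)) = i := Fin.ext (by simp; omega)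
      simp only [e1, Nat.add_sub_cancel, Fin.eta]
      push_cast
      module
  simp only [map_sub] at h2
  simp only [lieTotal, _root_.add_apply, ContinuousLinearMap.comp_apply, h1]
  linarith

theorem vertL_zero : (vertL N 0 : (Fin (N + 1) → E) →L[ℝ] _) = ContinuousLinearMap.id ℝ _ := by
  ext v i
  simp

/-- The coefficients multiply by the recursion for falling factorials. -/
theorem vertL_comp_one (r : ℕ) :
    (vertL N r).comp (vertL N 1) = (vertL N (r + 1) : (Fin (N + 1) → E) →L[ℝ] _) := by
  ext v i
  simp only [ContinuousLinearMap.comp_apply, vertL_apply, smul_smul, Nat.descFactorial_one,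
    Nat.descFactorial_succ (i : ℕ) r, Nat.sub_sub]
  push_cast
  rw [mul_comm]

/-- The image of `J_1` is the whole vertical space: shift the components down and divide by the
index. The last component of the preimage is free and set to zero. -/
theorem exists_vertL_one_eq {w : Fin (N + 1) → E} (hw : w 0 = 0) : ∃ x, vertL N 1 x = w := by
  refine ⟨fun i => if h : (i : ℕ) + 1 < N + 1 then ((i : ℝ) + 1)⁻¹ • w ⟨i + 1, h⟩ else 0, ?_⟩
  funext i
  rcases Nat.eq_zero_or_pos (i : ℕ) with h0 | h0
  · have : i = 0 := Fin.ext h0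
    subst this
    simp [hw]
  · rw [vertL_apply, dif_pos (by simp; omega)]
    have e1 : (⟨(i : ℕ) - 1 + 1, by omega⟩ : Fin (N + 1)) = i := Fin.ext (by simp; omega)
    have e2 : (((i : ℕ) - 1 : ℕ) : ℝ) + 1 = i := by
      rw [Nat.cast_sub h0]; simp
    have e3 : ((i : ℕ) : ℝ) ≠ 0 := by positivity
    simp only [e1, e2, Nat.descFactorial_one, smul_smul, mul_inv_cancel₀ e3, one_smul]

/-! ### The Euler–Lagrange form and the Cartan form of a function of order `k` -/

section EulerLagrange

variable {ℓ : (Fin (N + 1) → E) → ℝ} {k : ℕ}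

/-- The form `d_T^j d_{J_r} ℓ` in coordinates. -/
def lieVert (ℓ : (Fin (N + 1) → E) → ℝ) (r j : ℕ) :
    (Fin (N + 1) → E) → (Fin (N + 1) → E) →L[ℝ] ℝ :=
  lieTotal^[j] fun y => (fderiv ℝ ℓ y).comp (vertL N r)

theorem lieVert_succ (r j : ℕ) : lieVert ℓ r (j + 1) = lieTotal (lieVert ℓ r j) :=
  Function.iterate_succ_apply' _ _ _

theorem contDiffAt_lieVert {y : Fin (N + 1) → E} (hℓ : ContDiffAt ℝ ∞ ℓ y) (r j : ℕ) :
    ContDiffAt ℝ ∞ (lieVert ℓ r j) y :=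
  contDiffAt_lieTotal_iterate
    ((hℓ.fderiv_right (m := ∞) (by simp)).clm_comp contDiffAt_const) j

/-- Composing with `J_r` lowers the order of the differentials involved by `r`, and each Lie
derivative raises it by one. -/
theorem semibasicOn_lieVert (hU : IsOpen U) (hℓ : ∀ y ∈ U, ContDiffAt ℝ ∞ ℓ y)
    (hk : SemibasicOn U (k + 1) (fderiv ℝ ℓ)) {a r : ℕ} (ha : k + 1 ≤ a + r) (j : ℕ) :
    SemibasicOn U (a + j) (lieVert ℓ r j) := by
  refine SemibasicOn.lieTotal_iterate hU (fun y hy =>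
    ((hℓ y hy).fderiv_right (m := ∞) (by simp)).clm_comp contDiffAt_const) ?_ j
  intro y hy v hv
  refine hk y hy _ fun i hi => ?_
  refine (vertL_apply v i).trans ?_
  rcases Nat.lt_or_ge (i : ℕ) r with h | h
  · simp [Nat.descFactorial_eq_zero_iff_lt.2 h]
  · rw [hv _ (by simp; omega), smul_zero]

/-- Moving `J_1` through the Lie derivatives one at a time: each passage leaves one extra copy of
the form with one derivative less, while `J_1` itself merges with `J_r` into `J_{r+1}`. The bound `j
< r` keeps every form involved semibasic of order at most `k ≤ N`, where the commutation holds. -/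
theorem lieVert_vertL (hU : IsOpen U) (hℓ : ∀ y ∈ U, ContDiffAt ℝ ∞ ℓ y)
    (hk : SemibasicOn U (k + 1) (fderiv ℝ ℓ)) (hN : k ≤ N) {r : ℕ} (hr : r ≤ k) (j : ℕ)
    (hj : j < r) : ∀ y ∈ U, ∀ v : Fin (N + 1) → E,
    lieVert ℓ r (j + 1) y (vertL N 1 v) =
      lieVert ℓ (r + 1) (j + 1) y v + ((j : ℝ) + 1) * lieVert ℓ r j y v := by
  have hsb : ∀ i < r, SemibasicOn U N (lieVert ℓ r i) := fun i hi =>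
    (semibasicOn_lieVert hU hℓ hk (a := k + 1 - r) (by omega) i).mono (by omega)
  have h0 : ∀ y, (lieVert ℓ r 0 y).comp (vertL N 1) = lieVert ℓ (r + 1) 0 y := fun y => by
    change ((fderiv ℝ ℓ y).comp (vertL N r)).comp (vertL N 1) = (fderiv ℝ ℓ y).comp _
    rw [ContinuousLinearMap.comp_assoc, vertL_comp_one]
  induction j with
  | zero =>
    intro y hy v
    rw [lieVert_succ, lieTotal_vertL (fun z hz => contDiffAt_lieVert (hℓ z hz) r 0)
      (hsb 0 hj) hy, lieVert_succ]
    simp only [h0]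
    simp
  | succ j ih =>
    intro y hy v
    have h1 : ∀ z ∈ U, (lieVert ℓ r (j + 1) z).comp (vertL N 1) =
        lieVert ℓ (r + 1) (j + 1) z + ((j : ℝ) + 1) • lieVert ℓ r j z := by
      intro z hz
      ext w
      simpa using ih (by omega) z hz w
    rw [lieVert_succ, lieTotal_vertL (fun z hz => contDiffAt_lieVert (hℓ z hz) r (j + 1))
      (hsb (j + 1) hj) hy, lieTotal_congr hU h1 y hy,
      lieTotal_add_smul (contDiffAt_lieVert (hℓ y hy) _ _) (contDiffAt_lieVert (hℓ y hy) _ _),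
      ← lieVert_succ, ← lieVert_succ]
    simp
    ring

/-- The image of `J_{k+1}` has no components of order at most `k`, and these are the only ones that
the differential of `ℓ` sees. -/
theorem lieVert_eq_zero (hU : IsOpen U)
    (hk : SemibasicOn U (k + 1) (fderiv ℝ ℓ)) (j : ℕ) :
    ∀ y ∈ U, lieVert ℓ (k + 1) j y = 0 := by
  induction j with
  | zero =>
    intro y hy
    ext v
    refine hk y hy _ fun i hi => ?_
    refine (vertL_apply v i).trans ?_
    rw [Nat.descFactorial_eq_zero_iff_lt.2 hi]
    simp
  | succ j ih =>
    intro y hy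
    rw [lieVert_succ, lieTotal_congr hU ih y hy, lieTotal_zero]

/-- The Euler–Lagrange form `∑_r (-1)^r / r! d_T^r d_{J_r} ℓ` is a multiple of `dq_0`. -/
theorem eulerLagrange_semibasic (hU : IsOpen U) (hℓ : ∀ y ∈ U, ContDiffAt ℝ ∞ ℓ y)
    (hk : SemibasicOn U (k + 1) (fderiv ℝ ℓ)) (hN : k ≤ N) {y : Fin (N + 1) → E} (hy : y ∈ U)
    {v : Fin (N + 1) → E} (hv : v 0 = 0) :
    ∑ r ∈ Finset.range (k + 1), ((-1 : ℝ) ^ r / r.factorial) * lieVert ℓ r r y v = 0 := by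
  obtain ⟨x, rfl⟩ := exists_vertL_one_eq hv
  -- Telescoping: the commutation produces the factor `n + 1`, which turns `1 / (n + 1)!` into `1 /
  -- n!`, and the sign makes the new lower term cancel the previous remainder.
  have key : ∀ n ≤ k, ∑ r ∈ Finset.range (n + 1),
      ((-1 : ℝ) ^ r / r.factorial) * lieVert ℓ r r y (vertL N 1 x) =
      ((-1 : ℝ) ^ n / n.factorial) * lieVert ℓ (n + 1) n y x := by
    intro n
    induction n with
    | zero =>
      intro _
      rw [Finset.sum_range_one]
      congr 1
      change (fderiv ℝ ℓ y) (vertL N 0 (vertL N 1 x)) = (fderiv ℝ ℓ y) (vertL N 1 x)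
      rw [vertL_zero]
      rfl
    | succ n ih =>
      intro hn
      rw [Finset.sum_range_succ, ih (by omega),
        lieVert_vertL hU hℓ hk hN hn n (by omega) y hy x, Nat.factorial_succ]
      have : (n.factorial : ℝ) ≠ 0 := by positivity
      have : (n : ℝ) + 1 ≠ 0 := by positivity
      push_cast
      field_simp
      ring
  rw [key k le_rfl, lieVert_eq_zero hU hk k y hy]
  simp

/-- The Lagrangian `1`-form in coordinates. -/
def cartanForm (k : ℕ) (ℓ : (Fin (N + 1) → E) → ℝ) (y : Fin (N + 1) → E) :
    (Fin (N + 1) → E) →L[ℝ] ℝ :=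
  ∑ s : Fin k, ((-1 : ℝ) ^ (s : ℕ) / ((s : ℕ) + 1).factorial) • lieVert ℓ (s + 1) s y

/-- In the term of index `s`, `J_{s+1}` leaves the differentials of order below `k - s`, and `s` Lie
derivatives bring the bound back to `k`. -/
theorem semibasicOn_cartanForm (hU : IsOpen U) (hℓ : ∀ y ∈ U, ContDiffAt ℝ ∞ ℓ y)
    (hk : SemibasicOn U (k + 1) (fderiv ℝ ℓ)) : SemibasicOn U k (cartanForm k ℓ) := by
  intro y hy v hv
  rw [cartanForm, _root_.sum_apply]
  refine Finset.sum_eq_zero fun s _ => ?_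
  have h := (semibasicOn_lieVert hU hℓ hk (a := k - s) (r := s + 1) (by omega) s).mono
    (b := k) (by omega) y hy v hv
  simp [h]

/-- `d_T θ = dℓ` up to multiples of `dq_0`. -/
theorem lieTotal_cartanForm (hU : IsOpen U) (hℓ : ∀ y ∈ U, ContDiffAt ℝ ∞ ℓ y)
    (hk : SemibasicOn U (k + 1) (fderiv ℝ ℓ)) (hN : k ≤ N) {y : Fin (N + 1) → E} (hy : y ∈ U)
    {v : Fin (N + 1) → E} (hv : v 0 = 0) :
    lieTotal (cartanForm k ℓ) y v = fderiv ℝ ℓ y v := by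
  have h1 : lieTotal (cartanForm k ℓ) y =
      ∑ s : Fin k, ((-1 : ℝ) ^ (s : ℕ) / ((s : ℕ) + 1).factorial) •
        lieVert ℓ (s + 1) (s + 1) y := by
    refine (lieTotal_sum_smul _ _ _ fun s _ => contDiffAt_lieVert (hℓ y hy) _ _).trans ?_
    simp only [lieVert_succ]
  have h2 := eulerLagrange_semibasic hU hℓ hk hN hy hv
  -- The term `r = 0` of the Euler–Lagrange form is the differential of `ℓ`; the others add up to
  -- minus the Lie derivative of the Cartan form.
  rw [Finset.sum_range_succ'] at h2
  have h3 : lieVert ℓ 0 0 y v = fderiv ℝ ℓ y v := by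
    change (fderiv ℝ ℓ y) (vertL N 0 v) = _
    rw [vertL_zero]
    rfl
  rw [h1, _root_.sum_apply, Fin.sum_univ_eq_sum_range (fun s =>
    (((-1 : ℝ) ^ s / (s + 1).factorial) • lieVert ℓ (s + 1) (s + 1) y) v) k, ← h3]
  have h4 : ∀ s ∈ Finset.range k, (((-1 : ℝ) ^ s / (s + 1).factorial) •
      lieVert ℓ (s + 1) (s + 1) y) v =
      -(((-1 : ℝ) ^ (s + 1) / (s + 1).factorial) * lieVert ℓ (s + 1) (s + 1) y v) := by
    intro s _
    simp only [_root_.smul_apply, smul_eq_mul, pow_succ]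
    ring
  rw [Finset.sum_congr rfl h4, Finset.sum_neg_distrib]
  simp at h2
  linarith

end EulerLagrange

end TotalDerivative

/-! ### The Lagrangian form in natural coordinates -/

section LagrangianForm

variable {E : Type*} [NormedAddCommGroup E] [NormedSpace ℝ E]
  {Q : Type*} [TopologicalSpace Q] [ChartedSpace E Q] [IsManifold 𝓘(ℝ, E) ∞ Q]

open JetSpace

variable {k : ℕ} {e : OpenPartialHomeomorph Q E}

theorem truncL_totalL {N m : ℕ} (h : m + 1 ≤ N) (v : Fin (N + 1) → E) :
    truncL (Nat.le_of_succ_le h) (totalL E N v) = shiftL h v := by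
  funext i
  rw [truncL_apply, totalL_apply, dif_pos (by have := i.2; simp; omega)]
  rfl

theorem lieTotal_comp_truncL {N m : ℕ} (h : m + 1 ≤ N)
    {μ : (Fin (m + 1) → E) → (Fin (m + 1) → E) →L[ℝ] ℝ} {y : Fin (N + 1) → E}
    (hμ : DifferentiableAt ℝ μ (truncL (Nat.le_of_succ_le h) y)) (v : Fin (N + 1) → E) :
    lieTotal (fun z => (μ (truncL (Nat.le_of_succ_le h) z)).comp
        (truncL (Nat.le_of_succ_le h))) y v =
      fderiv ℝ μ (truncL (Nat.le_of_succ_le h) y) (shiftL h y)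
        (truncL (Nat.le_of_succ_le h) v) + μ (truncL (Nat.le_of_succ_le h) y) (shiftL h v) := by
  have h1 := (hμ.hasFDerivAt.comp y (truncL (E := E) (Nat.le_of_succ_le h)).hasFDerivAt).clm_comp
    (hasFDerivAt_const (truncL (E := E) (Nat.le_of_succ_le h)) y)
  have h2 : fderiv ℝ (fun z => (μ (truncL (Nat.le_of_succ_le h) z)).comp
    (truncL (Nat.le_of_succ_le h))) y = _ := h1.fderiv
  rw [lieTotal, h2]
  simp [← truncL_totalL h]

/-- Each `d_T` changes the jet space. Pulled back to a single space of sufficiently high order `N`,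
all of them become the same operator `lieTotal`, whose cut-off last component is lost under
truncation. -/
theorem rep_tulczyjewIter {L : JetSpace E Q k → ℝ} (hL : ContMDiff (modelT E k) 𝓘(ℝ, ℝ) ∞ L)
    (he : e ∈ atlas E Q) {N : ℕ} (hk : k ≤ N) (r s : ℕ) (hs : k + s ≤ N) :
    ∀ y : Fin (N + 1) → E, y 0 ∈ e.target →
      (rep e (tulczyjewIter (verticalDiff r L) s) (truncL hs y)).comp (truncL hs) =
        lieVert (L ∘ ofCoords e ∘ truncL hk) r s y := by
  induction s with
  | zero =>
    intro y hy
    have hd := (contDiffAt_comp_ofCoords hL he (y := truncL hk y) hy).differentiableAt (by simp)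
    have h1 : rep e (tulczyjewIter (verticalDiff r L) 0) (truncL hs y) = _ :=
      rep_verticalDiff he r hy hd
    have h2 : fderiv ℝ (L ∘ ofCoords e ∘ truncL hk) y = _ :=
      (hd.hasFDerivAt.comp y (truncL (E := E) hk).hasFDerivAt).fderiv
    change _ = (fderiv ℝ (L ∘ ofCoords e ∘ truncL hk) y).comp (vertL N r)
    rw [h1, h2]
    rfl
  | succ s ih =>
    intro y hy
    have hsm := (isSmoothForm_verticalDiff hL r).tulczyjewIter s
    have h1 := lieTotal_congr (isOpen_domain N e) (ih (by omega)) y hy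
    rw [lieVert_succ, ← h1]
    ext v
    rw [lieTotal_comp_truncL (m := k + s) hs
      ((hsm e he (truncL (by omega) y) hy).differentiableAt (by simp))]
    have h2 : rep e (tulczyjewIter (verticalDiff r L) (s + 1)) (truncL hs y) = _ :=
      rep_tulczyjew hsm he hy
    rw [h2]
    rfl

theorem rep_lagrangianOneForm_eq_cartanForm {L : JetSpace E Q k → ℝ}
    (hL : ContMDiff (modelT E k) 𝓘(ℝ, ℝ) ∞ L)
    (he : e ∈ atlas E Q) {N : ℕ} (hk : k ≤ N) (hN : 2 * k - 1 ≤ N) {y : Fin (N + 1) → E}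
    (hy : y 0 ∈ e.target) :
    (rep e (lagrangianOneForm L) (truncL hN y)).comp (truncL hN) =
      cartanForm k (L ∘ ofCoords e ∘ truncL hk) y := by
  rw [rep_lagrangianOneForm L he hy, cartanForm]
  ext v
  rw [ContinuousLinearMap.comp_apply, _root_.sum_apply, _root_.sum_apply]
  refine Finset.sum_congr rfl fun s _ => ?_
  rw [← rep_tulczyjewIter hL he hk (s + 1) s (by omega) y hy]
  rfl

omit [ChartedSpace E Q] [IsManifold 𝓘(ℝ, E) ∞ Q] in
theorem semibasicOn_fderiv_comp_truncL {N : ℕ} (hk : k ≤ N) {ℓ : (Fin (k + 1) → E) → ℝ}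
    (hℓ : ∀ y : Fin (k + 1) → E, y 0 ∈ e.target → ContDiffAt ℝ ∞ ℓ y) :
    SemibasicOn {y : Fin (N + 1) → E | y 0 ∈ e.target} (k + 1) (fderiv ℝ (ℓ ∘ truncL hk)) := by
  intro y hy v hv
  have hd := (hℓ (truncL hk y) hy).differentiableAt (by simp)
  rw [(hd.hasFDerivAt.comp y (truncL (E := E) hk).hasFDerivAt).fderiv]
  have : truncL hk v = 0 := funext fun i => hv _ i.2
  simp [this]

/-- The Lagrangian form is semibasic over `T^{k-1} Q`. -/
theorem rep_lagrangianOneForm_semibasic (hk : 1 ≤ k) {L : JetSpace E Q k → ℝ}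
    (hL : ContMDiff (modelT E k) 𝓘(ℝ, ℝ) ∞ L) (he : e ∈ atlas E Q)
    {y : Fin (2 * k - 1 + 1) → E} (hy : y 0 ∈ e.target) {v : Fin (2 * k - 1 + 1) → E}
    (hv : truncL (pred_le_two_mul_pred k) v = 0) :
    rep e (lagrangianOneForm L) y v = 0 := by
  have hk' : k ≤ 2 * k - 1 := by omega
  have hℓ : ∀ y : Fin (k + 1) → E, y 0 ∈ e.target → ContDiffAt ℝ ∞ (L ∘ ofCoords e) y :=
    fun y hy => contDiffAt_comp_ofCoords hL he hy
  have h := semibasicOn_cartanForm (k := k) (isOpen_domain (2 * k - 1) e)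
    (fun y hy => (hℓ (truncL hk' y) hy).comp y (truncL (E := E) hk').contDiff.contDiffAt)
    (semibasicOn_fderiv_comp_truncL hk' hℓ)
  have h1 := congrArg (fun A : (Fin (2 * k - 1 + 1) → E) →L[ℝ] ℝ => A v)
    (rep_lagrangianOneForm_eq_cartanForm hL he hk' le_rfl hy)
  refine h1.trans (h y hy v fun i hi => ?_)
  exact congrFun hv ⟨i, by omega⟩

/-- The Euler–Lagrange expression `dL - d_T θ_L` is a multiple of `dq_0`. -/
theorem lagrangianOneForm_eulerLagrange {L : JetSpace E Q k → ℝ}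
    (hL : ContMDiff (modelT E k) 𝓘(ℝ, ℝ) ∞ L) (he : e ∈ atlas E Q)
    (hk' : k ≤ 2 * k - 1)
    {y v : Fin (2 * k - 1 + 1 + 1) → E} (hy : y 0 ∈ e.target) (hv : v 0 = 0) :
    fderiv ℝ (rep e (lagrangianOneForm L)) (truncL (Nat.le_succ _) y) (shiftL le_rfl y)
        (truncL (Nat.le_succ _) v) +
      rep e (lagrangianOneForm L) (truncL (Nat.le_succ _) y) (shiftL le_rfl v) =
    fderiv ℝ (L ∘ ofCoords e) (truncL hk' (truncL (Nat.le_succ _) y))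
      (truncL hk' (truncL (Nat.le_succ _) v)) := by
  -- The ambient order is `2k`, one more than that of `θ_L`, because `d_T θ_L` depends on the
  -- coordinate of order `2k`.
  have hkN : k ≤ 2 * k - 1 + 1 := by omega
  have hℓ : ∀ y : Fin (k + 1) → E, y 0 ∈ e.target → ContDiffAt ℝ ∞ (L ∘ ofCoords e) y :=
    fun y hy => contDiffAt_comp_ofCoords hL he hy
  have h := lieTotal_cartanForm (k := k) (isOpen_domain (2 * k - 1 + 1) e)
    (fun y hy => (hℓ (truncL hkN y) hy).comp y (truncL (E := E) hkN).contDiff.contDiffAt)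
    (semibasicOn_fderiv_comp_truncL hkN hℓ) hkN hy hv
  have h1 := lieTotal_congr (isOpen_domain (2 * k - 1 + 1) e) (fun z hz =>
    rep_lagrangianOneForm_eq_cartanForm hL he hkN (Nat.le_succ _) hz) y hy
  have hd := (isSmoothForm_lagrangianOneForm hL e he (truncL (Nat.le_succ _) y) hy).differentiableAt
    (by simp)
  rw [← lieTotal_comp_truncL le_rfl hd v, h1]
  refine h.trans ?_
  have hdl := (hℓ (truncL hkN y) hy).differentiableAt (by simp)
  rw [(hdl.hasFDerivAt.comp y (truncL (E := E) hkN).hasFDerivAt).fderiv]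
  rfl

end LagrangianForm

/-! ### Charts of the cotangent bundle and of the unified space -/

section ExtChart

variable {F : Type*} [NormedAddCommGroup F] [NormedSpace ℝ F]
  {H : Type*} [TopologicalSpace H] {I : ModelWithCorners ℝ F H}
  {M : Type*} [TopologicalSpace M] [ChartedSpace H M]
  {F' : Type*} [NormedAddCommGroup F'] [NormedSpace ℝ F']
  {H' : Type*} [TopologicalSpace H'] {I' : ModelWithCorners ℝ F' H'}
  {M' : Type*} [TopologicalSpace M'] [ChartedSpace H' M']

/-- The tangent space at `x` is identified with the model space through the chart at `x`. -/
theorem hasMFDerivAt_extChartAt_self (x : M) :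
    HasMFDerivAt I 𝓘(ℝ, F) (extChartAt I x) x (ContinuousLinearMap.id ℝ F) := by
  refine ⟨continuousAt_extChartAt x, ?_⟩
  have h : writtenInExtChartAt I 𝓘(ℝ, F) x (extChartAt I x) =ᶠ[𝓝[range I] (extChartAt I x x)] id :=
    Filter.eventuallyEq_of_mem (extChartAt_target_mem_nhdsWithin x)
      (fun _ => (extChartAt I x).right_inv)
  exact (hasFDerivWithinAt_id _ _).congr_of_eventuallyEq h
    ((extChartAt I x).right_inv (mem_extChartAt_target x))

/-- Composing with the chart at the image point does not change the differential there, so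
differentials may be computed after reading the map in that chart. -/
theorem hasMFDerivAt_of_extChartAt_comp {g : M' → M} {x : M'} (hg : MDifferentiableAt I' I g x)
    {A : F' →L[ℝ] F}
    (hA : HasMFDerivAt I' 𝓘(ℝ, F) (fun z => extChartAt I (g x) (g z)) x A) :
    HasMFDerivAt I' I g x A := by
  have h1 := (hasMFDerivAt_extChartAt_self (I := I) (g x)).comp x hg.hasMFDerivAt
  have h2 : ((ContinuousLinearMap.id ℝ F).comp (mfderiv I' I g x : F' →L[ℝ] F)) = A :=
    hasMFDerivAt_unique h1 hA
  have h3 : (mfderiv I' I g x : F' →L[ℝ] F) = A := h2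
  rw [← h3]
  exact hg.hasMFDerivAt

theorem hasMFDerivAt_comp_extChartAt {h : F → F'} {x : M} {A : F →L[ℝ] F'}
    (hh : HasFDerivAt h A (extChartAt I x x)) :
    HasMFDerivAt I 𝓘(ℝ, F') (fun z => h (extChartAt I x z)) x A :=
  hh.hasMFDerivAt.comp x (hasMFDerivAt_extChartAt_self x)

end ExtChart

/-! ### Natural charts and canonical forms of the cotangent bundle -/

section CotangentCharts

variable {E : Type*} [NormedAddCommGroup E] [NormedSpace ℝ E]
  {Q : Type*} [TopologicalSpace Q] [ChartedSpace E Q] [IsManifold 𝓘(ℝ, E) ∞ Q]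

open JetSpace

variable {r : ℕ}

/-- A covector is trivialized by precomposition with the inverse of the tangent trivialization,
which is the differential of the inverse chart; the trivial line bundle contributes the identity. -/
theorem trivializationAt_cotangent (x₀ : JetSpace E Q r)
    (α : CotangentBundle (Fin (r + 1) → E) (JetSpace E Q r))
    (hα : α.proj.base ∈ (chartAt E x₀.base).source) :
    (trivializationAt ((Fin (r + 1) → E) →L[ℝ] ℝ)
      (Cotangent (Fin (r + 1) → E) (JetSpace E Q r)) x₀ α).2 =
      (α.snd : (Fin (r + 1) → E) →L[ℝ] ℝ).comp
        (frame r (chartAt E x₀.base) (coords (chartAt E x₀.base) α.proj)) := by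
  rw [hom_trivializationAt_apply]
  have hα' : α.proj ∈ (chartAt (Fin (r + 1) → E) x₀).source := hα
  have h1 := TangentBundle.symmL_trivializationAt (I := modelT E r) hα'
  have h2 : ((trivializationAt (Fin (r + 1) → E) (TangentSpace (modelT E r)) x₀).symmL ℝ α.proj :
      (Fin (r + 1) → E) →L[ℝ] (Fin (r + 1) → E)) =
      frame r (chartAt E x₀.base) (coords (chartAt E x₀.base) α.proj) := by
    refine h1.trans ?_
    simp only [modelWithCornersSelf_coe, range_id, mfderivWithin_univ]
    rfl
  simp only [ContinuousLinearMap.inCoordinates]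
  rw [show (trivializationAt ℝ (Bundle.Trivial (JetSpace E Q r) ℝ) x₀).continuousLinearMapAt ℝ
    α.proj = ContinuousLinearMap.id ℝ ℝ from
      Bundle.Trivial.continuousLinearMapAt_trivialization _ _ _ _]
  exact congrArg (fun A => (α.snd : (Fin (r + 1) → E) →L[ℝ] ℝ).comp A) h2

theorem extChartAt_cotangent (α₀ α : CotangentBundle (Fin (r + 1) → E) (JetSpace E Q r))
    (hα : α.proj.base ∈ (chartAt E α₀.proj.base).source) :
    extChartAt ((modelT E r).prod 𝓘(ℝ, (Fin (r + 1) → E) →L[ℝ] ℝ)) α₀ α =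
      (coords (chartAt E α₀.proj.base) α.proj, (α.snd : (Fin (r + 1) → E) →L[ℝ] ℝ).comp
        (frame r (chartAt E α₀.proj.base) (coords (chartAt E α₀.proj.base) α.proj))) := by
  rw [FiberBundle.extChartAt, ← trivializationAt_cotangent _ α hα]
  have hα' : α.proj ∈ (chartAt (Fin (r + 1) → E) α₀.proj).source := hα
  refine Prod.ext ?_ rfl
  change extChartAt (modelT E r) α₀.proj (trivializationAt ((Fin (r + 1) → E) →L[ℝ] ℝ)
      (Cotangent (Fin (r + 1) → E) (JetSpace E Q r)) α₀.proj α).1 = _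
  rfl

theorem mem_extChartAt_cotangent_source
    {α₀ α : CotangentBundle (Fin (r + 1) → E) (JetSpace E Q r)}
    (h : α ∈ (extChartAt ((modelT E r).prod 𝓘(ℝ, (Fin (r + 1) → E) →L[ℝ] ℝ)) α₀).source) :
    α.proj.base ∈ (chartAt E α₀.proj.base).source := by
  rw [FiberBundle.extChartAt, PartialEquiv.trans_source] at h
  have h1 : α ∈ (trivializationAt ((Fin (r + 1) → E) →L[ℝ] ℝ)
      (Cotangent (Fin (r + 1) → E) (JetSpace E Q r)) α₀.proj).source := h.1
  rw [Trivialization.mem_source, hom_trivializationAt_baseSet] at h1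
  exact h1.1

/-- The form is p dq: in the chart the projection is the first factor, and the frame coming from its
differential is the one absorbed in the momentum coordinate. -/
theorem canonicalOneForm_inChart (α₀ : CotangentBundle (Fin (r + 1) → E) (JetSpace E Q r)) :
    (canonicalOneForm (Fin (r + 1) → E) (JetSpace E Q r)).inChart α₀ =ᶠ[
      𝓝 (extChartAt ((modelT E r).prod 𝓘(ℝ, (Fin (r + 1) → E) →L[ℝ] ℝ)) α₀ α₀)]
      fun z => z.2.comp (ContinuousLinearMap.fst ℝ (Fin (r + 1) → E) ((Fin (r + 1) → E) →L[ℝ] ℝ)) := by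
  set J := (modelT E r).prod 𝓘(ℝ, (Fin (r + 1) → E) →L[ℝ] ℝ) with hJ
  set e₀ := chartAt E α₀.proj.base with he₀
  have he : e₀ ∈ atlas E Q := chart_mem_atlas E _
  have htarget : ∀ᶠ z in 𝓝 (extChartAt J α₀ α₀), z ∈ (extChartAt J α₀).target :=
    extChartAt_target_mem_nhds α₀
  have hbase : ∀ z ∈ (extChartAt J α₀).target,
      ((extChartAt J α₀).symm z).proj.base ∈ e₀.source := by
    intro z hz
    exact mem_extChartAt_cotangent_source ((extChartAt J α₀).map_target hz)
  -- The inverse chart is differentiated at `z`, so the chart target must be a neighbourhood of `z`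
  -- itself.
  filter_upwards [htarget.eventually_nhds] with z hz
  have hz0 := hz.self_of_nhds
  set α := (extChartAt J α₀).symm z with hα
  have hcoord : (coords e₀ α.proj, (α.snd : (Fin (r + 1) → E) →L[ℝ] ℝ).comp
      (frame r e₀ (coords e₀ α.proj))) = z := by
    rw [← extChartAt_cotangent α₀ α (hbase z hz0), hα]
    exact (extChartAt J α₀).right_inv hz0
  have hproj : MDifferentiableAt J (modelT E r)
      (TotalSpace.proj : CotangentBundle (Fin (r + 1) → E) (JetSpace E Q r) → JetSpace E Q r) α :=
    ((Bundle.contMDiff_proj (n := ∞) _).contMDiffAt).mdifferentiableAt (by simp)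
  have hsymm : MDifferentiableAt 𝓘(ℝ, (Fin (r + 1) → E) × ((Fin (r + 1) → E) →L[ℝ] ℝ)) J
      (extChartAt J α₀).symm z :=
    ((contMDiffOn_extChartAt_symm (n := ∞) α₀).contMDiffAt hz).mdifferentiableAt (by simp)
  have h1 := hproj.hasMFDerivAt.comp z hsymm.hasMFDerivAt
  have hz1 : z.1 0 ∈ e₀.target := by
    rw [← hcoord]
    exact coords_zero_mem (hbase z hz0)
  have h2 : HasMFDerivAt 𝓘(ℝ, (Fin (r + 1) → E) × ((Fin (r + 1) → E) →L[ℝ] ℝ)) (modelT E r)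
      ((ofCoords e₀ : (Fin (r + 1) → E) → JetSpace E Q r) ∘ Prod.fst) z
      ((frame r e₀ z.1).comp
        (ContinuousLinearMap.fst ℝ (Fin (r + 1) → E) ((Fin (r + 1) → E) →L[ℝ] ℝ))) :=
    (hasMFDerivAt_ofCoords he hz1).comp z hasFDerivAt_fst.hasMFDerivAt
  have hev : (TotalSpace.proj ∘ (extChartAt J α₀).symm) =ᶠ[𝓝 z]
      ((ofCoords e₀ : (Fin (r + 1) → E) → JetSpace E Q r) ∘ Prod.fst) := by
    filter_upwards [hz] with w hw
    have h3 := hbase w hw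
    have h4 : coords e₀ ((extChartAt J α₀).symm w).proj = w.1 := by
      have h5 := extChartAt_cotangent α₀ _ h3
      rw [(extChartAt J α₀).right_inv hw] at h5
      exact (congrArg Prod.fst h5).symm
    simp only [Function.comp_apply]
    rw [← h4, ofCoords_coords he h3]
  have h3 := hasMFDerivAt_unique h1 (h2.congr_of_eventuallyEq hev)
  have h4 : (α.snd : (Fin (r + 1) → E) →L[ℝ] ℝ).comp (frame r e₀ z.1) = z.2 := by
    have := congrArg Prod.snd hcoord
    have h5 := congrArg Prod.fst hcoord
    simp only at this h5
    rwa [h5] at this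
  refine (congrArg (fun A => (α.snd : (Fin (r + 1) → E) →L[ℝ] ℝ).comp A) h3).trans ?_
  exact congrArg (fun B : (Fin (r + 1) → E) →L[ℝ] ℝ => B.comp
    (ContinuousLinearMap.fst ℝ (Fin (r + 1) → E) ((Fin (r + 1) → E) →L[ℝ] ℝ))) h4

theorem hasFDerivAt_clm_comp_const {V W : Type*} [NormedAddCommGroup V] [NormedSpace ℝ V]
    [NormedAddCommGroup W] [NormedSpace ℝ W] (B : W →L[ℝ] V →L[ℝ] ℝ) (C : W →L[ℝ] V) (z : W) :
    ∃ A : W →L[ℝ] W →L[ℝ] ℝ, (∀ u v, A u v = B u (C v)) ∧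
      HasFDerivAt (fun z : W => (B z).comp C) A z :=
  ⟨_, fun u v => by simp, B.hasFDerivAt.clm_comp (hasFDerivAt_const C z)⟩

/-- The canonical symplectic form is `dq ∧ dp`. -/
theorem canonicalTwoForm_apply (α : CotangentBundle (Fin (r + 1) → E) (JetSpace E Q r))
    (u v : (Fin (r + 1) → E) × ((Fin (r + 1) → E) →L[ℝ] ℝ)) :
    canonicalTwoForm (Fin (r + 1) → E) (JetSpace E Q r) α u v = v.2 u.1 - u.2 v.1 := by
  obtain ⟨A, hA, hA'⟩ := hasFDerivAt_clm_comp_const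
    (ContinuousLinearMap.snd ℝ (Fin (r + 1) → E) ((Fin (r + 1) → E) →L[ℝ] ℝ))
    (ContinuousLinearMap.fst ℝ (Fin (r + 1) → E) ((Fin (r + 1) → E) →L[ℝ] ℝ))
    (extChartAt ((modelT E r).prod 𝓘(ℝ, (Fin (r + 1) → E) →L[ℝ] ℝ)) α α)
  have h2 := (hA'.congr_of_eventuallyEq (canonicalOneForm_inChart α)).fderiv
  have h3 : canonicalTwoForm (Fin (r + 1) → E) (JetSpace E Q r) α u v =
      -(fderiv ℝ ((canonicalOneForm (Fin (r + 1) → E) (JetSpace E Q r)).inChart α)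
          (extChartAt ((modelT E r).prod 𝓘(ℝ, (Fin (r + 1) → E) →L[ℝ] ℝ)) α α) u v -
        fderiv ℝ ((canonicalOneForm (Fin (r + 1) → E) (JetSpace E Q r)).inChart α)
          (extChartAt ((modelT E r).prod 𝓘(ℝ, (Fin (r + 1) → E) →L[ℝ] ℝ)) α α) v u) := rfl
  rw [h3, h2, hA, hA]
  simp

end CotangentCharts

/-! ### The unified space in natural coordinates -/

section Unified

variable {E : Type*} [NormedAddCommGroup E] [NormedSpace ℝ E]
  {Q : Type*} [TopologicalSpace Q] [ChartedSpace E Q] [IsManifold 𝓘(ℝ, E) ∞ Q]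

open JetSpace

variable {k : ℕ}

/-- The momentum coordinates of a point of `W` over a chart `e` of `Q`. -/
def momentum (e : OpenPartialHomeomorph Q E) (w : UnifiedSpace E Q k) :
    (Fin (k - 1 + 1) → E) →L[ℝ] ℝ :=
  (covector w : (Fin (k - 1 + 1) → E) →L[ℝ] ℝ).comp
    (frame (k - 1) e (coords e (proj (pred_le_two_mul_pred k) (pr₁ w))))

/-- The pullback bundle is trivialized by the cotangent trivialization at the projected jet, and
projecting a jet does not change its base point, hence not the chart of `Q` in use. -/
theorem trivializationAt_unified (p₀ : JetSpace E Q (2 * k - 1)) (w : UnifiedSpace E Q k)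
    (hw : w.proj.base ∈ (chartAt E p₀.base).source) :
    (trivializationAt ((Fin (k - 1 + 1) → E) →L[ℝ] ℝ)
      ((JetSpace.projMap E Q (pred_le_two_mul_pred k)) *ᵖ
        (Cotangent (Fin (k - 1 + 1) → E) (JetSpace E Q (k - 1)))) p₀ w).2 =
      momentum (chartAt E p₀.base) w := by
  have hb := base_proj (pred_le_two_mul_pred k) p₀
  have h := trivializationAt_cotangent (proj (pred_le_two_mul_pred k) p₀)
    (Pullback.lift (JetSpace.projMap E Q (pred_le_two_mul_pred k)) w)
    (by rw [hb]; exact (base_proj (pred_le_two_mul_pred k) w.proj).symm ▸ hw)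
  rw [hb] at h
  exact h

theorem extChartAt_unified (w₀ w : UnifiedSpace E Q k)
    (hw : w.proj.base ∈ (chartAt E w₀.proj.base).source) :
    extChartAt (modelW E k) w₀ w =
      (coords (chartAt E w₀.proj.base) w.proj, momentum (chartAt E w₀.proj.base) w) := by
  rw [FiberBundle.extChartAt, ← trivializationAt_unified _ w hw]
  rfl

theorem continuous_proj_unified :
    Continuous (TotalSpace.proj : UnifiedSpace E Q k → JetSpace E Q (2 * k - 1)) :=
  FiberBundle.continuous_proj _ _

theorem eventually_extChartAt_unified (w₀ : UnifiedSpace E Q k) :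
    ∀ᶠ w in 𝓝 w₀, w.proj.base ∈ (chartAt E w₀.proj.base).source ∧
      extChartAt (modelW E k) w₀ w =
        (coords (chartAt E w₀.proj.base) w.proj, momentum (chartAt E w₀.proj.base) w) := by
  have h := continuous_proj_unified.continuousAt.eventually
    (eventually_base_mem (chart_mem_atlas E w₀.proj.base) (mem_chart_source E w₀.proj.base))
  exact h.mono fun w hw => ⟨hw, extChartAt_unified w₀ w hw⟩

theorem contMDiff_pr₁ : ContMDiff (modelW E k) (modelT E (2 * k - 1)) ∞
    (TotalSpace.proj : UnifiedSpace E Q k → JetSpace E Q (2 * k - 1)) :=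
  Bundle.contMDiff_proj _

theorem hasMFDerivAt_pr₁ (w : UnifiedSpace E Q k) :
    HasMFDerivAt (modelW E k) (modelT E (2 * k - 1)) (pr₁ : UnifiedSpace E Q k → _) w
      (ContinuousLinearMap.fst ℝ (Fin (2 * k - 1 + 1) → E) ((Fin (k - 1 + 1) → E) →L[ℝ] ℝ)) := by
  refine hasMFDerivAt_of_extChartAt_comp ((contMDiff_pr₁ w).mdifferentiableAt (by simp)) ?_
  refine (hasMFDerivAt_comp_extChartAt (x := w) (h := Prod.fst) hasFDerivAt_fst).congr_of_eventuallyEq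
    ?_
  filter_upwards [eventually_extChartAt_unified w] with w' hw'
  rw [hw'.2]
  rfl

theorem contMDiff_lift : ContMDiff (modelW E k)
    ((modelT E (k - 1)).prod 𝓘(ℝ, (Fin (k - 1 + 1) → E) →L[ℝ] ℝ)) ∞
    (Pullback.lift (JetSpace.projMap E Q (pred_le_two_mul_pred k)) :
      UnifiedSpace E Q k → CotangentBundle (Fin (k - 1 + 1) → E) (JetSpace E Q (k - 1))) := by
  intro w
  rw [contMDiffAt_totalSpace]
  refine ⟨((JetSpace.contMDiff_proj (pred_le_two_mul_pred k)).comp contMDiff_pr₁) w, ?_⟩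
  exact (contMDiffAt_totalSpace.1 (contMDiffAt_id (x := w) (I := modelW E k))).2

theorem hasMFDerivAt_lift_unified (w : UnifiedSpace E Q k) :
    HasMFDerivAt (modelW E k) ((modelT E (k - 1)).prod 𝓘(ℝ, (Fin (k - 1 + 1) → E) →L[ℝ] ℝ))
      (Pullback.lift (JetSpace.projMap E Q (pred_le_two_mul_pred k)) :
        UnifiedSpace E Q k → CotangentBundle (Fin (k - 1 + 1) → E) (JetSpace E Q (k - 1))) w
      ((truncL (E := E) (pred_le_two_mul_pred k)).prodMap
        (ContinuousLinearMap.id ℝ ((Fin (k - 1 + 1) → E) →L[ℝ] ℝ))) := by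
  refine hasMFDerivAt_of_extChartAt_comp ((contMDiff_lift w).mdifferentiableAt (by simp)) ?_
  refine (hasMFDerivAt_comp_extChartAt (x := w)
    ((truncL (E := E) (pred_le_two_mul_pred k)).prodMap
        (ContinuousLinearMap.id ℝ ((Fin (k - 1 + 1) → E) →L[ℝ] ℝ))).hasFDerivAt).congr_of_eventuallyEq
    ?_
  filter_upwards [eventually_extChartAt_unified w] with w' hw'
  have hb := base_proj (pred_le_two_mul_pred k) w.proj
  have h := extChartAt_cotangent
    (Pullback.lift (JetSpace.projMap E Q (pred_le_two_mul_pred k)) w)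
    (Pullback.lift (JetSpace.projMap E Q (pred_le_two_mul_pred k)) w')
    (by
      change (proj (pred_le_two_mul_pred k) w'.proj).base ∈ (chartAt E (proj (pred_le_two_mul_pred k) w.proj).base).source
      rw [hb, base_proj]
      exact hw'.1)
  refine h.trans ?_
  rw [hw'.2]
  change (coords (chartAt E (proj (pred_le_two_mul_pred k) w.proj).base) (proj (pred_le_two_mul_pred k) w'.proj), _) = (truncL (pred_le_two_mul_pred k) (coords (chartAt E w.proj.base) w'.proj), _)
  rw [← coords_proj_eq (pred_le_two_mul_pred k) (chart_mem_atlas E _) hw'.1]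
  change (_, (covector w' : (Fin (k - 1 + 1) → E) →L[ℝ] ℝ).comp (frame (k - 1)
    (chartAt E (proj (pred_le_two_mul_pred k) w.proj).base) (coords (chartAt E (proj (pred_le_two_mul_pred k) w.proj).base) (proj (pred_le_two_mul_pred k) w'.proj)))) = _
  rw [hb]
  rfl

/-- The differential of `pr_2` truncates the positions and keeps the momenta, so Ω is dq ∧ dp in the
first `k` positions. -/
theorem unifiedTwoForm_apply (w : UnifiedSpace E Q k)
    (u v : (Fin (2 * k - 1 + 1) → E) × ((Fin (k - 1 + 1) → E) →L[ℝ] ℝ)) :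
    unifiedTwoForm E Q k w u v = v.2 (truncL (pred_le_two_mul_pred k) u.1) -
      u.2 (truncL (pred_le_two_mul_pred k) v.1) := by
  have h := (hasMFDerivAt_lift_unified w).mfderiv
  have h2 : ∀ z : (Fin (2 * k - 1 + 1) → E) × ((Fin (k - 1 + 1) → E) →L[ℝ] ℝ),
      (mfderiv (modelW E k) ((modelT E (k - 1)).prod 𝓘(ℝ, (Fin (k - 1 + 1) → E) →L[ℝ] ℝ))
        (Pullback.lift (JetSpace.projMap E Q (pred_le_two_mul_pred k)) :
        UnifiedSpace E Q k → CotangentBundle (Fin (k - 1 + 1) → E) (JetSpace E Q (k - 1))) w z :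
          (Fin (k - 1 + 1) → E) × ((Fin (k - 1 + 1) → E) →L[ℝ] ℝ)) =
        (truncL (pred_le_two_mul_pred k) z.1, z.2) := fun z =>
    congrArg (fun A : ((Fin (2 * k - 1 + 1) → E) × ((Fin (k - 1 + 1) → E) →L[ℝ] ℝ)) →L[ℝ]
      ((Fin (k - 1 + 1) → E) × ((Fin (k - 1 + 1) → E) →L[ℝ] ℝ)) => A z) h
  have h3 := canonicalTwoForm_apply
    (Pullback.lift (JetSpace.projMap E Q (pred_le_two_mul_pred k)) w)
    (truncL (pred_le_two_mul_pred k) u.1, u.2) (truncL (pred_le_two_mul_pred k) v.1, v.2)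
  rw [← h2 u, ← h2 v] at h3
  refine Eq.trans ?_ (h3.trans ?_)
  · rfl
  · rw [h2, h2]

theorem hamiltonian_eq (hk : 1 ≤ k) (L : JetSpace E Q k → ℝ) {e : OpenPartialHomeomorph Q E}
    (he : e ∈ atlas E Q) {w : UnifiedSpace E Q k} (hw : w.proj.base ∈ e.source) :
    hamiltonian hk L w =
      momentum e w (shiftL (show k - 1 + 1 ≤ 2 * k - 1 by omega) (coords e w.proj)) -
        (L ∘ ofCoords e) (truncL (show k ≤ 2 * k - 1 by omega) (coords e w.proj)) := by
  have h1 := canonicalInjection_eq (show k - 1 + 1 ≤ 2 * k - 1 by omega) he hw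
  rw [← coords_proj_eq (pred_le_two_mul_pred k) he hw] at h1
  rw [← coords_proj_eq _ he hw, Function.comp_apply,
    ofCoords_coords he (by rwa [base_proj])]
  refine congrArg₂ (· - ·) ?_ rfl
  exact congrArg (fun x => (covector w : (Fin (k - 1 + 1) → E) →L[ℝ] ℝ) x) h1

theorem hasFDerivAt_pairing_sub {V V' V'' : Type*} [NormedAddCommGroup V] [NormedSpace ℝ V]
    [NormedAddCommGroup V'] [NormedSpace ℝ V'] [NormedAddCommGroup V''] [NormedSpace ℝ V'']
    (S : V →L[ℝ] V') (T : V →L[ℝ] V'') {ℓ : V'' → ℝ} {z : V × (V' →L[ℝ] ℝ)}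
    (hℓ : DifferentiableAt ℝ ℓ (T z.1)) :
    ∃ A : V × (V' →L[ℝ] ℝ) →L[ℝ] ℝ,
      HasFDerivAt (fun z : V × (V' →L[ℝ] ℝ) => z.2 (S z.1) - ℓ (T z.1)) A z ∧
      ∀ v, A v = v.2 (S z.1) + z.2 (S v.1) - fderiv ℝ ℓ (T z.1) (T v.1) := by
  have h1 := (hasFDerivAt_snd (𝕜 := ℝ) (p := z)).clm_apply
    (S.hasFDerivAt.comp z hasFDerivAt_fst)
  have h2 := hℓ.hasFDerivAt.comp z (T.hasFDerivAt.comp z hasFDerivAt_fst)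
  exact ⟨_, h1.sub h2, fun v => by simp [add_comm]⟩

theorem hasMFDerivAt_hamiltonian (hk : 1 ≤ k) {L : JetSpace E Q k → ℝ} {w : UnifiedSpace E Q k}
    {e : OpenPartialHomeomorph Q E} (he : e = chartAt E w.proj.base)
    (h₁ : k - 1 + 1 ≤ 2 * k - 1) (h₂ : k ≤ 2 * k - 1)
    {A : ((Fin (2 * k - 1 + 1) → E) × ((Fin (k - 1 + 1) → E) →L[ℝ] ℝ)) →L[ℝ] ℝ}
    (hA : HasFDerivAt (fun z : (Fin (2 * k - 1 + 1) → E) × ((Fin (k - 1 + 1) → E) →L[ℝ] ℝ) =>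
      z.2 (shiftL h₁ z.1) - (L ∘ ofCoords e) (truncL h₂ z.1)) A
      (coords e w.proj, momentum e w)) :
    HasMFDerivAt (modelW E k) 𝓘(ℝ, ℝ) (hamiltonian hk L) w A := by
  have hw : w.proj.base ∈ (chartAt E w.proj.base).source := mem_chart_source E _
  have hx := extChartAt_unified w w hw
  rw [← he] at hx
  rw [← hx] at hA
  refine (hasMFDerivAt_comp_extChartAt (x := w) hA).congr_of_eventuallyEq ?_
  filter_upwards [eventually_extChartAt_unified w] with w' hw'
  rw [hw'.2, ← he]
  exact hamiltonian_eq hk L (he ▸ chart_mem_atlas E _) (he ▸ hw'.1)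

theorem exists_hasFDerivAt_hamiltonian {L : JetSpace E Q k → ℝ}
    (hL : ContMDiff (modelT E k) 𝓘(ℝ, ℝ) ∞ L) {e : OpenPartialHomeomorph Q E} (he : e ∈ atlas E Q)
    {m r : ℕ} (h₁ : r + 1 ≤ m) (h₂ : k ≤ m) {y : Fin (m + 1) → E} (hy : y 0 ∈ e.target)
    (a : (Fin (r + 1) → E) →L[ℝ] ℝ) :
    ∃ A : (Fin (m + 1) → E) × ((Fin (r + 1) → E) →L[ℝ] ℝ) →L[ℝ] ℝ,
      HasFDerivAt (fun z : (Fin (m + 1) → E) × ((Fin (r + 1) → E) →L[ℝ] ℝ) =>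
      z.2 (shiftL h₁ z.1) - (L ∘ ofCoords e) (truncL h₂ z.1)) A (y, a) ∧
      ∀ v, A v = v.2 (shiftL h₁ y) + a (shiftL h₁ v.1) -
        fderiv ℝ (L ∘ ofCoords e) (truncL h₂ y) (truncL h₂ v.1) := by
  have hd : DifferentiableAt ℝ (L ∘ ofCoords e) (truncL h₂ y) :=
    (contDiffAt_comp_ofCoords hL he hy).differentiableAt (by simp)
  exact hasFDerivAt_pairing_sub (shiftL h₁) (truncL h₂) (z := (y, a)) hd

theorem differential_hamiltonian (hk : 1 ≤ k) {L : JetSpace E Q k → ℝ}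
    (hL : ContMDiff (modelT E k) 𝓘(ℝ, ℝ) ∞ L) {w : UnifiedSpace E Q k}
    {e : OpenPartialHomeomorph Q E} (he : e = chartAt E w.proj.base)
    (h₁ : k - 1 + 1 ≤ 2 * k - 1) (h₂ : k ≤ 2 * k - 1)
    (v : (Fin (2 * k - 1 + 1) → E) × ((Fin (k - 1 + 1) → E) →L[ℝ] ℝ)) :
    differential (modelW E k) (hamiltonian hk L) w v =
      v.2 (shiftL h₁ (coords e w.proj)) + momentum e w (shiftL h₁ v.1) -
        fderiv ℝ (L ∘ ofCoords e) (truncL h₂ (coords e w.proj)) (truncL h₂ v.1) := by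
  obtain ⟨A, hA, hA'⟩ := exists_hasFDerivAt_hamiltonian hL
    (e := e) (he ▸ chart_mem_atlas E _) h₁ h₂
    (coords_zero_mem (p := w.proj) (he ▸ mem_chart_source E _)) (momentum e w)
  rw [← hA' v]
  exact congrArg (fun B : (Fin (2 * k - 1 + 1) → E) × ((Fin (k - 1 + 1) → E) →L[ℝ] ℝ) →L[ℝ] ℝ =>
    B v) (hasMFDerivAt_hamiltonian hk he h₁ h₂ hA).mfderiv

end Unified

/-! ### The Legendre–Ostrogradsky map in natural coordinates -/

section Legendre

variable {E : Type*} [NormedAddCommGroup E] [NormedSpace ℝ E]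
  {Q : Type*} [TopologicalSpace Q] [ChartedSpace E Q] [IsManifold 𝓘(ℝ, E) ∞ Q]

open JetSpace

variable {k : ℕ} {e : OpenPartialHomeomorph Q E} {L : JetSpace E Q k → ℝ}

/-- Since `θ_L` is semibasic, components of order `k` and above may be replaced by zeros. This is
how `θ_L` descends to covectors of T^{k-1}Q. -/
theorem rep_lagrangianOneForm_padL (hk : 1 ≤ k) (hL : ContMDiff (modelT E k) 𝓘(ℝ, ℝ) ∞ L)
    (he : e ∈ atlas E Q) {y : Fin (2 * k - 1 + 1) → E} (hy : y 0 ∈ e.target)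
    (v : Fin (2 * k - 1 + 1) → E) :
    rep e (lagrangianOneForm L) y (padL (truncL (pred_le_two_mul_pred k) v)) =
      rep e (lagrangianOneForm L) y v := by
  rw [← sub_eq_zero, ← map_sub]
  refine rep_lagrangianOneForm_semibasic hk hL he hy ?_
  rw [map_sub, truncL_padL, sub_self]

theorem fderiv_rep_lagrangianOneForm_padL (hk : 1 ≤ k)
    (hL : ContMDiff (modelT E k) 𝓘(ℝ, ℝ) ∞ L)
    (he : e ∈ atlas E Q) {y : Fin (2 * k - 1 + 1) → E} (hy : y 0 ∈ e.target)
    (u v : Fin (2 * k - 1 + 1) → E) :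
    fderiv ℝ (rep e (lagrangianOneForm L)) y u (padL (truncL (pred_le_two_mul_pred k) v)) =
      fderiv ℝ (rep e (lagrangianOneForm L)) y u v := by
  have hd := (isSmoothForm_lagrangianOneForm hL e he y hy).differentiableAt (by simp)
  have h1 : ∀ w : Fin (2 * k - 1 + 1) → E, fderiv ℝ (rep e (lagrangianOneForm L)) y u w =
      fderiv ℝ (fun z => rep e (lagrangianOneForm L) z w) y u := fun w => by
    rw [fderiv_clm_apply hd (differentiableAt_const w)]
    simp
  rw [h1, h1]
  have hev : (fun z => rep e (lagrangianOneForm L) z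
      (padL (truncL (pred_le_two_mul_pred k) v))) =ᶠ[𝓝 y]
      fun z => rep e (lagrangianOneForm L) z v := by
    filter_upwards [eventually_domain hy] with z hz
    exact rep_lagrangianOneForm_padL hk hL he hz v
  rw [hev.fderiv_eq]

theorem mfderiv_proj_self {r : ℕ} (h : r ≤ k) (p : JetSpace E Q k) (v : Fin (k + 1) → E) :
    (mfderiv (modelT E k) (modelT E r) (proj h) p v : Fin (r + 1) → E) = truncL h v := by
  have he : chartAt E p.base ∈ atlas E Q := chart_mem_atlas E _
  have hp : p.base ∈ (chartAt E p.base).source := mem_chart_source E _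
  have h1 := mfderiv_proj_frame h he (coords_zero_mem hp) v
  have h2 := frame_self (proj h p)
  rw [base_proj, coords_proj_eq h he hp] at h2
  rw [frame_self, h2, ofCoords_coords he hp] at h1
  exact h1

/-- The defining property of the Legendre–Ostrogradsky map. -/
theorem legendreMap_apply (hk : 1 ≤ k) (hL : ContMDiff (modelT E k) 𝓘(ℝ, ℝ) ∞ L)
    (p : JetSpace E Q (2 * k - 1)) (u : TangentSpace (modelT E (2 * k - 1)) p) :
    legendreMap L p (mfderiv (modelT E (2 * k - 1)) (modelT E (k - 1))
      (proj (pred_le_two_mul_pred k)) p u) = lagrangianOneForm L p u := by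
  have hex : ∃ α : TangentSpace (modelT E (k - 1)) (proj (pred_le_two_mul_pred k) p) →L[ℝ] ℝ,
      ∀ u : TangentSpace (modelT E (2 * k - 1)) p, lagrangianOneForm L p u =
        α (mfderiv (modelT E (2 * k - 1)) (modelT E (k - 1))
          (proj (pred_le_two_mul_pred k)) p u) := by
    -- The covector is `θ_L` evaluated on the lift by zeros, a right inverse of the projection's
    -- differential.
    refine ⟨(lagrangianOneForm L p : (Fin (2 * k - 1 + 1) → E) →L[ℝ] ℝ).comp
      (padL (m := 2 * k - 1) (r := k - 1)), fun u => ?_⟩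
    have h := rep_lagrangianOneForm_padL hk hL (chart_mem_atlas E p.base)
      (coords_zero_mem (mem_chart_source E p.base)) u
    rw [rep_self] at h
    refine h.symm.trans ?_
    exact congrArg (fun z => (lagrangianOneForm L p : (Fin (2 * k - 1 + 1) → E) →L[ℝ] ℝ) (padL z))
      (mfderiv_proj_self (pred_le_two_mul_pred k) p u).symm
  rw [legendreMap, dif_pos hex]
  exact (hex.choose_spec u).symm

/-- The Ostrogradsky momenta are the coefficients of `θ_L`; smoothness and the differential of the
graph map follow from this. -/
theorem momentum_legendreGraphMap (hk : 1 ≤ k) (hL : ContMDiff (modelT E k) 𝓘(ℝ, ℝ) ∞ L)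
    (he : e ∈ atlas E Q) {p : JetSpace E Q (2 * k - 1)} (hp : p.base ∈ e.source) :
    momentum e (legendreGraphMap L p) =
      (rep e (lagrangianOneForm L) (coords e p)).comp padL := by
  ext x
  have h1 := mfderiv_proj_frame (pred_le_two_mul_pred k) he (coords_zero_mem hp) (padL x)
  rw [truncL_padL, ofCoords_coords he hp, ← coords_proj_eq _ he hp] at h1
  have h2 := legendreMap_apply hk hL p (frame (2 * k - 1) e (coords e p) (padL x))
  refine (congrArg (fun z => (legendreMap L p : (Fin (k - 1 + 1) → E) →L[ℝ] ℝ) z)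
    h1.symm).trans (h2.trans ?_)
  rw [ContinuousLinearMap.comp_apply, rep_apply, ofCoords_coords he hp]

theorem contMDiff_legendreGraphMap (hk : 1 ≤ k) (hL : ContMDiff (modelT E k) 𝓘(ℝ, ℝ) ∞ L) :
    ContMDiff (modelT E (2 * k - 1)) (modelW E k) ∞ (legendreGraphMap L) := by
  intro p
  rw [contMDiffAt_totalSpace]
  refine ⟨contMDiffAt_id, ?_⟩
  have he : chartAt E p.base ∈ atlas E Q := chart_mem_atlas E _
  have hp : p.base ∈ (chartAt E p.base).source := mem_chart_source E _
  have h1 : ContDiffAt ℝ ∞ (fun y => (rep (chartAt E p.base) (lagrangianOneForm L) y).comp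
      (padL (m := 2 * k - 1) (r := k - 1))) (coords (chartAt E p.base) p) :=
    (isSmoothForm_lagrangianOneForm hL _ he _ (coords_zero_mem hp)).clm_comp contDiffAt_const
  refine (h1.contMDiffAt.comp p (contMDiffAt_coords he hp)).congr_of_eventuallyEq ?_
  filter_upwards [eventually_base_mem he hp] with p' hp'
  refine (trivializationAt_unified p (legendreGraphMap L p') hp').trans ?_
  exact momentum_legendreGraphMap hk hL he hp'

/-- The differential of `p ↦ (p, FL(p))` in natural coordinates. -/
theorem mfderiv_legendreGraphMap (hk : 1 ≤ k) (hL : ContMDiff (modelT E k) 𝓘(ℝ, ℝ) ∞ L)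
    (p : JetSpace E Q (2 * k - 1)) (u : Fin (2 * k - 1 + 1) → E) :
    (mfderiv (modelT E (2 * k - 1)) (modelW E k) (legendreGraphMap L) p u :
      (Fin (2 * k - 1 + 1) → E) × ((Fin (k - 1 + 1) → E) →L[ℝ] ℝ)) =
    (u, (fderiv ℝ (rep (chartAt E p.base) (lagrangianOneForm L))
      (coords (chartAt E p.base) p) u).comp padL) := by
  have he : chartAt E p.base ∈ atlas E Q := chart_mem_atlas E _
  have hp : p.base ∈ (chartAt E p.base).source := mem_chart_source E _
  have hd := (isSmoothForm_lagrangianOneForm hL _ he _ (coords_zero_mem hp)).differentiableAt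
    (by simp)
  have h1 : HasFDerivAt (fun y => (y, (rep (chartAt E p.base) (lagrangianOneForm L) y).comp
      (padL (E := E) (m := 2 * k - 1) (r := k - 1)))) _ (coords (chartAt E p.base) p) :=
    (hasFDerivAt_id _).prodMk (hd.hasFDerivAt.clm_comp (hasFDerivAt_const _ _))
  have h2 := (hasMFDerivAt_comp_extChartAt (I := modelT E (2 * k - 1)) (x := p) h1)
  have h3 := hasMFDerivAt_of_extChartAt_comp
    ((contMDiff_legendreGraphMap hk hL p).mdifferentiableAt (by simp))
    (h2.congr_of_eventuallyEq (by
      filter_upwards [eventually_base_mem he hp] with p' hp'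
      refine (extChartAt_unified (legendreGraphMap L p) (legendreGraphMap L p') hp').trans ?_
      exact Prod.ext rfl (momentum_legendreGraphMap hk hL he hp')))
  refine (congrArg (fun A : (Fin (2 * k - 1 + 1) → E) →L[ℝ] (Fin (2 * k - 1 + 1) → E) ×
    ((Fin (k - 1 + 1) → E) →L[ℝ] ℝ) => A u) h3.mfderiv).trans ?_
  refine Prod.ext rfl ?_
  ext x
  simp

end Legendre

/-! ### The Euler–Lagrange equations in natural coordinates -/

section Dynamics

variable {E : Type*} [NormedAddCommGroup E] [NormedSpace ℝ E]
  {Q : Type*} [TopologicalSpace Q] [ChartedSpace E Q] [IsManifold 𝓘(ℝ, E) ∞ Q]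

open JetSpace

variable {k : ℕ} {e : OpenPartialHomeomorph Q E} {L : JetSpace E Q k → ℝ}

theorem mfderiv_coords_frame (he : e ∈ atlas E Q) {y : Fin (k + 1) → E} (hy : y 0 ∈ e.target)
    (v : Fin (k + 1) → E) :
    (mfderiv (modelT E k) 𝓘(ℝ, Fin (k + 1) → E) (coords e) (ofCoords e y : JetSpace E Q k)
      (frame k e y v) : Fin (k + 1) → E) = v := by
  have h1 := ((contMDiffAt_coords he (base_ofCoords_mem (k := k) hy)).mdifferentiableAt
    (by simp)).hasMFDerivAt.comp y (hasMFDerivAt_ofCoords he hy)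
  have h2 : HasMFDerivAt 𝓘(ℝ, Fin (k + 1) → E) 𝓘(ℝ, Fin (k + 1) → E)
      (coords e ∘ (ofCoords e : (Fin (k + 1) → E) → JetSpace E Q k)) y
      (ContinuousLinearMap.id ℝ (Fin (k + 1) → E)) := by
    refine (hasMFDerivAt_id y).congr_of_eventuallyEq ?_
    filter_upwards [eventually_domain hy] with z hz
    exact coords_ofCoords_self he hz
  exact congrArg (fun A : (Fin (k + 1) → E) →L[ℝ] (Fin (k + 1) → E) => A v)
    (hasMFDerivAt_unique h1 h2)

theorem frame_injective (he : e ∈ atlas E Q) {y : Fin (k + 1) → E} (hy : y 0 ∈ e.target) :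
    Function.Injective (frame k e y) := fun u v huv => by
  rw [← mfderiv_coords_frame he hy u, huv]
  exact mfderiv_coords_frame he hy v

theorem frame_surjective [FiniteDimensional ℝ E] (he : e ∈ atlas E Q) {y : Fin (k + 1) → E}
    (hy : y 0 ∈ e.target) : Function.Surjective (frame k e y) :=
  (LinearMap.injective_iff_surjective
    (f := (frame k e y : (Fin (k + 1) → E) →ₗ[ℝ] (Fin (k + 1) → E)))).1 (frame_injective he hy)

/-- The expression of the Lagrangian `2`-form in natural coordinates, up to the sign. -/
theorem lagrangianTwoForm_frame (hL : ContMDiff (modelT E k) 𝓘(ℝ, ℝ) ∞ L) (he : e ∈ atlas E Q)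
    {y : Fin (2 * k - 1 + 1) → E} (hy : y 0 ∈ e.target) (u v : Fin (2 * k - 1 + 1) → E) :
    lagrangianTwoForm L (ofCoords e y) (frame _ e y u) (frame _ e y v) =
      fderiv ℝ (rep e (lagrangianOneForm L)) y v u -
        fderiv ℝ (rep e (lagrangianOneForm L)) y u v := by
  have h := extDeriv_frame (isSmoothForm_lagrangianOneForm hL) he hy u v
  refine (congrArg Neg.neg h).trans (neg_sub _ _)

/-- The hypothesis says that `u` is a null vector of `ω_L`; finite dimension makes the frame
surjective, so testing in coordinates suffices. -/
theorem eq_zero_of_fderiv_lagrangianOneForm [FiniteDimensional ℝ E]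
    (hL : ContMDiff (modelT E k) 𝓘(ℝ, ℝ) ∞ L) (hreg : IsRegularLagrangian L) (he : e ∈ atlas E Q)
    {y : Fin (2 * k - 1 + 1) → E} (hy : y 0 ∈ e.target) {u : Fin (2 * k - 1 + 1) → E}
    (hu : ∀ v, fderiv ℝ (rep e (lagrangianOneForm L)) y u v =
      fderiv ℝ (rep e (lagrangianOneForm L)) y v u) : u = 0 := by
  apply frame_injective he hy
  refine (hreg (ofCoords e y) (frame _ e y u) fun v => ?_).trans (map_zero _).symm
  obtain ⟨v, rfl⟩ := frame_surjective he hy v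
  rw [lagrangianTwoForm_frame hL he hy, hu, sub_self]

variable (L) in
/-- The equations, in the natural coordinates over `e`, for the velocity `u` at `y` of a solution
of the unified dynamical equation. -/
structure IsMotion (hk : 1 ≤ k) (e : OpenPartialHomeomorph Q E)
    (y u : Fin (2 * k - 1 + 1) → E) : Prop where
  truncL_eq : truncL (pred_le_two_mul_pred k) u =
    shiftL (show k - 1 + 1 ≤ 2 * k - 1 by omega) y
  equation : ∀ v, fderiv ℝ (rep e (lagrangianOneForm L)) y u v +
    rep e (lagrangianOneForm L) y (padL (shiftL (show k - 1 + 1 ≤ 2 * k - 1 by omega) v)) =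
      fderiv ℝ (L ∘ ofCoords e) (truncL (show k ≤ 2 * k - 1 by omega) y)
        (truncL (show k ≤ 2 * k - 1 by omega) v)

/-- Derivatives of `θ_L` vanish on vectors without components of order less than `k`. -/
theorem fderiv_rep_lagrangianOneForm_eq_zero (hk : 1 ≤ k)
    (hL : ContMDiff (modelT E k) 𝓘(ℝ, ℝ) ∞ L)
    (he : e ∈ atlas E Q) {y : Fin (2 * k - 1 + 1) → E} (hy : y 0 ∈ e.target)
    (u : Fin (2 * k - 1 + 1) → E) {v : Fin (2 * k - 1 + 1) → E}
    (hv : truncL (pred_le_two_mul_pred k) v = 0) :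
    fderiv ℝ (rep e (lagrangianOneForm L)) y u v = 0 := by
  rw [← fderiv_rep_lagrangianOneForm_padL hk hL he hy, hv, map_zero, map_zero]

/-- Whatever the coordinate of order `2k` is, the equations hold on the vectors which are vertical
over `Q`. -/
theorem equation_shiftL (hk : 1 ≤ k) (hL : ContMDiff (modelT E k) 𝓘(ℝ, ℝ) ∞ L)
    (he : e ∈ atlas E Q) {y : Fin (2 * k - 1 + 1 + 1) → E} (hy : y 0 ∈ e.target)
    {v : Fin (2 * k - 1 + 1) → E} (hv : v 0 = 0) :
    fderiv ℝ (rep e (lagrangianOneForm L)) (truncL (Nat.le_succ _) y) (shiftL le_rfl y) v +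
      rep e (lagrangianOneForm L) (truncL (Nat.le_succ _) y)
        (padL (shiftL (show k - 1 + 1 ≤ 2 * k - 1 by omega) v)) =
      fderiv ℝ (L ∘ ofCoords e)
        (truncL (show k ≤ 2 * k - 1 by omega) (truncL (Nat.le_succ (2 * k - 1)) y))
        (truncL (show k ≤ 2 * k - 1 by omega) v) := by
  -- The Euler–Lagrange identity lives one order higher, so `v` is extended by a zero component,
  -- which does not affect the terms below.
  have h := lagrangianOneForm_eulerLagrange hL he (show k ≤ 2 * k - 1 by omega) hy
    (v := padL v) (by rw [padL_apply]; simpa using hv)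
  rw [truncL_padL] at h
  rw [← h, ← rep_lagrangianOneForm_padL hk hL he (y := truncL (Nat.le_succ _) y) hy
    (shiftL le_rfl (padL v))]
  congr 3
  funext i
  have : (i : ℕ) + 1 < 2 * k - 1 + 1 := by omega
  simp [padL_apply, this]

theorem shiftL_single_last {m : ℕ} (z : E) :
    shiftL le_rfl (Pi.single (Fin.last (m + 1)) z : Fin (m + 1 + 1) → E) =
      Pi.single (Fin.last m) z := by
  funext i
  rw [shiftL_apply]
  by_cases h : i = Fin.last m
  · subst h
    rw [Pi.single_eq_same]
    exact Pi.single_eq_same (M := fun _ => E) _ _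
  · rw [Pi.single_eq_of_ne h, Pi.single_eq_of_ne]
    intro h'
    exact h (Fin.ext (by simpa using congrArg Fin.val h'))

/-- The unknown is the coordinate `z` of order `2k`. Vertical test vectors impose nothing on it, and
those along `q_0` give a square affine system whose linear part is invertible by regularity. Since
only the last component of the velocity is adjusted, all others are shifts of `y`. -/
theorem exists_isMotion [FiniteDimensional ℝ E] (hk : 1 ≤ k)
    (hL : ContMDiff (modelT E k) 𝓘(ℝ, ℝ) ∞ L) (hreg : IsRegularLagrangian L)
    (he : e ∈ atlas E Q) {y : Fin (2 * k - 1 + 1) → E} (hy : y 0 ∈ e.target) :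
    ∃ u, IsMotion L hk e y u ∧ truncL (show 2 * k - 2 ≤ 2 * k - 1 by omega) u =
      shiftL (show 2 * k - 2 + 1 ≤ 2 * k - 1 by omega) y := by
  let Y : E → Fin (2 * k - 1 + 1 + 1) → E := fun z => padL y + Pi.single (Fin.last _) z
  have hYt : ∀ z, truncL (Nat.le_succ _) (Y z) = y := fun z => by
    funext i
    have : Fin.castLE (show 2 * k - 1 + 1 ≤ 2 * k - 1 + 1 + 1 by omega) i ≠ Fin.last _ :=
      fun h => by
        have := congrArg Fin.val h
        simp at this
        omega
    simp only [Y, truncL_apply, Pi.add_apply, Pi.single_eq_of_ne this, padL_apply, add_zero]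
    rw [dif_pos (by simpa using i.2)]
    rfl
  let ι : E →L[ℝ] (Fin (2 * k - 1 + 1) → E) :=
    ContinuousLinearMap.single ℝ (fun _ : Fin (2 * k - 1 + 1) => E) (Fin.last _)
  let ι₀ : E →L[ℝ] (Fin (2 * k - 1 + 1) → E) :=
    ContinuousLinearMap.single ℝ (fun _ : Fin (2 * k - 1 + 1) => E) 0
  let u₀ : Fin (2 * k - 1 + 1) → E := shiftL le_rfl (Y 0)
  have hYs : ∀ z, shiftL le_rfl (Y z) = u₀ + ι z := fun z => by
    simp only [Y, u₀, ι, map_add, shiftL_single_last, Pi.single_zero, map_zero, add_zero]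
    rfl
  let D := fderiv ℝ (rep e (lagrangianOneForm L)) y
  -- `R` is the defect of the equation for `z = 0`; a general `z` adds `D (ι z)`.
  let R : (Fin (2 * k - 1 + 1) → E) →L[ℝ] ℝ := D u₀ +
    ((rep e (lagrangianOneForm L) y).comp padL).comp
      (shiftL (show k - 1 + 1 ≤ 2 * k - 1 by omega)) -
    (fderiv ℝ (L ∘ ofCoords e) (truncL (show k ≤ 2 * k - 1 by omega) y)).comp
        (truncL (show k ≤ 2 * k - 1 by omega))
  have hR : ∀ z v, v 0 = 0 → R v + D (ι z) v = 0 := fun z v hv => by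
    have h := equation_shiftL hk hL he (y := Y z) (by rw [← hYt z] at hy; exact hy) hv
    rw [hYt, hYs, map_add, _root_.add_apply] at h
    rw [← sub_eq_zero] at h
    rw [← h]
    simp only [R, D, _root_.add_apply, _root_.sub_apply, ContinuousLinearMap.comp_apply]
    ring
  -- The equations on vertical vectors hold for `z` and for `0`, so their difference vanishes.
  have hD : ∀ z v, v 0 = 0 → D (ι z) v = 0 := fun z v hv => by
    have h1 := hR z v hv
    have h2 := hR 0 v hv
    rw [map_zero, map_zero, _root_.zero_apply, add_zero] at h2
    rwa [h2, zero_add] at h1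
  -- The linear part of the remaining equations, those tested on the directions of `q_0`.
  let B : E →ₗ[ℝ] Module.Dual ℝ E :=
    { toFun := fun z => ((D (ι z)).comp ι₀ : E →L[ℝ] ℝ)
      map_add' := fun z z' => by ext x; simp
      map_smul' := fun c z => by ext x; simp }
  have hsplit : ∀ v : Fin (2 * k - 1 + 1) → E, (v - ι₀ (v 0)) 0 = 0 := fun v => by simp [ι₀]
  have hB : Function.Injective B := by
    rw [← LinearMap.ker_eq_bot, LinearMap.ker_eq_bot']
    intro z hz
    have h0 : ι z = 0 := by
      refine eq_zero_of_fderiv_lagrangianOneForm hL hreg he hy fun v => ?_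
      -- The transposed term vanishes because `ι z` has order `2k - 1 ≥ k` and `θ_L` is semibasic;
      -- hence `D (ι z) = 0` suffices for `ι z` to be null.
      rw [fderiv_rep_lagrangianOneForm_eq_zero hk hL he hy v]
      · have h1 := hD z _ (hsplit v)
        have h2 : D (ι z) (ι₀ (v 0)) = 0 := congrArg (fun A : Module.Dual ℝ E => A (v 0)) hz
        rwa [map_sub, h2, sub_zero] at h1
      · funext i
        have : Fin.castLE (show k - 1 + 1 ≤ 2 * k - 1 + 1 by omega) i ≠ Fin.last _ := fun h => by
          have := congrArg Fin.val h
          simp at this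
          omega
        simp [ι, this]
    have := congrFun h0 (Fin.last _)
    simpa [ι] using this
  obtain ⟨z, hz⟩ := (LinearMap.injective_iff_surjective_of_finrank_eq_finrank
    (Subspace.dual_finrank_eq (K := ℝ) (V := E)).symm).1 hB (-(R.comp ι₀ : E →L[ℝ] ℝ))
  have hz' : ∀ x, D (ι z) (ι₀ x) = - R (ι₀ x) := fun x =>
    congrArg (fun A : Module.Dual ℝ E => A x) hz
  have hzero : ∀ v, R v + D (ι z) v = 0 := fun v => by
    have h1 := hR z _ (hsplit v)
    rw [map_sub, map_sub, hz'] at h1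
    linarith
  have htr : truncL (show 2 * k - 2 ≤ 2 * k - 1 by omega) (u₀ + ι z) =
      shiftL (show 2 * k - 2 + 1 ≤ 2 * k - 1 by omega) y := by
    rw [← hYs]
    conv_rhs => rw [← hYt z]
    rfl
  refine ⟨u₀ + ι z, ⟨?_, fun v => ?_⟩, htr⟩
  · funext i
    exact congrFun htr ⟨i, by omega⟩
  · have h := hzero v
    rw [map_add, _root_.add_apply, ← sub_eq_zero, ← h]
    simp only [R, D, _root_.add_apply, _root_.sub_apply, ContinuousLinearMap.comp_apply]
    ring

end Dynamics

/-! ### The dynamics on the graph of the Legendre–Ostrogradsky map -/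

set_option synthInstance.maxHeartbeats 400000 in
theorem contDiffAt_clm_flip {V : Type*} [NormedAddCommGroup V] [NormedSpace ℝ V]
    {B : V → V →L[ℝ] V →L[ℝ] ℝ} {y : V} (hB : ContDiffAt ℝ ∞ B y) :
    ContDiffAt ℝ ∞ (fun z => (B z).flip) y := by
  have h := LinearIsometryEquiv.contDiff (𝕜 := ℝ) (E := V →L[ℝ] V →L[ℝ] ℝ)
    (F := V →L[ℝ] V →L[ℝ] ℝ) (n := ∞) (ContinuousLinearMap.flipₗᵢ ℝ V V ℝ)
  exact h.contDiffAt.comp y hB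

/-- Inversion of operators is smooth at an invertible one. `ContinuousLinearMap.inverse` is total,
so no invertibility is required in the definition of the field. -/
theorem contDiffAt_inverse_flip_sub {V : Type*} [NormedAddCommGroup V] [NormedSpace ℝ V]
    [CompleteSpace V] {B : V → V →L[ℝ] V →L[ℝ] ℝ} {b : V → V →L[ℝ] ℝ} {y : V}
    (hB : ContDiffAt ℝ ∞ B y) (hb : ContDiffAt ℝ ∞ b y) {A : V ≃L[ℝ] (V →L[ℝ] ℝ)}
    (hA : (A : V →L[ℝ] V →L[ℝ] ℝ) = (B y).flip - B y) :
    ContDiffAt ℝ ∞ (fun z => ContinuousLinearMap.inverse ((B z).flip - B z) (b z)) y := by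
  have h1 : ContDiffAt ℝ ∞ (fun z => (B z).flip - B z) y := (contDiffAt_clm_flip hB).sub hB
  have h2 := contDiffAt_map_inverse (n := ∞) A
  rw [hA] at h2
  exact (h2.comp y h1).clm_apply hb

/-! ### Energy, uniqueness and smoothness of the velocity of motions -/

section Dynamics

variable {E : Type*} [NormedAddCommGroup E] [NormedSpace ℝ E]
  {Q : Type*} [TopologicalSpace Q] [ChartedSpace E Q] [IsManifold 𝓘(ℝ, E) ∞ Q]

open JetSpace

variable {k : ℕ} {e : OpenPartialHomeomorph Q E} {L : JetSpace E Q k → ℝ}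

/-- The energy, i.e. the restriction of the Hamiltonian to the graph of `FL`, in natural
coordinates. -/
theorem hamiltonian_legendreGraphMap (hk : 1 ≤ k)
    (hL : ContMDiff (modelT E k) 𝓘(ℝ, ℝ) ∞ L) (he : e ∈ atlas E Q)
    {p : JetSpace E Q (2 * k - 1)} (hp : p.base ∈ e.source) :
    hamiltonian hk L (legendreGraphMap L p) =
      rep e (lagrangianOneForm L) (coords e p)
        (padL (shiftL (show k - 1 + 1 ≤ 2 * k - 1 by omega) (coords e p))) -
      (L ∘ ofCoords e) (truncL (show k ≤ 2 * k - 1 by omega) (coords e p)) :=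
  (hamiltonian_eq hk L he (w := legendreGraphMap L p) hp).trans (congrArg₂ (· - ·)
    (congrArg (fun A : (Fin (k - 1 + 1) → E) →L[ℝ] ℝ =>
      A (shiftL (show k - 1 + 1 ≤ 2 * k - 1 by omega) (coords e p)))
      (momentum_legendreGraphMap hk hL he hp)) rfl)

variable (L) in
/-- The energy in natural coordinates. -/
def localEnergy (hk : 1 ≤ k) (e : OpenPartialHomeomorph Q E) (y : Fin (2 * k - 1 + 1) → E) : ℝ :=
  hamiltonian hk L (legendreGraphMap L (ofCoords e y))

theorem localEnergy_eventuallyEq (hk : 1 ≤ k)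
    (hL : ContMDiff (modelT E k) 𝓘(ℝ, ℝ) ∞ L) (he : e ∈ atlas E Q)
    {y : Fin (2 * k - 1 + 1) → E} (hy : y 0 ∈ e.target) :
    localEnergy L hk e =ᶠ[𝓝 y] fun z => rep e (lagrangianOneForm L) z
        (padL (shiftL (show k - 1 + 1 ≤ 2 * k - 1 by omega) z)) -
      (L ∘ ofCoords e) (truncL (show k ≤ 2 * k - 1 by omega) z) := by
  filter_upwards [eventually_domain hy] with z hz
  have h := hamiltonian_legendreGraphMap hk hL he (base_ofCoords_mem (Q := Q) hz)
  rwa [coords_ofCoords_self he hz] at h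

theorem contDiffAt_localEnergy (hk : 1 ≤ k)
    (hL : ContMDiff (modelT E k) 𝓘(ℝ, ℝ) ∞ L) (he : e ∈ atlas E Q)
    {y : Fin (2 * k - 1 + 1) → E} (hy : y 0 ∈ e.target) :
    ContDiffAt ℝ ∞ (localEnergy L hk e) y := by
  have hθ := isSmoothForm_lagrangianOneForm hL e he y hy
  have hℓ : ContDiffAt ℝ ∞ (L ∘ ofCoords e) (truncL (show k ≤ 2 * k - 1 by omega) y) :=
    contDiffAt_comp_ofCoords hL he hy
  exact ((hθ.clm_apply (((padL (E := E)).contDiff.comp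
    (shiftL (E := E) _).contDiff).contDiffAt)).sub
      (hℓ.comp y (truncL (E := E) _).contDiff.contDiffAt)).congr_of_eventuallyEq
        (localEnergy_eventuallyEq hk hL he hy)

theorem fderiv_localEnergy (hk : 1 ≤ k)
    (hL : ContMDiff (modelT E k) 𝓘(ℝ, ℝ) ∞ L) (he : e ∈ atlas E Q)
    {y : Fin (2 * k - 1 + 1) → E} (hy : y 0 ∈ e.target) (v : Fin (2 * k - 1 + 1) → E) :
    fderiv ℝ (localEnergy L hk e) y v =
      fderiv ℝ (rep e (lagrangianOneForm L)) y v
        (padL (shiftL (show k - 1 + 1 ≤ 2 * k - 1 by omega) y)) +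
      rep e (lagrangianOneForm L) y (padL (shiftL (show k - 1 + 1 ≤ 2 * k - 1 by omega) v)) -
      fderiv ℝ (L ∘ ofCoords e) (truncL (show k ≤ 2 * k - 1 by omega) y)
        (truncL (show k ≤ 2 * k - 1 by omega) v) := by
  have hθ := (isSmoothForm_lagrangianOneForm hL e he y hy).differentiableAt (by simp)
  have hℓ : DifferentiableAt ℝ (L ∘ ofCoords e) (truncL (show k ≤ 2 * k - 1 by omega) y) :=
    (contDiffAt_comp_ofCoords hL he hy).differentiableAt (by simp)
  rw [(localEnergy_eventuallyEq hk hL he hy).fderiv_eq]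
  have h1 := hθ.hasFDerivAt.clm_apply
    (((padL (E := E) (m := 2 * k - 1)).comp
      (shiftL (E := E) (show k - 1 + 1 ≤ 2 * k - 1 by omega))).hasFDerivAt (x := y))
  have h2 := hℓ.hasFDerivAt.comp y
    (truncL (E := E) (show k ≤ 2 * k - 1 by omega)).hasFDerivAt
  refine (congrArg (fun A : (Fin (2 * k - 1 + 1) → E) →L[ℝ] ℝ => A v)
    (h1.sub h2).fderiv).trans ?_
  simp [add_comm]

/-- In natural coordinates, the equations of motion imply Hamilton's equations for `ω_L`. -/
theorem IsMotion.fderiv_sub {hk : 1 ≤ k}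
    (hL : ContMDiff (modelT E k) 𝓘(ℝ, ℝ) ∞ L) (he : e ∈ atlas E Q)
    {y u : Fin (2 * k - 1 + 1) → E} (hy : y 0 ∈ e.target) (hu : IsMotion L hk e y u)
    (v : Fin (2 * k - 1 + 1) → E) :
    fderiv ℝ (rep e (lagrangianOneForm L)) y v u - fderiv ℝ (rep e (lagrangianOneForm L)) y u v =
      fderiv ℝ (localEnergy L hk e) y v := by
  -- The first condition replaces the shift of `y` by the truncation of `u`, and the padding of a
  -- truncation is invisible to the derivatives of `θ_L`.
  rw [fderiv_localEnergy hk hL he hy, ← hu.truncL_eq, ← hu.equation v,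
    fderiv_rep_lagrangianOneForm_padL hk hL he hy]
  ring

theorem IsMotion.lagrangianTwoForm_frame {hk : 1 ≤ k}
    (hL : ContMDiff (modelT E k) 𝓘(ℝ, ℝ) ∞ L) (he : e ∈ atlas E Q)
    {y u : Fin (2 * k - 1 + 1) → E} (hy : y 0 ∈ e.target) (hu : IsMotion L hk e y u)
    (v : Fin (2 * k - 1 + 1) → E) :
    lagrangianTwoForm L (ofCoords e y) (frame _ e y u) (frame _ e y v) =
      differential (modelT E (2 * k - 1))
        (fun p => hamiltonian hk L (legendreGraphMap L p)) (ofCoords e y) (frame _ e y v) := by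
  rw [SkinnerRusk.lagrangianTwoForm_frame hL he hy, hu.fderiv_sub hL he hy]
  exact (differential_frame (f := fun p => hamiltonian hk L (legendreGraphMap L p)) he hy
    ((contDiffAt_localEnergy hk hL he hy).differentiableAt (by simp)) v).symm

/-- The equations of motion have the same meaning in all natural coordinates. -/
theorem IsMotion.frame_eq [FiniteDimensional ℝ E] {hk : 1 ≤ k}
    (hL : ContMDiff (modelT E k) 𝓘(ℝ, ℝ) ∞ L) (hreg : IsRegularLagrangian L)
    {e' : OpenPartialHomeomorph Q E} (he : e ∈ atlas E Q) (he' : e' ∈ atlas E Q)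
    {y u y' u' : Fin (2 * k - 1 + 1) → E} (hy : y 0 ∈ e.target) (hy' : y' 0 ∈ e'.target)
    (h : (ofCoords e y : JetSpace E Q (2 * k - 1)) = ofCoords e' y')
    (hu : IsMotion L hk e y u) (hu' : IsMotion L hk e' y' u') :
    frame (2 * k - 1) e y u = frame (2 * k - 1) e' y' u' := by
  -- Both velocities solve the same equation i(u)ω_L = dE, which mentions no chart, so nondegeneracy
  -- identifies them.
  have h1 : ∀ v : Fin (2 * k - 1 + 1) → E, lagrangianTwoForm L (ofCoords e y) (frame _ e y u) v =
      differential (modelT E (2 * k - 1))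
        (fun p => hamiltonian hk L (legendreGraphMap L p)) (ofCoords e y) v := fun v => by
    obtain ⟨v, rfl⟩ := frame_surjective he hy v
    exact hu.lagrangianTwoForm_frame hL he hy v
  have h2 : ∀ v : Fin (2 * k - 1 + 1) → E,
      lagrangianTwoForm L (ofCoords e y) (frame _ e' y' u') v =
      differential (modelT E (2 * k - 1))
        (fun p => hamiltonian hk L (legendreGraphMap L p)) (ofCoords e y) v := fun v => by
    obtain ⟨v, rfl⟩ := frame_surjective he' hy' v
    rw [h]
    exact hu'.lagrangianTwoForm_frame hL he' hy' v
  refine sub_eq_zero.1 (hreg (ofCoords e y) _ fun v => ?_)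
  exact (congrArg (fun A : (Fin (2 * k - 1 + 1) → E) →L[ℝ] ℝ => A v)
    (map_sub (lagrangianTwoForm L (ofCoords e y)) _ _)).trans
      (sub_eq_zero.2 ((h1 v).trans (h2 v).symm))

variable (L) in
/-- The velocities of the motions, in natural coordinates. -/
def localField (hk : 1 ≤ k) (e : OpenPartialHomeomorph Q E) (y : Fin (2 * k - 1 + 1) → E) :
    Fin (2 * k - 1 + 1) → E :=
  ContinuousLinearMap.inverse ((fderiv ℝ (rep e (lagrangianOneForm L)) y).flip -
    fderiv ℝ (rep e (lagrangianOneForm L)) y) (fderiv ℝ (localEnergy L hk e) y)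

/-- The operator is `u ↦ i(u)ω_L`; regularity makes it injective, and the dual has the same
dimension. -/
theorem exists_continuousLinearEquiv_lagrangianTwoForm [FiniteDimensional ℝ E]
    (hL : ContMDiff (modelT E k) 𝓘(ℝ, ℝ) ∞ L) (hreg : IsRegularLagrangian L)
    (he : e ∈ atlas E Q) {y : Fin (2 * k - 1 + 1) → E} (hy : y 0 ∈ e.target) :
    ∃ A : (Fin (2 * k - 1 + 1) → E) ≃L[ℝ] ((Fin (2 * k - 1 + 1) → E) →L[ℝ] ℝ),
      (A : (Fin (2 * k - 1 + 1) → E) →L[ℝ] ((Fin (2 * k - 1 + 1) → E) →L[ℝ] ℝ)) =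
        (fderiv ℝ (rep e (lagrangianOneForm L)) y).flip -
          fderiv ℝ (rep e (lagrangianOneForm L)) y := by
  set B := (fderiv ℝ (rep e (lagrangianOneForm L)) y).flip -
    fderiv ℝ (rep e (lagrangianOneForm L)) y with hB
  have hinj : Function.Injective
      (B : (Fin (2 * k - 1 + 1) → E) →ₗ[ℝ] ((Fin (2 * k - 1 + 1) → E) →L[ℝ] ℝ)) := by
    rw [← LinearMap.ker_eq_bot, LinearMap.ker_eq_bot']
    intro u hu
    refine eq_zero_of_fderiv_lagrangianOneForm hL hreg he hy fun v => ?_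
    have h1 := congrArg (fun A : (Fin (2 * k - 1 + 1) → E) →L[ℝ] ℝ => A v) hu
    exact (sub_eq_zero.1 h1).symm
  have hfin : Module.finrank ℝ (Fin (2 * k - 1 + 1) → E) =
      Module.finrank ℝ ((Fin (2 * k - 1 + 1) → E) →L[ℝ] ℝ) :=
    (Subspace.dual_finrank_eq (K := ℝ) (V := Fin (2 * k - 1 + 1) → E)).symm.trans
      (LinearMap.toContinuousLinearMap
        (𝕜 := ℝ) (E := Fin (2 * k - 1 + 1) → E) (F' := ℝ)).finrank_eq
  exact ⟨(LinearEquiv.ofInjectiveOfFinrankEq _ hinj hfin).toContinuousLinearEquiv, by ext; rfl⟩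

theorem IsMotion.eq_localField [FiniteDimensional ℝ E] {hk : 1 ≤ k}
    (hL : ContMDiff (modelT E k) 𝓘(ℝ, ℝ) ∞ L) (hreg : IsRegularLagrangian L) (he : e ∈ atlas E Q)
    {y u : Fin (2 * k - 1 + 1) → E} (hy : y 0 ∈ e.target) (hu : IsMotion L hk e y u) :
    localField L hk e y = u := by
  obtain ⟨A, hA⟩ := exists_continuousLinearEquiv_lagrangianTwoForm hL hreg he hy
  rw [localField, ← hA, ContinuousLinearMap.inverse_equiv]
  refine A.symm_apply_eq.2 ?_
  ext v
  rw [← hu.fderiv_sub hL he hy v]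
  exact congrArg (fun B : (Fin (2 * k - 1 + 1) → E) →L[ℝ] ((Fin (2 * k - 1 + 1) → E) →L[ℝ] ℝ) =>
    B u v) hA.symm

theorem isMotion_localField [FiniteDimensional ℝ E] (hk : 1 ≤ k)
    (hL : ContMDiff (modelT E k) 𝓘(ℝ, ℝ) ∞ L) (hreg : IsRegularLagrangian L) (he : e ∈ atlas E Q)
    {y : Fin (2 * k - 1 + 1) → E} (hy : y 0 ∈ e.target) :
    IsMotion L hk e y (localField L hk e y) := by
  obtain ⟨u, hu, -⟩ := exists_isMotion hk hL hreg he hy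
  rwa [hu.eq_localField hL hreg he hy]

/-- `IsMotion` alone prescribes only the components of order below `k`. The remaining ones are known
because the unique motion must be the one built in `exists_isMotion`. -/
theorem truncL_localField [FiniteDimensional ℝ E] (hk : 1 ≤ k)
    (hL : ContMDiff (modelT E k) 𝓘(ℝ, ℝ) ∞ L) (hreg : IsRegularLagrangian L) (he : e ∈ atlas E Q)
    {y : Fin (2 * k - 1 + 1) → E} (hy : y 0 ∈ e.target) :
    truncL (show 2 * k - 2 ≤ 2 * k - 1 by omega) (localField L hk e y) =
      shiftL (show 2 * k - 2 + 1 ≤ 2 * k - 1 by omega) y := by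
  obtain ⟨u, hu, hu'⟩ := exists_isMotion hk hL hreg he hy
  rwa [hu.eq_localField hL hreg he hy]

theorem contDiffAt_localField [FiniteDimensional ℝ E] (hk : 1 ≤ k)
    (hL : ContMDiff (modelT E k) 𝓘(ℝ, ℝ) ∞ L) (hreg : IsRegularLagrangian L) (he : e ∈ atlas E Q)
    {y : Fin (2 * k - 1 + 1) → E} (hy : y 0 ∈ e.target) :
    ContDiffAt ℝ ∞ (localField L hk e) y := by
  have : CompleteSpace E := FiniteDimensional.complete ℝ E
  obtain ⟨A, hA⟩ := exists_continuousLinearEquiv_lagrangianTwoForm hL hreg he hy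
  have h1 : ContDiffAt ℝ ∞ (fderiv ℝ (rep e (lagrangianOneForm L))) y :=
    (isSmoothForm_lagrangianOneForm hL e he y hy).fderiv_right (by simp)
  have h2 : ContDiffAt ℝ ∞ (fderiv ℝ (localEnergy L hk e)) y :=
    (contDiffAt_localEnergy hk hL he hy).fderiv_right (by simp)
  exact contDiffAt_inverse_flip_sub h1 h2 hA

end Dynamics

/-! ### Integral curves: smoothness and iterated derivatives -/

section Bootstrap

/-- Bootstrap: if `y` is of class `C^n`, then so is its derivative `F ∘ y`, and `y` is of class
`C^(n+1)`. -/
theorem contDiffOn_of_hasDerivAt_comp {V : Type*} [NormedAddCommGroup V] [NormedSpace ℝ V]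
    {F : V → V} {U : Set V} (hF : ∀ z ∈ U, ContDiffAt ℝ ∞ F z) {S : Set ℝ} (hS : IsOpen S)
    {y : ℝ → V} (hU : ∀ s ∈ S, y s ∈ U) (hy : ∀ s ∈ S, HasDerivAt y (F (y s)) s) :
    ContDiffOn ℝ ∞ y S := by
  rw [contDiffOn_infty]
  intro n
  induction n with
  | zero =>
    exact contDiffOn_zero.2 fun s hs => (hy s hs).continuousAt.continuousWithinAt
  | succ n ih =>
    rw [Nat.cast_add, Nat.cast_one, contDiffOn_succ_iff_deriv_of_isOpen hS]
    refine ⟨fun s hs => (hy s hs).differentiableAt.differentiableWithinAt, by simp, ?_⟩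
    refine ContDiffOn.congr (f := F ∘ y) (fun s hs => ?_) fun s hs => (hy s hs).deriv
    exact ((hF _ (hU s hs)).of_le (by exact_mod_cast le_top)).comp_contDiffWithinAt s (ih s hs)

theorem iteratedDeriv_eq_of_hasDerivAt {E : Type*} [NormedAddCommGroup E] [NormedSpace ℝ E]
    {m : ℕ} {S : Set ℝ} (hS : IsOpen S) {y u : ℝ → Fin (m + 1) → E}
    (hy : ∀ s ∈ S, HasDerivAt y (u s) s)
    (hu : ∀ s ∈ S, ∀ (i : ℕ) (hi : i + 1 < m + 1), u s ⟨i, by omega⟩ = y s ⟨i + 1, hi⟩) :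
    ∀ (i : ℕ) (hi : i < m + 1), ∀ s ∈ S, iteratedDeriv i (fun s => y s 0) s = y s ⟨i, hi⟩ := by
  intro i
  induction i with
  | zero => intro _ s _; simp
  | succ i ih =>
    intro hi s hs
    have hev : iteratedDeriv i (fun s => y s 0) =ᶠ[𝓝 s] fun s => y s ⟨i, by omega⟩ :=
      (hS.mem_nhds hs : S ∈ 𝓝 s) |> fun h => Filter.mem_of_superset h fun t ht => ih (by omega) t ht
    rw [iteratedDeriv_succ, hev.deriv_eq, (hasDerivAt_pi.1 (hy s hs) ⟨i, by omega⟩).deriv, hu s hs]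

end Bootstrap

/-! ### The velocity field on T^{2k-1}Q and its integral curves -/

section Dynamics

variable {E : Type*} [NormedAddCommGroup E] [NormedSpace ℝ E]
  {Q : Type*} [TopologicalSpace Q] [ChartedSpace E Q] [IsManifold 𝓘(ℝ, E) ∞ Q]

open JetSpace

variable {k : ℕ} {e : OpenPartialHomeomorph Q E} {L : JetSpace E Q k → ℝ}

theorem frame_self_apply (p : JetSpace E Q k) (v : Fin (k + 1) → E) :
    frame k (chartAt E p.base) (coords (chartAt E p.base) p) v = v := by
  rw [frame_self]; rfl

/-- The unified dynamical equation for a tangent vector to the graph of `FL`, in natural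
coordinates. -/
theorem unifiedEquation_iff (hk : 1 ≤ k) (hL : ContMDiff (modelT E k) 𝓘(ℝ, ℝ) ∞ L)
    (p : JetSpace E Q (2 * k - 1)) (u : Fin (2 * k - 1 + 1) → E) :
    (∀ v : (Fin (2 * k - 1 + 1) → E) × ((Fin (k - 1 + 1) → E) →L[ℝ] ℝ),
      unifiedTwoForm E Q k (legendreGraphMap L p)
        (mfderiv (modelT E (2 * k - 1)) (modelW E k) (legendreGraphMap L) p u) v =
      differential (modelW E k) (hamiltonian hk L) (legendreGraphMap L p) v) ↔
    IsMotion L hk (chartAt E p.base) (coords (chartAt E p.base) p) u := by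
  have he : chartAt E p.base ∈ atlas E Q := chart_mem_atlas E _
  have hp : p.base ∈ (chartAt E p.base).source := mem_chart_source E _
  have h₁ : k - 1 + 1 ≤ 2 * k - 1 := by omega
  have h₂ : k ≤ 2 * k - 1 := by omega
  have hΩ : ∀ v : (Fin (2 * k - 1 + 1) → E) × ((Fin (k - 1 + 1) → E) →L[ℝ] ℝ),
      unifiedTwoForm E Q k (legendreGraphMap L p)
        (mfderiv (modelT E (2 * k - 1)) (modelW E k) (legendreGraphMap L) p u) v =
      v.2 (truncL (pred_le_two_mul_pred k) u) -
        fderiv ℝ (rep (chartAt E p.base) (lagrangianOneForm L)) (coords (chartAt E p.base) p) u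
          v.1 := fun v => by
    rw [← fderiv_rep_lagrangianOneForm_padL hk hL he (coords_zero_mem hp) u v.1]
    exact (congrArg (fun z : (Fin (2 * k - 1 + 1) → E) × ((Fin (k - 1 + 1) → E) →L[ℝ] ℝ) =>
      unifiedTwoForm E Q k (legendreGraphMap L p) z v)
      (mfderiv_legendreGraphMap hk hL p u)).trans
        (unifiedTwoForm_apply (legendreGraphMap L p) (u, _) v)
  have hH : ∀ v : (Fin (2 * k - 1 + 1) → E) × ((Fin (k - 1 + 1) → E) →L[ℝ] ℝ),
      differential (modelW E k) (hamiltonian hk L) (legendreGraphMap L p) v =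
      v.2 (shiftL h₁ (coords (chartAt E p.base) p)) +
        rep (chartAt E p.base) (lagrangianOneForm L) (coords (chartAt E p.base) p)
          (padL (shiftL h₁ v.1)) -
        fderiv ℝ (L ∘ ofCoords (chartAt E p.base)) (truncL h₂ (coords (chartAt E p.base) p))
          (truncL h₂ v.1) := fun v => by
    have h := differential_hamiltonian hk hL (w := legendreGraphMap L p)
      (e := chartAt E p.base) rfl h₁ h₂ v
    rw [momentum_legendreGraphMap hk hL he hp] at h
    exact h
  constructor
  · intro h
    refine ⟨?_, fun v => ?_⟩
    -- Test vectors with zero position part: continuous functionals separate points.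
    · by_contra hne
      obtain ⟨a, ha⟩ := SeparatingDual.exists_ne_zero (R := ℝ) (sub_ne_zero.2 hne)
      have h1 := h (0, a)
      rw [hΩ, hH] at h1
      simp only [map_zero, sub_zero, add_zero] at h1
      exact ha (by rw [map_sub, h1, sub_self])
    -- Test vectors with zero momentum part.
    · have h1 := h (v, 0)
      rw [hΩ, hH] at h1
      simp only [_root_.zero_apply, zero_sub, zero_add] at h1
      linarith
  · intro h v
    rw [hΩ, hH, h.truncL_eq, ← h.equation v.1]
    ring

variable (L) in
/-- The velocity field on `T^{2k-1} Q` of the motions. -/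
def evolution (hk : 1 ≤ k) (p : JetSpace E Q (2 * k - 1)) : Fin (2 * k - 1 + 1) → E :=
  localField L hk (chartAt E p.base) (coords (chartAt E p.base) p)

/-- Pointwise definition through the chart at `p` is harmless: both sides are motions at the same
jet, read in two charts. -/
theorem evolution_eq [FiniteDimensional ℝ E] (hk : 1 ≤ k)
    (hL : ContMDiff (modelT E k) 𝓘(ℝ, ℝ) ∞ L) (hreg : IsRegularLagrangian L)
    (he : e ∈ atlas E Q) {p : JetSpace E Q (2 * k - 1)} (hp : p.base ∈ e.source) :
    evolution L hk p = frame (2 * k - 1) e (coords e p) (localField L hk e (coords e p)) := by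
  have he' : chartAt E p.base ∈ atlas E Q := chart_mem_atlas E _
  have hp' : p.base ∈ (chartAt E p.base).source := mem_chart_source E _
  refine (frame_self_apply p _).symm.trans ?_
  exact IsMotion.frame_eq hL hreg he' he (coords_zero_mem hp') (coords_zero_mem hp)
    ((ofCoords_coords he' hp').trans (ofCoords_coords he hp).symm)
    (isMotion_localField hk hL hreg he' (coords_zero_mem hp'))
    (isMotion_localField hk hL hreg he (coords_zero_mem hp))

theorem mfderiv_coords_evolution [FiniteDimensional ℝ E] (hk : 1 ≤ k)
    (hL : ContMDiff (modelT E k) 𝓘(ℝ, ℝ) ∞ L) (hreg : IsRegularLagrangian L)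
    (he : e ∈ atlas E Q) {p : JetSpace E Q (2 * k - 1)} (hp : p.base ∈ e.source) :
    (mfderiv (modelT E (2 * k - 1)) 𝓘(ℝ, Fin (2 * k - 1 + 1) → E) (coords e) p
      (evolution L hk p) : Fin (2 * k - 1 + 1) → E) = localField L hk e (coords e p) := by
  have h := mfderiv_coords_frame (Q := Q) he (coords_zero_mem hp) (localField L hk e (coords e p))
  rw [← evolution_eq hk hL hreg he hp, ofCoords_coords he hp] at h
  exact h

theorem contMDiff_evolution [FiniteDimensional ℝ E] (hk : 1 ≤ k)
    (hL : ContMDiff (modelT E k) 𝓘(ℝ, ℝ) ∞ L) (hreg : IsRegularLagrangian L) :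
    ContMDiff (modelT E (2 * k - 1)) (modelT E (2 * k - 1)).tangent ∞
      (fun p : JetSpace E Q (2 * k - 1) =>
        (⟨p, evolution L hk p⟩ : TangentBundle (modelT E (2 * k - 1)) (JetSpace E Q (2 * k - 1)))) := by
  intro p
  have he : chartAt E p.base ∈ atlas E Q := chart_mem_atlas E _
  have hp : p.base ∈ (chartAt E p.base).source := mem_chart_source E _
  rw [contMDiffAt_totalSpace]
  refine ⟨contMDiffAt_id, ?_⟩
  refine ((contDiffAt_localField hk hL hreg he (coords_zero_mem hp)).contMDiffAt.comp p
    (contMDiffAt_coords he hp)).congr_of_eventuallyEq ?_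
  filter_upwards [eventually_base_mem he hp] with p' hp'
  have hs : p' ∈ (chartAt (Fin (2 * k - 1 + 1) → E) p).source := hp'
  have h1 := TangentBundle.continuousLinearMapAt_trivializationAt (I := modelT E (2 * k - 1)) hs
  have hb : p' ∈ (trivializationAt (Fin (2 * k - 1 + 1) → E)
      (TangentSpace (modelT E (2 * k - 1))) p).baseSet := hs
  have h2 := congrFun (Trivialization.coe_linearMapAt_of_mem (R := ℝ)
    (trivializationAt (Fin (2 * k - 1 + 1) → E) (TangentSpace (modelT E (2 * k - 1))) p) hb)
    (evolution L hk p')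
  refine h2.symm.trans ((congrArg (fun A : (Fin (2 * k - 1 + 1) → E) →L[ℝ]
    (Fin (2 * k - 1 + 1) → E) => A (evolution L hk p')) h1).trans ?_)
  exact mfderiv_coords_evolution hk hL hreg he hp'

/-- In a chart each coordinate of the curve is the derivative of the preceding one, so all of them
are the iterated derivatives of the base curve. -/
theorem lift_base_eq_of_hasMFDerivAt [FiniteDimensional ℝ E] (hk : 1 ≤ k)
    (hL : ContMDiff (modelT E k) 𝓘(ℝ, ℝ) ∞ L) (hreg : IsRegularLagrangian L)
    {p : ℝ → JetSpace E Q (2 * k - 1)} {J : Set ℝ} (hJ : IsOpen J)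
    (h : ∀ t ∈ J, HasMFDerivAt 𝓘(ℝ, ℝ) (modelT E (2 * k - 1)) p t
      ((1 : ℝ →L[ℝ] ℝ).smulRight (evolution L hk (p t)))) {t : ℝ} (ht : t ∈ J) :
    lift E (2 * k - 1) (fun s => (p s).base) t = p t := by
  set e := chartAt E (p t).base with he_def
  have he : e ∈ atlas E Q := chart_mem_atlas E _
  have hpt : (p t).base ∈ e.source := mem_chart_source E _
  -- Restrict to times at which the curve stays in a single natural chart.
  obtain ⟨S, hSsub, hS, htS⟩ := mem_nhds_iff.1 (Filter.inter_mem (hJ.mem_nhds ht)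
    ((h t ht).continuousAt.eventually (eventually_base_mem he hpt)))
  have hder : ∀ s ∈ S, HasDerivAt (fun s => coords e (p s)) (localField L hk e (coords e (p s))) s :=
    fun s hs => by
      have hps : (p s).base ∈ e.source := (hSsub hs).2
      have h1 := ((contMDiffAt_coords he hps).mdifferentiableAt (by simp)).hasMFDerivAt.comp s
        (h s (hSsub hs).1)
      let A : (Fin (2 * k - 1 + 1) → E) →L[ℝ] (Fin (2 * k - 1 + 1) → E) :=
        mfderiv (modelT E (2 * k - 1)) 𝓘(ℝ, Fin (2 * k - 1 + 1) → E) (coords e) (p s)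
      have h2 : HasFDerivAt (coords e ∘ p)
          (A.comp ((1 : ℝ →L[ℝ] ℝ).smulRight (evolution L hk (p s)))) s :=
        hasMFDerivAt_iff_hasFDerivAt.1 h1
      have h3 : A.comp ((1 : ℝ →L[ℝ] ℝ).smulRight (evolution L hk (p s))) 1 =
          localField L hk e (coords e (p s)) :=
        (congrArg A (one_smul ℝ (evolution L hk (p s)))).trans
          (mfderiv_coords_evolution hk hL hreg he hps)
      exact h3 ▸ h2.hasDerivAt
  have hsm := contDiffOn_of_hasDerivAt_comp (U := {y : Fin (2 * k - 1 + 1) → E | y 0 ∈ e.target})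
    (fun z hz => contDiffAt_localField hk hL hreg he hz) hS
    (fun s hs => coords_zero_mem (hSsub hs).2) hder
  have hit := iteratedDeriv_eq_of_hasDerivAt hS hder (fun s hs i hi => congrFun
    (truncL_localField hk hL hreg he (coords_zero_mem (hSsub hs).2)) ⟨i, by omega⟩)
  have hbase : ∀ s ∈ S, (p s).base = e.symm (coords e (p s) 0) := fun s hs => by
    rw [coords_zero, e.left_inv (hSsub hs).2]
  -- Without this `lift` would return its default value, the jet of a constant curve. The integral
  -- curve is only assumed differentiable, so smoothness comes from the bootstrap.
  have hnear : IsSmoothNear E (fun s => (p s).base) t := by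
    filter_upwards [hS.mem_nhds htS] with s hs
    have hc : ContDiffAt ℝ ∞ (fun s => coords e (p s) 0) s :=
      contDiffAt_pi.1 (hsm.contDiffAt (hS.mem_nhds hs)) 0
    refine ContMDiffAt.congr_of_eventuallyEq (ContMDiffAt.comp s (g := e.symm)
      (contMDiffAt_symm_of_mem_maximalAtlas (IsManifold.subset_maximalAtlas he)
        (coords_zero_mem (hSsub hs).2)) hc.contMDiffAt) ?_
    filter_upwards [hS.mem_nhds hs] with s' hs'
    exact hbase s' hs'
  refine ext_coords he (by rwa [base_lift]) hpt (funext fun i => ?_)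
  rw [coords_lift he hnear hpt]
  have hev : e ∘ (fun s => (p s).base) = fun s => coords e (p s) 0 :=
    funext fun s => (coords_zero e (p s)).symm
  rw [hev]
  exact hit i i.2 t htS

end Dynamics

/-! ### Existence, uniqueness and the semispray property on the graph -/

section Dynamics

variable {E : Type*} [NormedAddCommGroup E] [NormedSpace ℝ E]
  {Q : Type*} [TopologicalSpace Q] [ChartedSpace E Q] [IsManifold 𝓘(ℝ, E) ∞ Q]

open JetSpace

variable {k : ℕ} {L : JetSpace E Q k → ℝ}

variable (L) in
/-- The solution of the unified dynamical equation: the image of the velocity field of the motions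
by the differential of `p ↦ (p, FL(p))`. -/
def unifiedField (hk : 1 ≤ k) : FieldAlongGraph L := fun w =>
  show (Fin (2 * k - 1 + 1) → E) × ((Fin (k - 1 + 1) → E) →L[ℝ] ℝ) from
    mfderiv (modelT E (2 * k - 1)) (modelW E k) (legendreGraphMap L)
      (pr₁ (w : UnifiedSpace E Q k)) (evolution L hk (pr₁ (w : UnifiedSpace E Q k)))

theorem isSmooth_unifiedField [FiniteDimensional ℝ E] (hk : 1 ≤ k)
    (hL : ContMDiff (modelT E k) 𝓘(ℝ, ℝ) ∞ L) (hreg : IsRegularLagrangian L) :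
    (unifiedField L hk).IsSmooth :=
  ((contMDiff_legendreGraphMap hk hL).contMDiff_tangentMap (m := ∞) (by simp)).comp
    (contMDiff_evolution hk hL hreg)

theorem isTangent_unifiedField (hk : 1 ≤ k) : (unifiedField L hk).IsTangent :=
  fun p => ⟨evolution L hk p, rfl⟩

theorem isSolution_unifiedField [FiniteDimensional ℝ E] (hk : 1 ≤ k)
    (hL : ContMDiff (modelT E k) 𝓘(ℝ, ℝ) ∞ L) (hreg : IsRegularLagrangian L) :
    (unifiedField L hk).IsSolution hk := by
  rintro ⟨_, p, rfl⟩ v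
  exact (unifiedEquation_iff hk hL p _).2 (isMotion_localField hk hL hreg (chart_mem_atlas E _)
    (coords_zero_mem (mem_chart_source E _))) v

/-- Tangency gives a velocity on T^{2k-1}Q, the equation makes it a motion, and motions are unique
by regularity. -/
theorem unifiedField_unique [FiniteDimensional ℝ E] (hk : 1 ≤ k)
    (hL : ContMDiff (modelT E k) 𝓘(ℝ, ℝ) ∞ L) (hreg : IsRegularLagrangian L)
    {Y : FieldAlongGraph L} (hY : Y.IsTangent) (hY' : Y.IsSolution hk) :
    Y = unifiedField L hk := by
  funext ⟨w, p, hp⟩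
  subst hp
  obtain ⟨u, hu⟩ := hY p
  have h1 : IsMotion L hk (chartAt E p.base) (coords (chartAt E p.base) p) u :=
    (unifiedEquation_iff hk hL p u).1 fun v => by
      have h := hY' ⟨legendreGraphMap L p, mem_range_self p⟩ v
      rw [hu] at h
      exact h
  have h2 := h1.eq_localField hL hreg (chart_mem_atlas E _)
    (coords_zero_mem (mem_chart_source E _))
  refine hu.trans ?_
  rw [← h2]
  rfl

theorem isSemispray_unifiedField [FiniteDimensional ℝ E] (hk : 1 ≤ k)
    (hL : ContMDiff (modelT E k) 𝓘(ℝ, ℝ) ∞ L) (hreg : IsRegularLagrangian L) :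
    (unifiedField L hk).IsSemispray 1 le_rfl := by
  intro σ J hJ _ hσ t ht
  have h : ∀ s ∈ J, HasMFDerivAt 𝓘(ℝ, ℝ) (modelT E (2 * k - 1)) (fun s => pr₁ (σ s)) s
      ((1 : ℝ →L[ℝ] ℝ).smulRight (evolution L hk (pr₁ (σ s)))) := fun s hs => by
    obtain ⟨⟨p, hp⟩, hs'⟩ := hσ s hs
    refine ((hasMFDerivAt_pr₁ (σ s)).comp s hs').congr_mfderiv ?_
    have h1 : (unifiedField L hk ⟨σ s, ⟨p, hp⟩⟩ :
        (Fin (2 * k - 1 + 1) → E) × ((Fin (k - 1 + 1) → E) →L[ℝ] ℝ)).1 =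
        evolution L hk (pr₁ (σ s)) :=
      congrArg Prod.fst (mfderiv_legendreGraphMap hk hL (pr₁ (σ s)) (evolution L hk (pr₁ (σ s))))
    refine ContinuousLinearMap.ext fun c => ?_
    exact congrArg (fun z : Fin (2 * k - 1 + 1) → E => (show ℝ from c) • z) h1
  rw [lift_base_eq_of_hasMFDerivAt hk hL hreg hJ h ht]
  -- For type 1 the remaining projection goes from T^{2k-1}Q to itself, and it is the identity in
  -- coordinates.
  refine ext_coords (chart_mem_atlas E (pr₁ (σ t)).base) (mem_chart_source E _)
    (by rw [base_proj]; exact mem_chart_source E _) (funext fun i => ?_)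
  rw [coords_proj_eq _ (chart_mem_atlas E _) (mem_chart_source E _)]
  rfl

end Dynamics

end SkinnerRusk

end

theorem mainTheorem4 {E : Type*} [NormedAddCommGroup E] [NormedSpace ℝ E] [FiniteDimensional ℝ E]
    {Q : Type*} [TopologicalSpace Q] [ChartedSpace E Q] [IsManifold 𝓘(ℝ, E) ∞ Q]
    (k : ℕ) (hk : 1 ≤ k) (L : JetSpace E Q k → ℝ)
    (hL : ContMDiff (modelT E k) 𝓘(ℝ, ℝ) ∞ L) (hreg : IsRegularLagrangian L) :
    ∃ X : FieldAlongGraph L,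
      (X.IsSmooth ∧ X.IsTangent ∧ X.IsSolution hk) ∧ X.IsSemispray 1 le_rfl ∧
        ∀ Y : FieldAlongGraph L, Y.IsSmooth ∧ Y.IsTangent ∧ Y.IsSolution hk → Y = X :=
  ⟨unifiedField L hk, ⟨isSmooth_unifiedField hk hL hreg, isTangent_unifiedField hk,
    isSolution_unifiedField hk hL hreg⟩, isSemispray_unifiedField hk hL hreg,
    fun _ hY => unifiedField_unique hk hL hreg hY.2.1 hY.2.2⟩
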